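/- **Definitions.** A virtual knot diagram is an oriented closed curve in the plane whose transverse double points are classical crossings (with over/under information) or virtual crossings; two diagrams present the same virtual knot if they are related by the classical and virtual Reidemeister moves. The virtual crossing number $v(K)$ is the least number of virtual crossings in a diagram of $K$. Its signed Gauss code lists the passages through the classical crossings met along the knot: $O_i^{\pm}$ (over) or $U_i^{\pm}$ (under), where $i$ names the crossing and $\pm$ is its sign; virtual crossings are not recorded. The arrow polynomial of a diagram $D$ is $$\langle D\rangle_A=\sum_S A^{\alpha(S)-\beta(S)}\,(-A^2-A^{-2})^{|S|-1}\prod_{C\in S}K_{n(C)}\in\mathbb Z[A^{\pm1},K_1,K_2,\dots],\qquad K_0=1.$$ Here $S$ runs over the states of $D$, obtained by smoothing every classical crossing; at a positive crossing the oriented smoothing has weight $A$ and the disoriented one $A^{-1}$, and at a negative crossing the weights are interchanged; $\alpha(S)$ and $\beta(S)$ count the smoothings of weight $A$ and $A^{-1}$; $|S|$ is the number of closed loops. A disoriented smoothing creates two cusps, each marked by a nodal arrow; two consecutive nodal arrows on a loop cancel if the acute angles of their cusps lie on the same side of the loop, and $2n(C)$ is the number of arrows left on the loop $C$. The normalized arrow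 polynomial is $\langle D\rangle_{NA}=(-A^3)^{-w(D)}\langle D\rangle_A$, where $w(D)$ is the writhe. The k-degree of a monomial $A^mK_{i_1}^{p_1}\cdots K_{i_r}^{p_r}$ is $i_1p_1+\dots+i_rp_r$, and the maximum k-degree of a polynomial is the maximum over its nonzero terms. **Statement.** For $1\le n\le 108$ let $4.n$ be the virtual knot (with four classical crossings) in Green's table of virtual knots, given by the Gauss code in the list below; there are virtual knot diagrams with this Gauss code. Let $D$ be any such diagram, and let $P_n$ and $b_n$ be the polynomial and the integer listed after the code. Then 1. $\langle D\rangle_A=P_n$; 2. the maximum k-degree of $\langle D\rangle_A$ is $b_n$, it is a lower bound $b_n\le v(4.n)$ for the virtual crossing number, and $b_n\le 3$; 3. $\langle D\rangle_A=1$ if and only if $n\in\{46,72,98,107\}$, and likewise $\langle D\rangle_{NA}=1$ if and only if $n\in\{46,72,98,107\}$. The list (knot; Gauss code; $P_n$; $b_n$): - $4.1$: $O_1^{-}O_2^{-}U_1^{-}U_2^{-}O_3^{-}O_4^{-}U_3^{-}U_4^{-}$; $A^{8}K_{1}^{2}-3K_{1}^{2}+2-2A^{4}K_{1}^{2}+2K_{2}-2A^{2}K_{1}+2A^{-2}K_{1}+A^{-4}$;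 $2$ - $4.2$: $O_1^{-}O_2^{-}U_1^{-}U_2^{-}O_3^{+}O_4^{+}U_3^{+}U_4^{+}$; $-A^{6}K_{1}-A^{4}K_{1}^{2}+2K_{2}+3-2K_{1}^{2}+A^{2}K_{1}+A^{-2}K_{1}-A^{-4}K_{1}^{2}-A^{-6}K_{1}$; $2$ - $4.3$: $O_1^{-}O_2^{-}U_1^{-}U_2^{-}O_3^{-}U_4^{-}U_3^{-}O_4^{-}$; $A^{8}K_{1}^{2}-A^{4}-K_{1}^{2}+1-2A^{2}K_{1}-A^{4}K_{2}+K_{2}+2A^{-2}K_{1}+A^{-4}$; $2$ - $4.4$: $O_1^{-}O_2^{-}U_1^{-}U_2^{-}O_3^{-}U_4^{+}U_3^{-}O_4^{+}$; $A^{2}-A^{4}K_{1}-2A^{2}K_{1}^{2}-2A^{-2}K_{1}^{2}+A^{-2}K_{2}+A^{2}K_{2}+2A^{-2}+K_{1}$; $2$ - $4.5$: $O_1^{-}O_2^{-}U_1^{-}U_2^{-}O_3^{+}U_4^{-}U_3^{+}O_4^{-}$; $-A^{4}K_{1}+A^{2}-2A^{2}K_{1}^{2}-2A^{-2}K_{1}^{2}+A^{-2}K_{2}+A^{2}K_{2}+K_{1}+2A^{-2}$;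 $2$ - $4.6$: $O_1^{-}O_2^{-}U_1^{-}U_2^{-}O_3^{+}U_4^{+}U_3^{+}O_4^{+}$; $-A^{6}K_{1}-A^{4}K_{1}^{2}+K_{2}+A^{-4}K_{1}^{2}-A^{-4}K_{2}+A^{2}K_{1}+2+A^{-2}K_{1}-A^{-4}-A^{-6}K_{1}$; $2$ - $4.7$: $O_1^{-}O_2^{-}U_1^{-}U_2^{-}U_3^{-}U_4^{-}O_3^{-}O_4^{-}$; $A^{8}K_{1}^{2}-3K_{1}^{2}+2K_{2}-2A^{4}K_{1}^{2}+2-2A^{2}K_{1}+2A^{-2}K_{1}+A^{-4}$; $2$ - $4.8$: $O_1^{-}O_2^{-}U_1^{-}U_2^{-}U_3^{+}U_4^{+}O_3^{+}O_4^{+}$; $-A^{6}K_{1}-A^{4}K_{1}^{2}+3+2K_{2}-2K_{1}^{2}+A^{2}K_{1}+A^{-2}K_{1}-A^{-4}K_{1}^{2}-A^{-6}K_{1}$; $2$ - $4.9$: $O_1^{-}O_2^{-}U_1^{-}O_3^{-}U_2^{-}O_4^{-}U_3^{-}U_4^{-}$; $-A^{4}-A^{2}K_{1}+A^{-2}K_{1}+A^{-4}+1$;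 $1$ - $4.10$: $O_1^{-}O_2^{-}U_1^{-}O_3^{-}U_2^{-}O_4^{+}U_3^{-}U_4^{+}$; $-A^{6}-A^{4}K_{1}+2A^{2}+2K_{1}+A^{-2}-A^{2}K_{1}^{2}-A^{-2}K_{1}^{2}+A^{-2}K_{2}-A^{-4}K_{1}$; $2$ - $4.11$: $O_1^{-}O_2^{-}U_1^{-}O_3^{+}U_2^{-}O_4^{-}U_3^{+}U_4^{-}$; $-A^{-2}K_{1}^{2}+A^{2}-A^{4}K_{1}-A^{2}K_{1}^{2}+A^{-2}K_{2}+K_{1}+A^{-2}$; $2$ - $4.12$: $O_1^{-}O_2^{-}U_1^{-}O_3^{+}U_2^{-}O_4^{+}U_3^{+}U_4^{+}$; $-A^{6}K_{1}-A^{4}K_{2}+A^{2}K_{1}+1+2K_{2}-A^{-4}K_{2}+A^{-2}K_{1}-A^{-6}K_{1}$; $2$ - $4.13$: $O_1^{-}O_2^{+}U_1^{-}O_3^{-}U_2^{+}O_4^{+}U_3^{-}U_4^{+}$; $A^{4}-A^{-4}K_{1}^{2}+1-A^{4}K_{1}^{2}-2K_{1}^{2}+2K_{2}+A^{-4}$;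 $2$ - $4.14$: $O_1^{-}O_2^{+}U_1^{-}O_3^{+}U_2^{+}O_4^{-}U_3^{+}U_4^{-}$; $-A^{6}K_{1}-2A^{-4}K_{1}^{2}+A^{2}K_{1}+2K_{2}+2-2K_{1}^{2}+A^{-4}$; $2$ - $4.15$: $O_1^{-}O_2^{-}U_1^{-}O_3^{-}U_2^{-}U_4^{-}U_3^{-}O_4^{-}$; $K_{2}-A^{4}K_{1}^{2}-K_{1}^{2}+1-A^{2}K_{1}+A^{-2}K_{1}+A^{-4}$; $2$ - $4.16$: $O_1^{-}O_2^{-}U_1^{-}O_3^{-}U_2^{-}U_4^{+}U_3^{-}O_4^{+}$; $-A^{6}-A^{4}K_{1}+A^{2}+2K_{1}+A^{-2}-A^{-4}K_{1}$; $1$ - $4.17$: $O_1^{-}O_2^{-}U_1^{-}O_3^{+}U_2^{-}U_4^{+}U_3^{+}O_4^{+}$; $-A^{6}K_{1}-A^{4}K_{2}+A^{2}K_{1}+2+2K_{2}-A^{-4}K_{1}^{2}-K_{1}^{2}+A^{-2}K_{1}-A^{-6}K_{1}$; $2$ - $4.18$: $O_1^{-}O_2^{+}U_1^{-}O_3^{-}U_2^{+}U_4^{-}U_3^{-}O_4^{-}$;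 $-2A^{-2}K_{1}^{2}-A^{4}K_{1}+A^{2}K_{2}-2A^{2}K_{1}^{2}+2A^{-2}+A^{2}+K_{1}+A^{-2}K_{2}$; $2$ - $4.19$: $O_1^{-}O_2^{+}U_1^{-}O_3^{-}U_2^{+}U_4^{+}U_3^{-}O_4^{+}$; $A^{4}+K_{2}+1-A^{4}K_{1}^{2}-K_{1}^{2}$; $2$ - $4.20$: $O_1^{-}O_2^{+}U_1^{-}O_3^{+}U_2^{+}U_4^{-}U_3^{+}O_4^{-}$; $-A^{6}K_{1}+K_{2}+A^{2}K_{1}+2-A^{-4}K_{1}^{2}-K_{1}^{2}$; $2$ - $4.21$: $O_1^{-}O_2^{+}U_1^{-}O_3^{+}U_2^{+}U_4^{+}U_3^{+}O_4^{+}$; $A^{2}+A^{2}K_{2}-A^{4}K_{1}-A^{2}K_{1}^{2}-2A^{-2}K_{1}^{2}+2A^{-2}+2K_{1}+A^{-2}K_{2}-A^{-4}K_{1}-A^{-6}K_{1}^{2}$; $2$ - $4.22$: $O_1^{-}O_2^{-}U_1^{-}O_3^{+}O_4^{+}U_2^{-}U_3^{+}U_4^{+}$; $-A^{6}K_{1}+A^{2}K_{1}+K_{2}+2-A^{2}K_{1}K_{2}-A^{-2}K_{1}K_{2}-K_{1}^{2}-A^{-4}K_{1}^{2}+A^{2}K_{1}^{3}+2A^{-2}K_{1}^{3}+A^{-6}K_{1}^{3}-A^{-2}K_{1}-A^{-6}K_{1}$;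 $3$ - $4.23$: $O_1^{-}O_2^{+}U_1^{-}O_3^{-}O_4^{-}U_2^{+}U_3^{-}U_4^{-}$; $A^{8}K_{1}-2A^{4}K_{1}+2A^{-2}-A^{2}K_{1}^{2}-A^{-2}K_{1}^{2}+K_{1}+A^{-2}K_{2}$; $2$ - $4.24$: $O_1^{-}O_2^{+}U_1^{-}O_3^{+}O_4^{+}U_2^{+}U_3^{+}U_4^{+}$; $A^{2}-2A^{4}K_{1}+A^{4}K_{1}^{3}+2K_{1}^{3}+A^{-4}K_{1}^{3}-A^{-4}K_{1}+A^{-2}+K_{1}+A^{-2}K_{2}-K_{1}K_{2}-A^{-4}K_{1}K_{2}-A^{-2}K_{1}^{2}-A^{-6}K_{1}^{2}$; $3$ - $4.25$: $O_1^{-}O_2^{-}U_1^{-}O_3^{-}O_4^{-}U_2^{-}U_4^{-}U_3^{-}$; $-A^{6}K_{1}-A^{-2}K_{1}+A^{-6}K_{1}+A^{2}K_{1}-A^{-4}+1+A^{-8}$; $1$ - $4.26$: $O_1^{-}O_2^{-}U_1^{-}O_3^{+}O_4^{+}U_2^{-}U_4^{+}U_3^{+}$; $A^{2}K_{1}-A^{-2}K_{1}K_{2}-A^{2}K_{1}K_{2}+1+A^{-2}K_{3}$;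 $3$ - $4.27$: $O_1^{-}O_2^{+}U_1^{-}O_3^{-}O_4^{-}U_2^{+}U_4^{-}U_3^{-}$; $A^{-6}-A^{-2}+A^{2}-A^{-4}K_{1}+A^{-8}K_{1}$; $1$ - $4.28$: $O_1^{-}O_2^{+}U_1^{-}O_3^{+}O_4^{+}U_2^{+}U_4^{+}U_3^{+}$; $A^{2}+K_{3}+K_{1}-A^{-4}K_{1}K_{2}-K_{1}K_{2}$; $3$ - $4.29$: $O_1^{-}O_2^{-}U_1^{-}O_3^{-}O_4^{-}U_3^{-}U_2^{-}U_4^{-}$; $1-A^{4}K_{1}^{2}-K_{1}^{2}+K_{2}-A^{2}K_{1}+A^{-2}K_{1}+A^{-4}$; $2$ - $4.30$: $O_1^{-}O_2^{-}U_1^{-}O_3^{-}O_4^{+}U_3^{-}U_2^{-}U_4^{+}$; $-2A^{-2}K_{1}^{2}+A^{2}K_{2}+A^{2}-2A^{2}K_{1}^{2}+A^{-2}K_{2}-A^{4}K_{1}+2A^{-2}+K_{1}$; $2$ - $4.31$: $O_1^{-}O_2^{-}U_1^{-}O_3^{+}O_4^{-}U_3^{+}U_2^{-}U_4^{-}$;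 $-A^{6}K_{1}^{2}-2A^{2}K_{1}^{2}+2A^{2}K_{2}-A^{-2}K_{1}^{2}-A^{4}K_{1}+2K_{1}+2A^{-2}+A^{2}-A^{-4}K_{1}$; $2$ - $4.32$: $O_1^{-}O_2^{-}U_1^{-}O_3^{+}O_4^{+}U_3^{+}U_2^{-}U_4^{+}$; $-A^{6}K_{1}+A^{2}K_{1}+3-A^{4}K_{1}^{2}-K_{1}^{2}-A^{-4}+K_{2}+A^{-2}K_{1}-A^{-6}K_{1}$; $2$ - $4.33$: $O_1^{-}O_2^{+}U_1^{-}O_3^{-}O_4^{-}U_3^{-}U_2^{+}U_4^{-}$; $-A^{4}K_{1}+K_{1}+A^{-2}$; $1$ - $4.34$: $O_1^{-}O_2^{+}U_1^{-}O_3^{-}O_4^{+}U_3^{-}U_2^{+}U_4^{+}$; $-A^{6}K_{1}+A^{2}K_{1}+2-A^{-4}K_{1}^{2}+K_{2}-K_{1}^{2}$; $2$ - $4.35$: $O_1^{-}O_2^{+}U_1^{-}O_3^{+}O_4^{-}U_3^{+}U_2^{+}U_4^{-}$; $-K_{1}^{2}-A^{-4}K_{1}^{2}+2+A^{-4}K_{2}$;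 $2$ - $4.36$: $O_1^{-}O_2^{+}U_1^{-}O_3^{+}O_4^{+}U_3^{+}U_2^{+}U_4^{+}$; $A^{2}+2K_{1}-A^{4}K_{1}-A^{-4}K_{1}+A^{-2}K_{2}-A^{-6}K_{2}$; $2$ - $4.37$: $O_1^{-}O_2^{-}U_1^{-}O_3^{-}U_4^{-}U_2^{-}U_3^{-}O_4^{-}$; $K_{2}-A^{4}K_{2}-A^{2}K_{1}+A^{-2}K_{1}+A^{-4}$; $2$ - $4.38$: $O_1^{-}O_2^{-}U_1^{-}O_3^{-}U_4^{+}U_2^{-}U_3^{-}O_4^{+}$; $A^{2}K_{2}-A^{4}K_{1}-A^{2}K_{1}^{2}-A^{-2}K_{1}^{2}+2A^{-2}+K_{1}$; $2$ - $4.39$: $O_1^{-}O_2^{-}U_1^{-}O_3^{+}U_4^{-}U_2^{-}U_3^{+}O_4^{-}$; $A^{2}K_{2}-A^{4}K_{1}K_{2}-K_{1}K_{2}-A^{2}K_{1}^{2}-A^{-2}K_{1}^{2}-A^{4}K_{1}+2A^{-2}-A^{-4}K_{1}+A^{4}K_{1}^{3}+2K_{1}^{3}+A^{-4}K_{1}^{3}$;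 $3$ - $4.40$: $O_1^{-}O_2^{-}U_1^{-}O_3^{+}U_4^{+}U_2^{-}U_3^{+}O_4^{+}$; $-A^{6}K_{1}-A^{-4}+2+A^{2}K_{1}$; $1$ - $4.41$: $O_1^{-}O_2^{+}U_1^{-}O_3^{-}U_4^{-}U_2^{+}U_3^{-}O_4^{-}$; $A^{8}K_{1}-2A^{4}K_{1}-A^{2}+K_{1}+2A^{-2}$; $1$ - $4.42$: $O_1^{-}O_2^{+}U_1^{-}O_3^{+}U_4^{-}U_2^{+}U_3^{+}O_4^{-}$; $-A^{6}K_{1}+A^{6}K_{1}^{3}+2A^{2}K_{1}^{3}+A^{-2}K_{1}^{3}-A^{2}K_{1}+2-A^{2}K_{1}K_{2}-A^{-2}K_{1}K_{2}-K_{1}^{2}-A^{-4}K_{1}^{2}+A^{-4}K_{2}$; $3$ - $4.43$: $O_1^{-}O_2^{-}U_1^{-}O_3^{-}U_4^{-}U_2^{-}O_4^{-}U_3^{-}$; $-A^{6}K_{1}-A^{-2}K_{1}+A^{-6}K_{1}+A^{2}K_{1}-A^{-4}+1+A^{-8}$; $1$ - $4.44$: $O_1^{-}O_2^{-}U_1^{-}O_3^{-}U_4^{+}U_2^{-}O_4^{+}U_3^{-}$;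 $-A^{4}K_{1}+A^{-2}+K_{1}$; $1$ - $4.45$: $O_1^{-}O_2^{-}U_1^{-}O_3^{+}U_4^{-}U_2^{-}O_4^{-}U_3^{+}$; $-K_{1}K_{2}-A^{4}K_{1}K_{2}+K_{1}+K_{3}+A^{-2}$; $3$ - $4.46$: $O_1^{-}O_2^{-}U_1^{-}O_3^{+}U_4^{+}U_2^{-}O_4^{+}U_3^{+}$; $1$; $0$ - $4.47$: $O_1^{-}O_2^{+}U_1^{-}O_3^{+}U_4^{-}U_2^{+}O_4^{-}U_3^{+}$; $A^{2}K_{3}+1-A^{-2}K_{1}K_{2}-A^{2}K_{1}K_{2}+A^{-2}K_{1}$; $3$ - $4.48$: $O_1^{-}O_2^{-}U_1^{-}O_3^{-}U_4^{-}U_3^{-}U_2^{-}O_4^{-}$; $A^{4}-2A^{4}K_{1}^{2}-2K_{1}^{2}+1+2K_{2}-A^{2}K_{1}+A^{-2}K_{1}+A^{-4}$; $2$ - $4.49$: $O_1^{-}O_2^{-}U_1^{-}O_3^{-}U_4^{+}U_3^{-}U_2^{-}O_4^{+}$; $A^{2}K_{2}-A^{-2}K_{1}^{2}-A^{2}K_{1}^{2}-A^{4}K_{1}+K_{1}+2A^{-2}$;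 $2$ - $4.50$: $O_1^{-}O_2^{-}U_1^{-}O_3^{+}U_4^{-}U_3^{+}U_2^{-}O_4^{-}$; $-A^{6}K_{1}^{2}-A^{2}K_{1}^{2}+A^{2}+2K_{1}+A^{2}K_{2}-A^{4}K_{1}-A^{-4}K_{1}+A^{-2}$; $2$ - $4.51$: $O_1^{-}O_2^{-}U_1^{-}O_3^{+}U_4^{+}U_3^{+}U_2^{-}O_4^{+}$; $-A^{6}K_{1}+A^{2}K_{1}+3-A^{4}K_{1}^{2}-2K_{1}^{2}+2K_{2}-A^{-4}K_{1}^{2}+A^{-2}K_{1}-A^{-6}K_{1}$; $2$ - $4.52$: $O_1^{-}O_2^{+}U_1^{-}O_3^{-}U_4^{+}U_3^{-}U_2^{+}O_4^{+}$; $-A^{6}K_{1}+A^{2}K_{1}+2-A^{-4}$; $1$ - $4.53$: $O_1^{-}O_2^{-}U_1^{-}O_3^{-}U_4^{-}U_3^{-}O_4^{-}U_2^{-}$; $A^{8}-2A^{4}-2A^{2}K_{1}+1+2A^{-2}K_{1}+A^{-4}$; $1$ - $4.54$: $O_1^{-}O_2^{-}U_1^{-}O_3^{-}U_4^{+}U_3^{-}O_4^{+}U_2^{-}$;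 $-A^{6}-A^{4}K_{1}+A^{6}K_{1}^{2}+A^{-2}-A^{2}K_{2}+A^{2}+K_{1}-A^{-2}K_{1}^{2}+A^{-2}K_{2}$; $2$ - $4.55$: $O_1^{-}O_2^{+}U_1^{-}O_3^{-}U_4^{+}U_3^{-}O_4^{+}U_2^{+}$; $A^{4}+2K_{2}+1-A^{4}K_{1}^{2}-2K_{1}^{2}-A^{-4}K_{1}^{2}+A^{-4}$; $2$ - $4.56$: $O_1^{-}O_2^{+}U_1^{-}O_3^{+}U_4^{-}U_3^{+}O_4^{-}U_2^{+}$; $A^{4}+1-A^{4}K_{1}^{2}+2K_{2}-2K_{1}^{2}-A^{-4}K_{1}^{2}+A^{-4}$; $2$ - $4.57$: $O_1^{-}O_2^{-}U_1^{-}U_3^{-}U_2^{-}U_4^{+}O_3^{-}O_4^{+}$; $-A^{6}K_{2}-A^{4}K_{1}+2A^{2}K_{2}+2K_{1}+2A^{-2}-A^{2}K_{1}^{2}-A^{-2}K_{1}^{2}-A^{-4}K_{1}$; $2$ - $4.58$: $O_1^{-}O_2^{-}U_1^{-}U_3^{+}U_2^{-}U_4^{+}O_3^{+}O_4^{+}$;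 $-A^{6}K_{1}+A^{2}K_{1}+3-A^{4}+A^{-2}K_{1}-A^{-4}-A^{-6}K_{1}$; $1$ - $4.59$: $O_1^{-}O_2^{+}U_1^{-}U_3^{-}U_2^{+}U_4^{+}O_3^{-}O_4^{+}$; $A^{4}K_{2}-A^{-4}K_{1}^{2}-A^{4}K_{1}^{2}-2K_{1}^{2}+3+A^{-4}K_{2}$; $2$ - $4.60$: $O_1^{-}O_2^{+}U_1^{-}U_3^{+}U_2^{+}U_4^{-}O_3^{+}O_4^{-}$; $-A^{6}K_{1}-2A^{-4}K_{1}^{2}+A^{2}K_{1}+3+K_{2}-2K_{1}^{2}+A^{-4}K_{2}$; $2$ - $4.61$: $O_1^{-}O_2^{-}U_1^{-}U_3^{-}O_4^{-}U_2^{-}O_3^{-}U_4^{-}$; $1-A^{4}-A^{2}K_{1}+A^{-2}K_{1}+A^{-4}$; $1$ - $4.62$: $O_1^{-}O_2^{-}U_1^{-}U_3^{-}O_4^{+}U_2^{-}O_3^{-}U_4^{+}$; $A^{2}-A^{4}K_{1}K_{2}-K_{1}K_{2}-A^{2}K_{1}^{2}-A^{-2}K_{1}^{2}-A^{4}K_{1}+A^{-2}K_{2}-A^{-4}K_{1}+A^{-2}+A^{4}K_{1}^{3}+2K_{1}^{3}+A^{-4}K_{1}^{3}$;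 $3$ - $4.63$: $O_1^{-}O_2^{-}U_1^{-}U_3^{+}O_4^{-}U_2^{-}O_3^{+}U_4^{-}$; $A^{2}-A^{4}K_{1}-A^{2}K_{1}^{2}-A^{-2}K_{1}^{2}+A^{-2}K_{2}+K_{1}+A^{-2}$; $2$ - $4.64$: $O_1^{-}O_2^{-}U_1^{-}U_3^{+}O_4^{+}U_2^{-}O_3^{+}U_4^{+}$; $-A^{6}K_{1}-A^{-4}K_{2}+K_{2}+1+A^{2}K_{1}$; $2$ - $4.65$: $O_1^{-}O_2^{+}U_1^{-}U_3^{-}O_4^{-}U_2^{+}O_3^{-}U_4^{-}$; $A^{8}K_{1}-2A^{4}K_{1}+A^{-2}-A^{2}K_{2}+K_{1}+A^{-2}K_{2}$; $2$ - $4.66$: $O_1^{-}O_2^{+}U_1^{-}U_3^{-}O_4^{+}U_2^{+}O_3^{-}U_4^{+}$; $-A^{6}K_{1}+A^{-2}K_{1}^{3}+1+A^{6}K_{1}^{3}+2A^{2}K_{1}^{3}-A^{-4}K_{1}^{2}+K_{2}-A^{2}K_{1}-A^{2}K_{1}K_{2}-A^{-2}K_{1}K_{2}-K_{1}^{2}+A^{-4}$;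 $3$ - $4.67$: $O_1^{-}O_2^{+}U_1^{-}U_3^{+}O_4^{-}U_2^{+}O_3^{+}U_4^{-}$; $-A^{-4}K_{1}^{2}+1+K_{2}-K_{1}^{2}+A^{-4}$; $2$ - $4.68$: $O_1^{-}O_2^{+}U_1^{-}U_3^{+}O_4^{+}U_2^{+}O_3^{+}U_4^{+}$; $A^{2}-A^{4}K_{1}+A^{-2}+2K_{1}-A^{-4}K_{1}-A^{-6}$; $1$ - $4.69$: $O_1^{-}O_2^{-}U_1^{-}U_3^{-}O_4^{-}O_3^{-}U_2^{-}U_4^{-}$; $A^{4}K_{2}-2A^{4}K_{1}^{2}-2K_{1}^{2}+K_{2}+2-A^{2}K_{1}+A^{-2}K_{1}+A^{-4}$; $2$ - $4.70$: $O_1^{-}O_2^{-}U_1^{-}U_3^{+}O_4^{-}O_3^{+}U_2^{-}U_4^{-}$; $-A^{6}K_{1}^{2}-A^{2}K_{1}^{2}+A^{2}K_{2}+2K_{1}-A^{4}K_{1}+A^{2}-A^{-4}K_{1}+A^{-2}$; $2$ - $4.71$: $O_1^{-}O_2^{-}U_1^{-}U_3^{+}O_4^{+}O_3^{+}U_2^{-}U_4^{+}$;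 $-A^{6}K_{1}+A^{2}K_{1}+2K_{2}-A^{4}K_{1}^{2}-2K_{1}^{2}+3-A^{-4}K_{1}^{2}+A^{-2}K_{1}-A^{-6}K_{1}$; $2$ - $4.72$: $O_1^{-}O_2^{+}U_1^{-}U_3^{+}O_4^{-}O_3^{+}U_2^{+}U_4^{-}$; $1$; $0$ - $4.73$: $O_1^{-}O_2^{-}U_1^{-}U_3^{-}O_4^{-}O_3^{-}U_4^{-}U_2^{-}$; $A^{8}K_{2}-2A^{4}K_{2}-2A^{2}K_{1}+K_{2}+2A^{-2}K_{1}+A^{-4}$; $2$ - $4.74$: $O_1^{-}O_2^{-}U_1^{-}U_3^{-}O_4^{+}O_3^{-}U_4^{+}U_2^{-}$; $-A^{6}K_{2}-A^{4}K_{1}+A^{6}K_{1}^{2}+2A^{-2}-A^{2}+A^{2}K_{2}+K_{1}-A^{-2}K_{1}^{2}$; $2$ - $4.75$: $O_1^{-}O_2^{-}U_1^{-}U_3^{+}O_4^{+}O_3^{+}U_4^{+}U_2^{-}$; $-A^{6}K_{1}-A^{4}+3+A^{2}K_{1}+A^{-2}K_{1}-A^{-4}-A^{-6}K_{1}$; $1$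 - $4.76$: $O_1^{-}O_2^{+}U_1^{-}U_3^{-}O_4^{+}O_3^{-}U_4^{+}U_2^{+}$; $A^{4}K_{2}-A^{4}K_{1}^{2}+3-2K_{1}^{2}-A^{-4}K_{1}^{2}+A^{-4}K_{2}$; $2$ - $4.77$: $O_1^{-}O_2^{+}U_1^{-}U_3^{+}O_4^{-}O_3^{+}U_4^{-}U_2^{+}$; $A^{4}K_{2}-2K_{1}^{2}-A^{4}K_{1}^{2}+3-A^{-4}K_{1}^{2}+A^{-4}K_{2}$; $2$ - $4.78$: $O_1^{-}O_2^{-}U_1^{-}U_3^{-}U_4^{-}U_2^{-}O_3^{-}O_4^{-}$; $-A^{6}K_{1}K_{2}-A^{2}K_{1}K_{2}-A^{4}K_{1}^{2}-K_{1}^{2}+A^{-2}K_{1}^{3}+K_{2}+1+A^{6}K_{1}^{3}+2A^{2}K_{1}^{3}-2A^{2}K_{1}+A^{-4}$; $3$ - $4.79$: $O_1^{-}O_2^{+}U_1^{-}U_3^{-}U_4^{-}U_2^{+}O_3^{-}O_4^{-}$; $A^{8}K_{1}^{3}+2A^{4}K_{1}^{3}+K_{1}^{3}-3A^{4}K_{1}+2A^{-2}-A^{4}K_{1}K_{2}-K_{1}K_{2}-A^{2}K_{1}^{2}-A^{-2}K_{1}^{2}+K_{1}+A^{-2}K_{2}$;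 $3$ - $4.80$: $O_1^{-}O_2^{-}U_1^{-}U_3^{-}U_4^{-}U_2^{-}O_4^{-}O_3^{-}$; $-A^{6}K_{1}K_{2}-A^{2}K_{1}K_{2}-A^{-2}K_{1}+A^{2}K_{1}+A^{-6}K_{1}+A^{2}K_{3}-A^{-4}+1+A^{-8}$; $3$ - $4.81$: $O_1^{-}O_2^{+}U_1^{-}U_3^{-}U_4^{-}U_2^{+}O_4^{-}O_3^{-}$; $A^{4}K_{3}-A^{-2}+A^{2}+A^{-6}-A^{4}K_{1}K_{2}-K_{1}K_{2}-A^{-4}K_{1}+K_{1}+A^{-8}K_{1}$; $3$ - $4.82$: $O_1^{-}O_2^{-}O_3^{-}U_1^{-}O_4^{-}U_2^{-}U_3^{-}U_4^{-}$; $-A^{6}K_{1}+A^{-4}K_{1}^{2}-A^{4}K_{1}^{2}+2-2A^{-4}+A^{2}K_{1}+A^{-8}$; $2$ - $4.83$: $O_1^{-}O_2^{-}O_3^{-}U_1^{-}O_4^{+}U_2^{-}U_3^{-}U_4^{+}$; $-K_{1}K_{2}-A^{4}K_{1}K_{2}+K_{1}+A^{-2}+K_{3}$; $3$ - $4.84$: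 $O_1^{-}O_2^{+}O_3^{+}U_1^{-}O_4^{-}U_2^{+}U_3^{+}U_4^{-}$; $2+A^{2}K_{1}-A^{-4}-A^{-2}K_{1}-K_{1}^{2}+A^{-8}K_{1}^{2}$; $2$ - $4.85$: $O_1^{-}O_2^{-}O_3^{-}U_1^{-}O_4^{+}U_3^{-}U_2^{-}U_4^{+}$; $-A^{2}K_{1}^{2}+A^{2}+A^{-6}K_{1}^{2}$; $2$ - $4.86$: $O_1^{-}O_2^{+}O_3^{+}U_1^{-}O_4^{-}U_3^{+}U_2^{+}U_4^{-}$; $A^{8}-A^{4}+2-A^{-4}-K_{1}^{2}+A^{-8}K_{1}^{2}$; $2$ - $4.87$: $O_1^{-}O_2^{-}O_3^{-}U_1^{-}U_4^{-}U_2^{-}U_3^{-}O_4^{-}$; $-A^{6}K_{1}K_{2}-A^{2}K_{1}K_{2}-A^{4}K_{1}^{2}-2A^{-4}+A^{2}K_{1}+2+A^{2}K_{3}+A^{-4}K_{1}^{2}+A^{-8}$; $3$ - $4.88$: $O_1^{-}O_2^{+}O_3^{+}U_1^{-}U_4^{-}U_2^{+}U_3^{+}O_4^{-}$; $2+A^{2}K_{1}+A^{2}K_{3}-A^{-4}-A^{2}K_{1}K_{2}-A^{-2}K_{1}K_{2}-K_{1}^{2}+A^{-8}K_{1}^{2}$;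 $3$ - $4.89$: $O_1^{-}O_2^{-}O_3^{-}U_1^{-}U_4^{-}U_3^{-}U_2^{-}O_4^{-}$; $A^{4}-2A^{4}K_{1}^{2}+2A^{-4}K_{1}^{2}-2A^{-4}+1+A^{-8}$; $2$ - $4.90$: $O_1^{-}O_2^{+}O_3^{+}U_1^{-}U_4^{-}U_3^{+}U_2^{+}O_4^{-}$; $A^{8}K_{1}^{2}-A^{4}-2K_{1}^{2}+3-A^{-4}+A^{-8}K_{1}^{2}$; $2$ - $4.91$: $O_1^{-}O_2^{-}O_3^{-}O_4^{-}U_1^{-}U_2^{-}U_3^{-}U_4^{-}$; $-A^{10}K_{1}^{3}-A^{6}K_{1}^{3}+A^{2}K_{1}^{3}+2A^{6}K_{1}+A^{-2}K_{1}^{3}-2A^{2}K_{1}+A^{-4}$; $3$ - $4.92$: $O_1^{-}O_2^{-}O_3^{-}O_4^{-}U_1^{-}U_3^{-}U_2^{-}U_4^{-}$; $-A^{6}K_{3}-A^{4}+2+A^{2}K_{3}-A^{-4}+A^{-8}$; $3$ - $4.93$: $O_1^{-}O_2^{-}O_3^{-}O_4^{+}U_1^{-}U_3^{-}U_2^{-}U_4^{+}$;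 $A^{4}K_{3}+A^{-6}K_{1}^{2}+A^{2}-A^{2}K_{1}^{2}-A^{4}K_{1}K_{2}-K_{1}K_{2}+K_{1}$; $3$ - $4.94$: $O_1^{-}O_2^{-}U_3^{-}U_1^{-}O_4^{-}U_2^{-}O_3^{-}U_4^{-}$; $-A^{6}K_{1}+2-A^{4}+A^{2}K_{1}-A^{-4}+A^{-8}$; $1$ - $4.95$: $O_1^{-}O_2^{-}U_3^{-}U_1^{-}O_4^{+}U_2^{-}O_3^{-}U_4^{+}$; $-A^{4}K_{3}+A^{-2}+K_{3}$; $3$ - $4.96$: $O_1^{-}O_2^{-}U_3^{+}U_1^{-}O_4^{-}U_2^{-}O_3^{+}U_4^{-}$; $A^{-6}K_{1}^{2}-A^{2}K_{1}^{2}+A^{2}$; $2$ - $4.97$: $O_1^{-}O_2^{-}U_3^{+}U_1^{-}O_4^{+}U_2^{-}O_3^{+}U_4^{+}$; $-A^{2}K_{1}K_{2}-A^{-2}K_{1}K_{2}+A^{2}K_{3}+1+A^{-2}K_{1}$; $3$ - $4.98$: $O_1^{-}O_2^{-}U_3^{+}U_1^{-}O_4^{+}O_3^{+}U_2^{-}U_4^{+}$;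 $1$; $0$ - $4.99$: $O_1^{-}O_2^{+}U_3^{+}U_1^{-}O_4^{-}O_3^{+}U_2^{+}U_4^{-}$; $A^{8}-A^{4}-A^{-4}+1+A^{-8}$; $0$ - $4.100$: $O_1^{-}O_2^{-}U_3^{-}O_4^{-}U_1^{-}U_2^{-}O_3^{-}U_4^{-}$; $-A^{10}K_{1}+A^{6}K_{1}-A^{2}K_{1}+A^{-2}K_{1}+A^{-4}$; $1$ - $4.101$: $O_1^{-}O_2^{-}U_3^{-}O_4^{+}U_1^{-}U_2^{-}O_3^{-}U_4^{+}$; $A^{8}K_{1}+K_{1}^{3}-A^{-4}K_{1}+A^{-2}-A^{8}K_{1}^{3}-A^{4}K_{1}^{3}+A^{-4}K_{1}^{3}$; $3$ - $4.102$: $O_1^{-}O_2^{-}U_3^{+}O_4^{+}U_1^{-}U_2^{-}O_3^{+}U_4^{+}$; $-A^{6}K_{1}-A^{-2}K_{1}^{3}+1+A^{6}K_{1}^{3}+A^{2}K_{1}^{3}-A^{-6}K_{1}^{3}-A^{2}K_{1}+A^{-6}K_{1}+A^{-2}K_{1}$; $3$ - $4.103$: $O_1^{-}O_2^{-}U_3^{-}O_4^{+}U_2^{-}U_1^{-}O_3^{-}U_4^{+}$;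 $A^{4}K_{1}+A^{2}+K_{3}-A^{4}K_{1}K_{2}-K_{1}K_{2}-A^{2}K_{1}^{2}+A^{-6}K_{1}^{2}$; $3$ - $4.104$: $O_1^{-}O_2^{-}U_3^{+}O_4^{+}U_2^{-}U_1^{-}O_3^{+}U_4^{+}$; $A^{2}K_{3}-A^{-2}K_{3}-A^{-4}+1+A^{-8}$; $3$ - $4.105$: $O_1^{-}U_2^{-}O_3^{-}U_1^{-}O_4^{-}U_3^{-}O_2^{-}U_4^{-}$; $-A^{4}+1+A^{-8}$; $0$ - $4.106$: $O_1^{-}U_2^{-}O_3^{-}U_1^{-}O_4^{+}U_3^{-}O_2^{-}U_4^{+}$; $A^{2}-A^{2}K_{1}^{2}+A^{-6}K_{1}^{2}$; $2$ - $4.107$: $O_1^{-}U_2^{-}O_3^{+}U_1^{-}O_4^{+}U_3^{+}O_2^{-}U_4^{+}$; $1$; $0$ - $4.108$: $O_1^{-}U_2^{+}O_3^{+}U_1^{-}O_4^{-}U_3^{+}O_2^{+}U_4^{-}$; $A^{8}-A^{4}-A^{-4}+1+A^{-8}$; $0$ -/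

import Mathlib

open scoped LaurentPolynomial

namespace VirtualKnot

/-! Oriented virtual knot diagrams on the sphere, written as cyclic words.  Traversing the knot once
meets every crossing, classical or virtual, twice; each visit is recorded as one letter. -/

/-- How a strand passes through a double point. -/
inductive Level where
  | over
  | under
  | virt
  deriving DecidableEq

/-- The level of the other strand at the same double point. -/
def Level.swap : Level → Level
  | .over => .under
  | .under => .over
  | .virt => .virt

/-- One visit to a double point: its label, the level of the strand, and whether the strand crosses
the other strand from the right of that strand to its left. -/
structure Passage where
  crossing : ℕ
  level : Level
  toLeft : Bool
  deriving DecidableEq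

/-- The visit of the other strand to the same double point. -/
def Passage.opp (x : Passage) : Passage :=
  { crossing := x.crossing, level := x.level.swap, toLeft := !x.toLeft }

/-- The sign of a classical crossing is `+1`, read at either of its visits: the under strand runs
from the right to the left of the over strand. -/
def Passage.positive (x : Passage) : Bool :=
  xor (decide (x.level = Level.over)) x.toLeft

/-- Every double point that occurs in the word is visited exactly twice, by two transverse strands,
and is either a classical or a virtual crossing. -/
def IsGaussWord (w : List Passage) : Prop :=
  ∀ x ∈ w, x.opp ∈ w ∧ w.countP (fun y => y.crossing == x.crossing) = 2

instance (w : List Passage) : Decidable (IsGaussWord w) :=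
  inferInstanceAs (Decidable (∀ x ∈ w, x.opp ∈ w ∧
    w.countP (fun y => y.crossing == x.crossing) = 2))

/-- The labels of the classical crossings of a word. -/
def classicalCrossings (w : List Passage) : Finset ℕ :=
  ((w.filter (fun x => x.level ≠ Level.virt)).map Passage.crossing).toFinset

/-- The labels of the virtual crossings of a word. -/
def virtualCrossings (w : List Passage) : Finset ℕ :=
  ((w.filter (fun x => x.level = Level.virt)).map Passage.crossing).toFinset

/-- The signed Gauss code of a diagram: forget the virtual crossings. -/
def gaussCode (w : List Passage) : List Passage :=
  w.filter (fun x => x.level ≠ Level.virt)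

/-- The writhe: the sum of the signs of the classical crossings. -/
def writhe (w : List Passage) : ℤ :=
  ((w.filter (fun x => x.level = Level.over)).map
    (fun x => if x.positive then (1 : ℤ) else -1)).sum

/-! The four-valent graph of a word: its vertices are the double points and its edges join
cyclically consecutive visits. -/

/-- A dart `(p, d)` is an edge of the diagram together with a direction: it ends at the visit number
`p`, arriving along the orientation of the knot if `d = true`, and against it if `d = false`. -/
abbrev Dart (w : List Passage) : Type := Fin w.length × Bool

/-- The other visit to the double point visited at position `p`. -/
def partner (w : List Passage) (p : Fin w.length) : Fin w.length :=
  ((List.finRange w.length).find?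
    (fun q => q ≠ p ∧ (w.get q).crossing = (w.get p).crossing)).getD p

/-- The dart that leaves the visit number `q`, forwards if `d = true`, backwards otherwise. -/
def leave (w : List Passage) (q : Fin w.length) (d : Bool) : Dart w :=
  if d then (finRotate w.length q, true) else ((finRotate w.length).symm q, false)

/-- The edge underlying a dart; the edge number `p` runs from the visit number `p` to the next. -/
def edgeOf (w : List Passage) (x : Dart w) : Fin w.length :=
  if x.2 then (finRotate w.length).symm x.1 else x.1

/-- The darts met by following `f` from `x`. -/
def orbit (w : List Passage) (f : Dart w → Dart w) (x : Dart w) : Finset (Dart w) :=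
  (Finset.range (2 * w.length)).image (fun k => f^[k] x)

/-- Turn left at the end of a dart; this walks around the face to the left of the dart. -/
def turnLeft (w : List Passage) (x : Dart w) : Dart w :=
  leave w (partner w x.1) (xor x.2 (w.get x.1).toLeft)

/-- The faces of the surface into which the graph of the word is cellularly embedded. -/
def faces (w : List Passage) : Finset (Finset (Dart w)) :=
  Finset.univ.image (orbit w (turnLeft w))

/-- The word comes from a curve in the plane (equivalently, on the sphere): the graph, which has
half as many vertices as edges and is connected, has Euler characteristic `V - E + F = 2`.  The
empty word is the circle without double points. -/
def IsPlanar (w : List Passage) : Prop :=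
  w = [] ∨ (faces w).card = w.length / 2 + 2

/-- A virtual knot diagram. -/
structure Diagram where
  word : List Passage
  isGaussWord : IsGaussWord word
  isPlanar : IsPlanar word

/-! The Reidemeister moves. -/

/-- The part of a strand that runs along one side of a triangle. -/
def side (e : Bool) (x y : Passage) : List Passage :=
  if e then [x, y] else [y, x]

/-- The classical third Reidemeister move needs one strand over, one strand under and one strand in
the middle; the virtual one needs three virtual crossings; the mixed one moves a strand with two
virtual crossings past a classical crossing.  The strand `1` meets `2`, `2` meets `3`, and `3`
meets `1` at the given levels. -/
def TriangleLevels (l₁₂ l₂₃ l₃₁ : Level) : Prop :=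
  (l₁₂ ≠ .virt ∧ l₂₃ ≠ .virt ∧ l₃₁ ≠ .virt ∧ ¬ (l₁₂ = l₂₃ ∧ l₂₃ = l₃₁)) ∨
  (l₁₂ = .virt ∧ l₂₃ = .virt) ∨ (l₂₃ = .virt ∧ l₃₁ = .virt) ∨ (l₃₁ = .virt ∧ l₁₂ = .virt)

/-- The moves on words, each in one direction. -/
inductive Move : List Passage → List Passage → Prop
  /-- Change of the base point. -/
  | rotate (u v : List Passage) : Move (u ++ v) (v ++ u)
  /-- Change of the labels of the double points. -/
  | relabel (f : ℕ → ℕ) (hf : f.Injective) (w : List Passage) :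
      Move w (w.map (fun x => { x with crossing := f x.crossing }))
  /-- First move, classical or virtual: remove a monogon. -/
  | one (x : Passage) (w : List Passage) : Move (x :: x.opp :: w) w
  /-- Second move, classical or virtual, for strands that run in parallel: remove a bigon. -/
  | two_parallel (x y : Passage) (u v : List Passage)
      (hl : x.level = y.level) (ht : x.toLeft ≠ y.toLeft) :
      Move (x :: y :: u ++ x.opp :: y.opp :: v) (u ++ v)
  /-- Second move, classical or virtual, for strands that run in opposite directions. -/
  | two_antiparallel (x y : Passage) (u v : List Passage)
      (hl : x.level = y.level) (ht : x.toLeft ≠ y.toLeft) :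
      Move (x :: y :: u ++ y.opp :: x.opp :: v) (u ++ v)
  /-- Third move, classical, virtual or mixed: three strands bound a triangle, the strands `1`
  and `2` crossing at `c`, `2` and `3` at `a`, and `3` and `1` at `b`, where the letters are the
  visits of `1`, `2`, `3` respectively.  The bits `e₁ e₂ e₃` say in which direction the strands run
  along the triangle, `t` says on which side of them the triangle lies; the three conditions on
  `toLeft` say that the three sides bound a common face. -/
  | three (a b c : Passage) (e₁ e₂ e₃ t : Bool) (u v w : List Passage)
      (hl : TriangleLevels c.level a.level b.level)
      (hc : c.opp.toLeft = xor t (e₁ == e₂))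
      (ha : a.opp.toLeft = xor t (e₂ == e₃))
      (hb : b.opp.toLeft = xor t (e₃ == e₁)) :
      Move (side e₁ b.opp c ++ u ++ side e₂ c.opp a ++ v ++ side e₃ a.opp b ++ w)
        (side (!e₁) b.opp c ++ u ++ side (!e₂) c.opp a ++ v ++ side (!e₃) a.opp b ++ w)

/-- Two diagrams present the same virtual knot: they are connected by finitely many classical and
virtual Reidemeister moves. -/
def Diagram.Equivalent : Diagram → Diagram → Prop :=
  Relation.EqvGen (fun D D' => Move D.word D'.word)

/-- The virtual crossing number: the least number of virtual crossings of an equivalent diagram. -/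
noncomputable def Diagram.virtualCrossingNumber (D : Diagram) : ℕ :=
  sInf {n | ∃ D' : Diagram, D.Equivalent D' ∧ (virtualCrossings D'.word).card = n}

/-! The arrow polynomial. -/

/-- Polynomials in `K₁, K₂, …` whose coefficients are Laurent polynomials in `A`. -/
abbrev ArrowRing : Type := MvPolynomial ℕ+ ℤ[T;T⁻¹]

/-- The power `A ^ m`. -/
noncomputable def A (m : ℤ) : ArrowRing := MvPolynomial.C (LaurentPolynomial.T m)

/-- The variable `K_n`, with `K_0 = 1`. -/
noncomputable def K (n : ℕ) : ArrowRing :=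
  if h : 0 < n then MvPolynomial.X ⟨n, h⟩ else 1

/-- In the state `s`, the set of the classical crossings that receive the smoothing with coefficient
`A`, is the smoothing at this visit the oriented one?  At a positive crossing the oriented smoothing
has coefficient `A` and the disoriented one `A⁻¹`; at a negative crossing it is the other way. -/
def smoothedOriented (s : Finset ℕ) (x : Passage) : Bool :=
  decide (x.crossing ∈ s) == x.positive

/-- Follow a closed loop of the state `s` through one double point: go straight through a virtual
crossing, and switch to the other strand at a classical one, reversing the direction if the
smoothing is disoriented. -/
def follow (w : List Passage) (s : Finset ℕ) (x : Dart w) : Dart w :=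
  if (w.get x.1).level = Level.virt then leave w x.1 x.2
  else if smoothedOriented s (w.get x.1) then leave w (partner w x.1) x.2
  else leave w (partner w x.1) (!x.2)

/-- The nodal arrow met at the end of a dart, as a sign.  A disoriented smoothing makes two cusps,
each with one nodal arrow.  Walking along the loop, consecutive arrows cancel if and only if their
cusps have their acute angles on the same side of the loop.  With the sign below (`-1` if the cusp
leads from the strand that crosses from left to right to the other strand, in either direction, and
`+1` otherwise) the side is the sign times a factor that alternates from one cusp to the next, so
consecutive arrows cancel if and only if their signs are opposite. -/
def arrowSign (w : List Passage) (s : Finset ℕ) (x : Dart w) : ℤ :=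
  if (w.get x.1).level = Level.virt ∨ smoothedOriented s (w.get x.1) then 0
  else if (w.get x.1).toLeft = x.2 then 1 else -1

/-- The closed loops of the state `s`, each given by its set of edges and by half the number of
nodal arrows that remain on it after all cancellations.  A loop is found twice, once for each
direction, with the same result. -/
def loops (w : List Passage) (s : Finset ℕ) : Finset (Finset (Fin w.length) × ℕ) :=
  Finset.univ.image (fun x : Dart w =>
    ((orbit w (follow w s) x).image (edgeOf w),
      (∑ y ∈ orbit w (follow w s) x, arrowSign w s y).natAbs / 2))

/-- The arrow polynomial `∑ A ^ (α - β) d ^ (|S| - 1) ⟨S⟩`, where `d = - A ^ 2 - A ^ (-2)`. -/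
noncomputable def arrowPolynomial (w : List Passage) : ArrowRing :=
  if w = [] then 1 else
    ∑ s ∈ (classicalCrossings w).powerset,
      A ((s.card : ℤ) - ((classicalCrossings w \ s).card : ℤ)) *
        (- A 2 - A (-2)) ^ ((loops w s).card - 1) * ∏ l ∈ loops w s, K l.2

/-- The normalized arrow polynomial `(- A ^ 3) ^ (- writhe)` times the arrow polynomial. -/
noncomputable def normalizedArrowPolynomial (w : List Passage) : ArrowRing :=
  ((writhe w).negOnePow : ℤ) • (A (-3 * writhe w) * arrowPolynomial w)

/-- The maximum k-degree: the maximum over the summands of `∑ iⱼ * pⱼ`. -/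
noncomputable def maxKDegree (f : ArrowRing) : ℕ :=
  f.weightedTotalDegree (fun i : ℕ+ => (i : ℕ))

/-! The table of the virtual knots `4.1, …, 4.108`. -/

/-- A classical Gauss code: `k` and `-k` are the visits of the over strand and of the under strand
to the crossing number `k = 1, 2, …`, and `signs` lists the signs `±1` of the crossings. -/
def ofGaussCode (code signs : List ℤ) : List Passage :=
  code.map fun (k : ℤ) =>
    { crossing := k.natAbs
      level := if 0 < k then Level.over else Level.under
      toLeft := xor (decide (0 < k)) (decide (0 < signs.getD (k.natAbs - 1) 0)) }

/-- A row of the table.  The entry `(c, m, [i, j, …])` of `terms` is the term `c A ^ m K_i K_j ⋯`. -/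
structure Row where
  number : ℕ
  code : List Passage
  terms : List (ℤ × ℤ × List ℕ)
  bound : ℕ

/-- The polynomial in a row of the table. -/
noncomputable def Row.polynomial (r : Row) : ArrowRing :=
  (r.terms.map fun t => t.1 • (A t.2.1 * (t.2.2.map K).prod)).sum

/-- The table: number `n` of the knot `4.n`, Gauss code, arrow polynomial, and bound. -/
def table : List Row := [
  ⟨1, ofGaussCode [1,2,-1,-2,3,4,-3,-4] [-1,-1,-1,-1], [(1,8,[1,1]),(-3,0,[1,1]),(2,0,[]),(-2,4,[1,1]),(2,0,[2]),(-2,2,[1]),(2,-2,[1]),(1,-4,[])], 2⟩,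
  ⟨2, ofGaussCode [1,2,-1,-2,3,4,-3,-4] [-1,-1,1,1], [(-1,6,[1]),(-1,4,[1,1]),(2,0,[2]),(3,0,[]),(-2,0,[1,1]),(1,2,[1]),(1,-2,[1]),(-1,-4,[1,1]),(-1,-6,[1])], 2⟩,
  ⟨3, ofGaussCode [1,2,-1,-2,3,-4,-3,4] [-1,-1,-1,-1], [(1,8,[1,1]),(-1,4,[]),(-1,0,[1,1]),(1,0,[]),(-2,2,[1]),(-1,4,[2]),(1,0,[2]),(2,-2,[1]),(1,-4,[])], 2⟩,
  ⟨4, ofGaussCode [1,2,-1,-2,3,-4,-3,4] [-1,-1,-1,1], [(1,2,[]),(-1,4,[1]),(-2,2,[1,1]),(-2,-2,[1,1]),(1,-2,[2]),(1,2,[2]),(2,-2,[]),(1,0,[1])], 2⟩,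
  ⟨5, ofGaussCode [1,2,-1,-2,3,-4,-3,4] [-1,-1,1,-1], [(-1,4,[1]),(1,2,[]),(-2,2,[1,1]),(-2,-2,[1,1]),(1,-2,[2]),(1,2,[2]),(1,0,[1]),(2,-2,[])], 2⟩,
  ⟨6, ofGaussCode [1,2,-1,-2,3,-4,-3,4] [-1,-1,1,1], [(-1,6,[1]),(-1,4,[1,1]),(1,0,[2]),(1,-4,[1,1]),(-1,-4,[2]),(1,2,[1]),(2,0,[]),(1,-2,[1]),(-1,-4,[]),(-1,-6,[1])], 2⟩,
  ⟨7, ofGaussCode [1,2,-1,-2,-3,-4,3,4] [-1,-1,-1,-1], [(1,8,[1,1]),(-3,0,[1,1]),(2,0,[2]),(-2,4,[1,1]),(2,0,[]),(-2,2,[1]),(2,-2,[1]),(1,-4,[])], 2⟩,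
  ⟨8, ofGaussCode [1,2,-1,-2,-3,-4,3,4] [-1,-1,1,1], [(-1,6,[1]),(-1,4,[1,1]),(3,0,[]),(2,0,[2]),(-2,0,[1,1]),(1,2,[1]),(1,-2,[1]),(-1,-4,[1,1]),(-1,-6,[1])], 2⟩,
  ⟨9, ofGaussCode [1,2,-1,3,-2,4,-3,-4] [-1,-1,-1,-1], [(-1,4,[]),(-1,2,[1]),(1,-2,[1]),(1,-4,[]),(1,0,[])], 1⟩,
  ⟨10, ofGaussCode [1,2,-1,3,-2,4,-3,-4] [-1,-1,-1,1], [(-1,6,[]),(-1,4,[1]),(2,2,[]),(2,0,[1]),(1,-2,[]),(-1,2,[1,1]),(-1,-2,[1,1]),(1,-2,[2]),(-1,-4,[1])], 2⟩,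
  ⟨11, ofGaussCode [1,2,-1,3,-2,4,-3,-4] [-1,-1,1,-1], [(-1,-2,[1,1]),(1,2,[]),(-1,4,[1]),(-1,2,[1,1]),(1,-2,[2]),(1,0,[1]),(1,-2,[])], 2⟩,
  ⟨12, ofGaussCode [1,2,-1,3,-2,4,-3,-4] [-1,-1,1,1], [(-1,6,[1]),(-1,4,[2]),(1,2,[1]),(1,0,[]),(2,0,[2]),(-1,-4,[2]),(1,-2,[1]),(-1,-6,[1])], 2⟩,
  ⟨13, ofGaussCode [1,2,-1,3,-2,4,-3,-4] [-1,1,-1,1], [(1,4,[]),(-1,-4,[1,1]),(1,0,[]),(-1,4,[1,1]),(-2,0,[1,1]),(2,0,[2]),(1,-4,[])], 2⟩,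
  ⟨14, ofGaussCode [1,2,-1,3,-2,4,-3,-4] [-1,1,1,-1], [(-1,6,[1]),(-2,-4,[1,1]),(1,2,[1]),(2,0,[2]),(2,0,[]),(-2,0,[1,1]),(1,-4,[])], 2⟩,
  ⟨15, ofGaussCode [1,2,-1,3,-2,-4,-3,4] [-1,-1,-1,-1], [(1,0,[2]),(-1,4,[1,1]),(-1,0,[1,1]),(1,0,[]),(-1,2,[1]),(1,-2,[1]),(1,-4,[])], 2⟩,
  ⟨16, ofGaussCode [1,2,-1,3,-2,-4,-3,4] [-1,-1,-1,1], [(-1,6,[]),(-1,4,[1]),(1,2,[]),(2,0,[1]),(1,-2,[]),(-1,-4,[1])], 1⟩,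
  ⟨17, ofGaussCode [1,2,-1,3,-2,-4,-3,4] [-1,-1,1,1], [(-1,6,[1]),(-1,4,[2]),(1,2,[1]),(2,0,[]),(2,0,[2]),(-1,-4,[1,1]),(-1,0,[1,1]),(1,-2,[1]),(-1,-6,[1])], 2⟩,
  ⟨18, ofGaussCode [1,2,-1,3,-2,-4,-3,4] [-1,1,-1,-1], [(-2,-2,[1,1]),(-1,4,[1]),(1,2,[2]),(-2,2,[1,1]),(2,-2,[]),(1,2,[]),(1,0,[1]),(1,-2,[2])], 2⟩,
  ⟨19, ofGaussCode [1,2,-1,3,-2,-4,-3,4] [-1,1,-1,1], [(1,4,[]),(1,0,[2]),(1,0,[]),(-1,4,[1,1]),(-1,0,[1,1])], 2⟩,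
  ⟨20, ofGaussCode [1,2,-1,3,-2,-4,-3,4] [-1,1,1,-1], [(-1,6,[1]),(1,0,[2]),(1,2,[1]),(2,0,[]),(-1,-4,[1,1]),(-1,0,[1,1])], 2⟩,
  ⟨21, ofGaussCode [1,2,-1,3,-2,-4,-3,4] [-1,1,1,1], [(1,2,[]),(1,2,[2]),(-1,4,[1]),(-1,2,[1,1]),(-2,-2,[1,1]),(2,-2,[]),(2,0,[1]),(1,-2,[2]),(-1,-4,[1]),(-1,-6,[1,1])], 2⟩,
  ⟨22, ofGaussCode [1,2,-1,3,4,-2,-3,-4] [-1,-1,1,1], [(-1,6,[1]),(1,2,[1]),(1,0,[2]),(2,0,[]),(-1,2,[1,2]),(-1,-2,[1,2]),(-1,0,[1,1]),(-1,-4,[1,1]),(1,2,[1,1,1]),(2,-2,[1,1,1]),(1,-6,[1,1,1]),(-1,-2,[1]),(-1,-6,[1])], 3⟩,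
  ⟨23, ofGaussCode [1,2,-1,3,4,-2,-3,-4] [-1,1,-1,-1], [(1,8,[1]),(-2,4,[1]),(2,-2,[]),(-1,2,[1,1]),(-1,-2,[1,1]),(1,0,[1]),(1,-2,[2])], 2⟩,
  ⟨24, ofGaussCode [1,2,-1,3,4,-2,-3,-4] [-1,1,1,1], [(1,2,[]),(-2,4,[1]),(1,4,[1,1,1]),(2,0,[1,1,1]),(1,-4,[1,1,1]),(-1,-4,[1]),(1,-2,[]),(1,0,[1]),(1,-2,[2]),(-1,0,[1,2]),(-1,-4,[1,2]),(-1,-2,[1,1]),(-1,-6,[1,1])], 3⟩,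
  ⟨25, ofGaussCode [1,2,-1,3,4,-2,-4,-3] [-1,-1,-1,-1], [(-1,6,[1]),(-1,-2,[1]),(1,-6,[1]),(1,2,[1]),(-1,-4,[]),(1,0,[]),(1,-8,[])], 1⟩,
  ⟨26, ofGaussCode [1,2,-1,3,4,-2,-4,-3] [-1,-1,1,1], [(1,2,[1]),(-1,-2,[1,2]),(-1,2,[1,2]),(1,0,[]),(1,-2,[3])], 3⟩,
  ⟨27, ofGaussCode [1,2,-1,3,4,-2,-4,-3] [-1,1,-1,-1], [(1,-6,[]),(-1,-2,[]),(1,2,[]),(-1,-4,[1]),(1,-8,[1])], 1⟩,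
  ⟨28, ofGaussCode [1,2,-1,3,4,-2,-4,-3] [-1,1,1,1], [(1,2,[]),(1,0,[3]),(1,0,[1]),(-1,-4,[1,2]),(-1,0,[1,2])], 3⟩,
  ⟨29, ofGaussCode [1,2,-1,3,4,-3,-2,-4] [-1,-1,-1,-1], [(1,0,[]),(-1,4,[1,1]),(-1,0,[1,1]),(1,0,[2]),(-1,2,[1]),(1,-2,[1]),(1,-4,[])], 2⟩,
  ⟨30, ofGaussCode [1,2,-1,3,4,-3,-2,-4] [-1,-1,-1,1], [(-2,-2,[1,1]),(1,2,[2]),(1,2,[]),(-2,2,[1,1]),(1,-2,[2]),(-1,4,[1]),(2,-2,[]),(1,0,[1])], 2⟩,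
  ⟨31, ofGaussCode [1,2,-1,3,4,-3,-2,-4] [-1,-1,1,-1], [(-1,6,[1,1]),(-2,2,[1,1]),(2,2,[2]),(-1,-2,[1,1]),(-1,4,[1]),(2,0,[1]),(2,-2,[]),(1,2,[]),(-1,-4,[1])], 2⟩,
  ⟨32, ofGaussCode [1,2,-1,3,4,-3,-2,-4] [-1,-1,1,1], [(-1,6,[1]),(1,2,[1]),(3,0,[]),(-1,4,[1,1]),(-1,0,[1,1]),(-1,-4,[]),(1,0,[2]),(1,-2,[1]),(-1,-6,[1])], 2⟩,
  ⟨33, ofGaussCode [1,2,-1,3,4,-3,-2,-4] [-1,1,-1,-1], [(-1,4,[1]),(1,0,[1]),(1,-2,[])], 1⟩,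
  ⟨34, ofGaussCode [1,2,-1,3,4,-3,-2,-4] [-1,1,-1,1], [(-1,6,[1]),(1,2,[1]),(2,0,[]),(-1,-4,[1,1]),(1,0,[2]),(-1,0,[1,1])], 2⟩,
  ⟨35, ofGaussCode [1,2,-1,3,4,-3,-2,-4] [-1,1,1,-1], [(-1,0,[1,1]),(-1,-4,[1,1]),(2,0,[]),(1,-4,[2])], 2⟩,
  ⟨36, ofGaussCode [1,2,-1,3,4,-3,-2,-4] [-1,1,1,1], [(1,2,[]),(2,0,[1]),(-1,4,[1]),(-1,-4,[1]),(1,-2,[2]),(-1,-6,[2])], 2⟩,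
  ⟨37, ofGaussCode [1,2,-1,3,-4,-2,-3,4] [-1,-1,-1,-1], [(1,0,[2]),(-1,4,[2]),(-1,2,[1]),(1,-2,[1]),(1,-4,[])], 2⟩,
  ⟨38, ofGaussCode [1,2,-1,3,-4,-2,-3,4] [-1,-1,-1,1], [(1,2,[2]),(-1,4,[1]),(-1,2,[1,1]),(-1,-2,[1,1]),(2,-2,[]),(1,0,[1])], 2⟩,
  ⟨39, ofGaussCode [1,2,-1,3,-4,-2,-3,4] [-1,-1,1,-1], [(1,2,[2]),(-1,4,[1,2]),(-1,0,[1,2]),(-1,2,[1,1]),(-1,-2,[1,1]),(-1,4,[1]),(2,-2,[]),(-1,-4,[1]),(1,4,[1,1,1]),(2,0,[1,1,1]),(1,-4,[1,1,1])], 3⟩,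
  ⟨40, ofGaussCode [1,2,-1,3,-4,-2,-3,4] [-1,-1,1,1], [(-1,6,[1]),(-1,-4,[]),(2,0,[]),(1,2,[1])], 1⟩,
  ⟨41, ofGaussCode [1,2,-1,3,-4,-2,-3,4] [-1,1,-1,-1], [(1,8,[1]),(-2,4,[1]),(-1,2,[]),(1,0,[1]),(2,-2,[])], 1⟩,
  ⟨42, ofGaussCode [1,2,-1,3,-4,-2,-3,4] [-1,1,1,-1], [(-1,6,[1]),(1,6,[1,1,1]),(2,2,[1,1,1]),(1,-2,[1,1,1]),(-1,2,[1]),(2,0,[]),(-1,2,[1,2]),(-1,-2,[1,2]),(-1,0,[1,1]),(-1,-4,[1,1]),(1,-4,[2])], 3⟩,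
  ⟨43, ofGaussCode [1,2,-1,3,-4,-2,4,-3] [-1,-1,-1,-1], [(-1,6,[1]),(-1,-2,[1]),(1,-6,[1]),(1,2,[1]),(-1,-4,[]),(1,0,[]),(1,-8,[])], 1⟩,
  ⟨44, ofGaussCode [1,2,-1,3,-4,-2,4,-3] [-1,-1,-1,1], [(-1,4,[1]),(1,-2,[]),(1,0,[1])], 1⟩,
  ⟨45, ofGaussCode [1,2,-1,3,-4,-2,4,-3] [-1,-1,1,-1], [(-1,0,[1,2]),(-1,4,[1,2]),(1,0,[1]),(1,0,[3]),(1,-2,[])], 3⟩,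
  ⟨46, ofGaussCode [1,2,-1,3,-4,-2,4,-3] [-1,-1,1,1], [(1,0,[])], 0⟩,
  ⟨47, ofGaussCode [1,2,-1,3,-4,-2,4,-3] [-1,1,1,-1], [(1,2,[3]),(1,0,[]),(-1,-2,[1,2]),(-1,2,[1,2]),(1,-2,[1])], 3⟩,
  ⟨48, ofGaussCode [1,2,-1,3,-4,-3,-2,4] [-1,-1,-1,-1], [(1,4,[]),(-2,4,[1,1]),(-2,0,[1,1]),(1,0,[]),(2,0,[2]),(-1,2,[1]),(1,-2,[1]),(1,-4,[])], 2⟩,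
  ⟨49, ofGaussCode [1,2,-1,3,-4,-3,-2,4] [-1,-1,-1,1], [(1,2,[2]),(-1,-2,[1,1]),(-1,2,[1,1]),(-1,4,[1]),(1,0,[1]),(2,-2,[])], 2⟩,
  ⟨50, ofGaussCode [1,2,-1,3,-4,-3,-2,4] [-1,-1,1,-1], [(-1,6,[1,1]),(-1,2,[1,1]),(1,2,[]),(2,0,[1]),(1,2,[2]),(-1,4,[1]),(-1,-4,[1]),(1,-2,[])], 2⟩,
  ⟨51, ofGaussCode [1,2,-1,3,-4,-3,-2,4] [-1,-1,1,1], [(-1,6,[1]),(1,2,[1]),(3,0,[]),(-1,4,[1,1]),(-2,0,[1,1]),(2,0,[2]),(-1,-4,[1,1]),(1,-2,[1]),(-1,-6,[1])], 2⟩,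
  ⟨52, ofGaussCode [1,2,-1,3,-4,-3,-2,4] [-1,1,-1,1], [(-1,6,[1]),(1,2,[1]),(2,0,[]),(-1,-4,[])], 1⟩,
  ⟨53, ofGaussCode [1,2,-1,3,-4,-3,4,-2] [-1,-1,-1,-1], [(1,8,[]),(-2,4,[]),(-2,2,[1]),(1,0,[]),(2,-2,[1]),(1,-4,[])], 1⟩,
  ⟨54, ofGaussCode [1,2,-1,3,-4,-3,4,-2] [-1,-1,-1,1], [(-1,6,[]),(-1,4,[1]),(1,6,[1,1]),(1,-2,[]),(-1,2,[2]),(1,2,[]),(1,0,[1]),(-1,-2,[1,1]),(1,-2,[2])], 2⟩,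
  ⟨55, ofGaussCode [1,2,-1,3,-4,-3,4,-2] [-1,1,-1,1], [(1,4,[]),(2,0,[2]),(1,0,[]),(-1,4,[1,1]),(-2,0,[1,1]),(-1,-4,[1,1]),(1,-4,[])], 2⟩,
  ⟨56, ofGaussCode [1,2,-1,3,-4,-3,4,-2] [-1,1,1,-1], [(1,4,[]),(1,0,[]),(-1,4,[1,1]),(2,0,[2]),(-2,0,[1,1]),(-1,-4,[1,1]),(1,-4,[])], 2⟩,
  ⟨57, ofGaussCode [1,2,-1,-3,-2,-4,3,4] [-1,-1,-1,1], [(-1,6,[2]),(-1,4,[1]),(2,2,[2]),(2,0,[1]),(2,-2,[]),(-1,2,[1,1]),(-1,-2,[1,1]),(-1,-4,[1])], 2⟩,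
  ⟨58, ofGaussCode [1,2,-1,-3,-2,-4,3,4] [-1,-1,1,1], [(-1,6,[1]),(1,2,[1]),(3,0,[]),(-1,4,[]),(1,-2,[1]),(-1,-4,[]),(-1,-6,[1])], 1⟩,
  ⟨59, ofGaussCode [1,2,-1,-3,-2,-4,3,4] [-1,1,-1,1], [(1,4,[2]),(-1,-4,[1,1]),(-1,4,[1,1]),(-2,0,[1,1]),(3,0,[]),(1,-4,[2])], 2⟩,
  ⟨60, ofGaussCode [1,2,-1,-3,-2,-4,3,4] [-1,1,1,-1], [(-1,6,[1]),(-2,-4,[1,1]),(1,2,[1]),(3,0,[]),(1,0,[2]),(-2,0,[1,1]),(1,-4,[2])], 2⟩,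
  ⟨61, ofGaussCode [1,2,-1,-3,4,-2,3,-4] [-1,-1,-1,-1], [(1,0,[]),(-1,4,[]),(-1,2,[1]),(1,-2,[1]),(1,-4,[])], 1⟩,
  ⟨62, ofGaussCode [1,2,-1,-3,4,-2,3,-4] [-1,-1,-1,1], [(1,2,[]),(-1,4,[1,2]),(-1,0,[1,2]),(-1,2,[1,1]),(-1,-2,[1,1]),(-1,4,[1]),(1,-2,[2]),(-1,-4,[1]),(1,-2,[]),(1,4,[1,1,1]),(2,0,[1,1,1]),(1,-4,[1,1,1])], 3⟩,
  ⟨63, ofGaussCode [1,2,-1,-3,4,-2,3,-4] [-1,-1,1,-1], [(1,2,[]),(-1,4,[1]),(-1,2,[1,1]),(-1,-2,[1,1]),(1,-2,[2]),(1,0,[1]),(1,-2,[])], 2⟩,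
  ⟨64, ofGaussCode [1,2,-1,-3,4,-2,3,-4] [-1,-1,1,1], [(-1,6,[1]),(-1,-4,[2]),(1,0,[2]),(1,0,[]),(1,2,[1])], 2⟩,
  ⟨65, ofGaussCode [1,2,-1,-3,4,-2,3,-4] [-1,1,-1,-1], [(1,8,[1]),(-2,4,[1]),(1,-2,[]),(-1,2,[2]),(1,0,[1]),(1,-2,[2])], 2⟩,
  ⟨66, ofGaussCode [1,2,-1,-3,4,-2,3,-4] [-1,1,-1,1], [(-1,6,[1]),(1,-2,[1,1,1]),(1,0,[]),(1,6,[1,1,1]),(2,2,[1,1,1]),(-1,-4,[1,1]),(1,0,[2]),(-1,2,[1]),(-1,2,[1,2]),(-1,-2,[1,2]),(-1,0,[1,1]),(1,-4,[])], 3⟩,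
  ⟨67, ofGaussCode [1,2,-1,-3,4,-2,3,-4] [-1,1,1,-1], [(-1,-4,[1,1]),(1,0,[]),(1,0,[2]),(-1,0,[1,1]),(1,-4,[])], 2⟩,
  ⟨68, ofGaussCode [1,2,-1,-3,4,-2,3,-4] [-1,1,1,1], [(1,2,[]),(-1,4,[1]),(1,-2,[]),(2,0,[1]),(-1,-4,[1]),(-1,-6,[])], 1⟩,
  ⟨69, ofGaussCode [1,2,-1,-3,4,3,-2,-4] [-1,-1,-1,-1], [(1,4,[2]),(-2,4,[1,1]),(-2,0,[1,1]),(1,0,[2]),(2,0,[]),(-1,2,[1]),(1,-2,[1]),(1,-4,[])], 2⟩,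
  ⟨70, ofGaussCode [1,2,-1,-3,4,3,-2,-4] [-1,-1,1,-1], [(-1,6,[1,1]),(-1,2,[1,1]),(1,2,[2]),(2,0,[1]),(-1,4,[1]),(1,2,[]),(-1,-4,[1]),(1,-2,[])], 2⟩,
  ⟨71, ofGaussCode [1,2,-1,-3,4,3,-2,-4] [-1,-1,1,1], [(-1,6,[1]),(1,2,[1]),(2,0,[2]),(-1,4,[1,1]),(-2,0,[1,1]),(3,0,[]),(-1,-4,[1,1]),(1,-2,[1]),(-1,-6,[1])], 2⟩,
  ⟨72, ofGaussCode [1,2,-1,-3,4,3,-2,-4] [-1,1,1,-1], [(1,0,[])], 0⟩,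
  ⟨73, ofGaussCode [1,2,-1,-3,4,3,-4,-2] [-1,-1,-1,-1], [(1,8,[2]),(-2,4,[2]),(-2,2,[1]),(1,0,[2]),(2,-2,[1]),(1,-4,[])], 2⟩,
  ⟨74, ofGaussCode [1,2,-1,-3,4,3,-4,-2] [-1,-1,-1,1], [(-1,6,[2]),(-1,4,[1]),(1,6,[1,1]),(2,-2,[]),(-1,2,[]),(1,2,[2]),(1,0,[1]),(-1,-2,[1,1])], 2⟩,
  ⟨75, ofGaussCode [1,2,-1,-3,4,3,-4,-2] [-1,-1,1,1], [(-1,6,[1]),(-1,4,[]),(3,0,[]),(1,2,[1]),(1,-2,[1]),(-1,-4,[]),(-1,-6,[1])], 1⟩,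
  ⟨76, ofGaussCode [1,2,-1,-3,4,3,-4,-2] [-1,1,-1,1], [(1,4,[2]),(-1,4,[1,1]),(3,0,[]),(-2,0,[1,1]),(-1,-4,[1,1]),(1,-4,[2])], 2⟩,
  ⟨77, ofGaussCode [1,2,-1,-3,4,3,-4,-2] [-1,1,1,-1], [(1,4,[2]),(-2,0,[1,1]),(-1,4,[1,1]),(3,0,[]),(-1,-4,[1,1]),(1,-4,[2])], 2⟩,
  ⟨78, ofGaussCode [1,2,-1,-3,-4,-2,3,4] [-1,-1,-1,-1], [(-1,6,[1,2]),(-1,2,[1,2]),(-1,4,[1,1]),(-1,0,[1,1]),(1,-2,[1,1,1]),(1,0,[2]),(1,0,[]),(1,6,[1,1,1]),(2,2,[1,1,1]),(-2,2,[1]),(1,-4,[])], 3⟩,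
  ⟨79, ofGaussCode [1,2,-1,-3,-4,-2,3,4] [-1,1,-1,-1], [(1,8,[1,1,1]),(2,4,[1,1,1]),(1,0,[1,1,1]),(-3,4,[1]),(2,-2,[]),(-1,4,[1,2]),(-1,0,[1,2]),(-1,2,[1,1]),(-1,-2,[1,1]),(1,0,[1]),(1,-2,[2])], 3⟩,
  ⟨80, ofGaussCode [1,2,-1,-3,-4,-2,4,3] [-1,-1,-1,-1], [(-1,6,[1,2]),(-1,2,[1,2]),(-1,-2,[1]),(1,2,[1]),(1,-6,[1]),(1,2,[3]),(-1,-4,[]),(1,0,[]),(1,-8,[])], 3⟩,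
  ⟨81, ofGaussCode [1,2,-1,-3,-4,-2,4,3] [-1,1,-1,-1], [(1,4,[3]),(-1,-2,[]),(1,2,[]),(1,-6,[]),(-1,4,[1,2]),(-1,0,[1,2]),(-1,-4,[1]),(1,0,[1]),(1,-8,[1])], 3⟩,
  ⟨82, ofGaussCode [1,2,3,-1,4,-2,-3,-4] [-1,-1,-1,-1], [(-1,6,[1]),(1,-4,[1,1]),(-1,4,[1,1]),(2,0,[]),(-2,-4,[]),(1,2,[1]),(1,-8,[])], 2⟩,
  ⟨83, ofGaussCode [1,2,3,-1,4,-2,-3,-4] [-1,-1,-1,1], [(-1,0,[1,2]),(-1,4,[1,2]),(1,0,[1]),(1,-2,[]),(1,0,[3])], 3⟩,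
  ⟨84, ofGaussCode [1,2,3,-1,4,-2,-3,-4] [-1,1,1,-1], [(2,0,[]),(1,2,[1]),(-1,-4,[]),(-1,-2,[1]),(-1,0,[1,1]),(1,-8,[1,1])], 2⟩,
  ⟨85, ofGaussCode [1,2,3,-1,4,-3,-2,-4] [-1,-1,-1,1], [(-1,2,[1,1]),(1,2,[]),(1,-6,[1,1])], 2⟩,
  ⟨86, ofGaussCode [1,2,3,-1,4,-3,-2,-4] [-1,1,1,-1], [(1,8,[]),(-1,4,[]),(2,0,[]),(-1,-4,[]),(-1,0,[1,1]),(1,-8,[1,1])], 2⟩,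
  ⟨87, ofGaussCode [1,2,3,-1,-4,-2,-3,4] [-1,-1,-1,-1], [(-1,6,[1,2]),(-1,2,[1,2]),(-1,4,[1,1]),(-2,-4,[]),(1,2,[1]),(2,0,[]),(1,2,[3]),(1,-4,[1,1]),(1,-8,[])], 3⟩,
  ⟨88, ofGaussCode [1,2,3,-1,-4,-2,-3,4] [-1,1,1,-1], [(2,0,[]),(1,2,[1]),(1,2,[3]),(-1,-4,[]),(-1,2,[1,2]),(-1,-2,[1,2]),(-1,0,[1,1]),(1,-8,[1,1])], 3⟩,
  ⟨89, ofGaussCode [1,2,3,-1,-4,-3,-2,4] [-1,-1,-1,-1], [(1,4,[]),(-2,4,[1,1]),(2,-4,[1,1]),(-2,-4,[]),(1,0,[]),(1,-8,[])], 2⟩,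
  ⟨90, ofGaussCode [1,2,3,-1,-4,-3,-2,4] [-1,1,1,-1], [(1,8,[1,1]),(-1,4,[]),(-2,0,[1,1]),(3,0,[]),(-1,-4,[]),(1,-8,[1,1])], 2⟩,
  ⟨91, ofGaussCode [1,2,3,4,-1,-2,-3,-4] [-1,-1,-1,-1], [(-1,10,[1,1,1]),(-1,6,[1,1,1]),(1,2,[1,1,1]),(2,6,[1]),(1,-2,[1,1,1]),(-2,2,[1]),(1,-4,[])], 3⟩,
  ⟨92, ofGaussCode [1,2,3,4,-1,-3,-2,-4] [-1,-1,-1,-1], [(-1,6,[3]),(-1,4,[]),(2,0,[]),(1,2,[3]),(-1,-4,[]),(1,-8,[])], 3⟩,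
  ⟨93, ofGaussCode [1,2,3,4,-1,-3,-2,-4] [-1,-1,-1,1], [(1,4,[3]),(1,-6,[1,1]),(1,2,[]),(-1,2,[1,1]),(-1,4,[1,2]),(-1,0,[1,2]),(1,0,[1])], 3⟩,
  ⟨94, ofGaussCode [1,2,-3,-1,4,-2,3,-4] [-1,-1,-1,-1], [(-1,6,[1]),(2,0,[]),(-1,4,[]),(1,2,[1]),(-1,-4,[]),(1,-8,[])], 1⟩,
  ⟨95, ofGaussCode [1,2,-3,-1,4,-2,3,-4] [-1,-1,-1,1], [(-1,4,[3]),(1,-2,[]),(1,0,[3])], 3⟩,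
  ⟨96, ofGaussCode [1,2,-3,-1,4,-2,3,-4] [-1,-1,1,-1], [(1,-6,[1,1]),(-1,2,[1,1]),(1,2,[])], 2⟩,
  ⟨97, ofGaussCode [1,2,-3,-1,4,-2,3,-4] [-1,-1,1,1], [(-1,2,[1,2]),(-1,-2,[1,2]),(1,2,[3]),(1,0,[]),(1,-2,[1])], 3⟩,
  ⟨98, ofGaussCode [1,2,-3,-1,4,3,-2,-4] [-1,-1,1,1], [(1,0,[])], 0⟩,
  ⟨99, ofGaussCode [1,2,-3,-1,4,3,-2,-4] [-1,1,1,-1], [(1,8,[]),(-1,4,[]),(-1,-4,[]),(1,0,[]),(1,-8,[])], 0⟩,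
  ⟨100, ofGaussCode [1,2,-3,4,-1,-2,3,-4] [-1,-1,-1,-1], [(-1,10,[1]),(1,6,[1]),(-1,2,[1]),(1,-2,[1]),(1,-4,[])], 1⟩,
  ⟨101, ofGaussCode [1,2,-3,4,-1,-2,3,-4] [-1,-1,-1,1], [(1,8,[1]),(1,0,[1,1,1]),(-1,-4,[1]),(1,-2,[]),(-1,8,[1,1,1]),(-1,4,[1,1,1]),(1,-4,[1,1,1])], 3⟩,
  ⟨102, ofGaussCode [1,2,-3,4,-1,-2,3,-4] [-1,-1,1,1], [(-1,6,[1]),(-1,-2,[1,1,1]),(1,0,[]),(1,6,[1,1,1]),(1,2,[1,1,1]),(-1,-6,[1,1,1]),(-1,2,[1]),(1,-6,[1]),(1,-2,[1])], 3⟩,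
  ⟨103, ofGaussCode [1,2,-3,4,-2,-1,3,-4] [-1,-1,-1,1], [(1,4,[1]),(1,2,[]),(1,0,[3]),(-1,4,[1,2]),(-1,0,[1,2]),(-1,2,[1,1]),(1,-6,[1,1])], 3⟩,
  ⟨104, ofGaussCode [1,2,-3,4,-2,-1,3,-4] [-1,-1,1,1], [(1,2,[3]),(-1,-2,[3]),(-1,-4,[]),(1,0,[]),(1,-8,[])], 3⟩,
  ⟨105, ofGaussCode [1,-2,3,-1,4,-3,2,-4] [-1,-1,-1,-1], [(-1,4,[]),(1,0,[]),(1,-8,[])], 0⟩,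
  ⟨106, ofGaussCode [1,-2,3,-1,4,-3,2,-4] [-1,-1,-1,1], [(1,2,[]),(-1,2,[1,1]),(1,-6,[1,1])], 2⟩,
  ⟨107, ofGaussCode [1,-2,3,-1,4,-3,2,-4] [-1,-1,1,1], [(1,0,[])], 0⟩,
  ⟨108, ofGaussCode [1,-2,3,-1,4,-3,2,-4] [-1,1,1,-1], [(1,8,[]),(-1,4,[]),(-1,-4,[]),(1,0,[]),(1,-8,[])], 0⟩]

theorem table_numbers : table.map Row.number = List.range' 1 108 := by decide

theorem table_codes : ∀ r ∈ table, IsGaussWord r.code ∧ (classicalCrossings r.code).card = 4 ∧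
    virtualCrossings r.code = ∅ := by decide +kernel

end VirtualKnot

/-! All computations are made with `d` times the arrow polynomial, where `d = -A^2 - A^(-2)`: then
every loop of a state contributes one factor `d * K n`, and the sum becomes local. Since `ArrowRing`
is a domain and `d ≠ 0`, the factor is cancelled at the end.

A state is encoded as a closed system of weighted arcs, the weights being the signs of the nodal
arrows. The absolute weights of its loops are recovered from colourings. Given a permutation `τ` of
a set, a colouring changes by `τ ^ k` along an arc of weight `k`, so the number of colourings is the
product of the numbers of fixed points of `τ ^ m` over the loop weights `m`. If `τ` is an `l`-cycle
with one further fixed point, this is `l + 1` raised to the number of weights divisible by `l`, and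
these numbers for all `l > 0` determine the multiset of weights (`multiset_eq_of_prod_fixedPoints`).
Numbers of colourings do not see the order or direction of arcs, nor the contraction of a point
where two arcs meet. So the loops may be found by contraction in any order, and they agree with the
loops defined by orbits of darts (`loopWeights_stateArcs`).

Visits to virtual crossings are arcs of weight 0 and contract away (`loopWeights_gaussCode`), so the
polynomial depends on the Gauss code only, and each table entry is a finite sum over 16 states
(`table_stateTerms`). Cutting the curve at six points separates the part where a Reidemeister move
happens from the rest. An equality of the formal inner state sums then gives an equality of the
whole sums (`stateSum_local_change`), and the moves reduce to finitely many checks. Invariance up to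
a unit `± A^e` suffices, because units do not affect the k-degree.

For the bound on virtual crossings, a planar diagram has an Alexander numbering of its edges
(`exists_numbering`). It comes from linear algebra on functions of the faces: with `V` crossings
there are `V + 2` faces, and the map to `ℚ × ℚ^V` recording the left-right difference at one edge
and its jumps at the crossings has only constants in its kernel, hence is onto. At a classical
crossing the nodal weights are exactly the changes of the numbering, while each visit to a virtual
crossing gives an error of 1. By the triangle inequality the loop weights of a state sum to at most
twice the number of virtual crossings (`sum_loopWeights_le`), so the k-degree is at most that
number. As the k-degree is the same for all equivalent diagrams, it bounds the virtual crossing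
number.

Diagrams for the codes are given by explicit insertions of virtual crossings, and planarity is
certified by sufficiently many face labels, since `card_faces_le` bounds the number of faces from
above. -/

namespace VirtualKnot

/-! ### Systems of weighted arcs and their closed loops -/

section ArcSystem

variable {α β S : Type*}

/-- A system of arcs: `(a, b, k)` is an arc from `a` to `b` of weight `k`, or, equivalently, an arc
from `b` to `a` of weight `-k`. -/
abbrev ArcSystem (α : Type*) : Type _ := List (α × α × ℤ)

/-- The end points of the arcs, with multiplicity. -/
def ends (L : ArcSystem α) : List α := L.flatMap fun x => [x.1, x.2.1]

@[simp] theorem ends_nil : ends ([] : ArcSystem α) = [] := rfl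

@[simp] theorem ends_cons (x : α × α × ℤ) (L : ArcSystem α) :
    ends (x :: L) = x.1 :: x.2.1 :: ends L := rfl

@[simp] theorem ends_append (L M : ArcSystem α) : ends (L ++ M) = ends L ++ ends M := by
  simp [ends]

theorem ends_perm {L M : ArcSystem α} (h : L.Perm M) : (ends L).Perm (ends M) := h.flatMap_right _

theorem mem_ends {L : ArcSystem α} {v : α} : v ∈ ends L ↔ ∃ x ∈ L, v = x.1 ∨ v = x.2.1 := by
  simp [ends]

/-- Push a system of arcs forward along a map of the end points. -/
def mapArcs (f : α → β) (L : ArcSystem α) : ArcSystem β := L.map fun x => (f x.1, f x.2.1, x.2.2)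

@[simp] theorem mapArcs_cons (f : α → β) (x : α × α × ℤ) (L : ArcSystem α) :
    mapArcs f (x :: L) = (f x.1, f x.2.1, x.2.2) :: mapArcs f L := rfl

@[simp] theorem mapArcs_append (f : α → β) (L M : ArcSystem α) :
    mapArcs f (L ++ M) = mapArcs f L ++ mapArcs f M := by
  simp [mapArcs]

theorem mapArcs_perm (f : α → β) {L M : ArcSystem α} (h : L.Perm M) :
    (mapArcs f L).Perm (mapArcs f M) := h.map _

/-- The colourings of the end points of a system of arcs by `S` that change by `τ ^ k` along an arc
of weight `k`; away from the end points the colour is `s₀`. -/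
def Colouring (τ : Equiv.Perm S) (s₀ : S) (L : ArcSystem α) : Type _ :=
  {φ : α → S // (∀ v, v ∉ ends L → φ v = s₀) ∧ ∀ x ∈ L, φ x.2.1 = (τ ^ x.2.2) (φ x.1)}

/-- The number of colourings. -/
noncomputable def colourings (τ : Equiv.Perm S) (s₀ : S) (L : ArcSystem α) : ℕ :=
  Nat.card (Colouring τ s₀ L)

/-- The number of fixed points of a power of a permutation. -/
noncomputable def fixedPoints (τ : Equiv.Perm S) (k : ℤ) : ℕ := Nat.card {s : S // s = (τ ^ k) s}

theorem fixedPoints_neg (τ : Equiv.Perm S) (k : ℤ) : fixedPoints τ (-k) = fixedPoints τ k := by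
  refine Nat.card_congr (Equiv.subtypeEquivRight fun s => ?_)
  rw [zpow_neg, Equiv.Perm.eq_inv_iff_eq, eq_comm]

theorem fixedPoints_natAbs (τ : Equiv.Perm S) (k : ℤ) :
    fixedPoints τ (k.natAbs : ℤ) = fixedPoints τ k := by
  rcases Int.natAbs_eq k with h | h
  · rw [← h]
  · conv_rhs => rw [h]
    rw [fixedPoints_neg]

theorem colourings_perm (τ : Equiv.Perm S) (s₀ : S) {L M : ArcSystem α} (h : L.Perm M) :
    colourings τ s₀ L = colourings τ s₀ M := by
  refine Nat.card_congr (Equiv.subtypeEquivRight fun φ => ?_)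
  simp only [(ends_perm h).mem_iff, h.mem_iff]

theorem colourings_nil (τ : Equiv.Perm S) (s₀ : S) : colourings τ s₀ ([] : ArcSystem α) = 1 := by
  have : Unique (Colouring τ s₀ ([] : ArcSystem α)) :=
    { default := ⟨fun _ => s₀, by simp, by simp⟩
      uniq := fun φ => Subtype.ext (funext fun v => φ.2.1 v (by simp)) }
  exact Nat.card_unique

theorem colourings_flip (τ : Equiv.Perm S) (s₀ : S) (a b : α) (k : ℤ) (L : ArcSystem α) :
    colourings τ s₀ ((b, a, -k) :: L) = colourings τ s₀ ((a, b, k) :: L) := by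
  refine Nat.card_congr (Equiv.subtypeEquivRight fun φ => ?_)
  simp only [ends_cons, List.mem_cons, forall_eq_or_imp, zpow_neg]
  rw [Equiv.Perm.eq_inv_iff_eq, eq_comm (a := (τ ^ k) (φ a))]
  refine and_congr_left fun _ => forall_congr' fun v => ?_
  rw [or_left_comm]

variable [DecidableEq α] [DecidableEq β]

/-- The colour of `b` is forced by that of `a` and occurs in no other condition, so it can be erased
and restored. -/
theorem colourings_contract (τ : Equiv.Perm S) (s₀ : S) {a b c : α} (k l : ℤ) {L : ArcSystem α}
    (ha : a ≠ b) (hc : c ≠ b) (hb : b ∉ ends L) :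
    colourings τ s₀ ((a, b, k) :: (b, c, l) :: L) = colourings τ s₀ ((a, c, k + l) :: L) := by
  have hL : ∀ x ∈ L, x.1 ≠ b ∧ x.2.1 ≠ b := fun x hx =>
    ⟨fun h => hb (mem_ends.2 ⟨x, hx, .inl h.symm⟩), fun h => hb (mem_ends.2 ⟨x, hx, .inr h.symm⟩)⟩
  refine Nat.card_congr
    { toFun := fun φ => ⟨Function.update φ.1 b s₀, fun v hv => ?_, fun x hx => ?_⟩
      invFun := fun φ => ⟨Function.update φ.1 b ((τ ^ k) (φ.1 a)), fun v hv => ?_, fun x hx => ?_⟩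
      left_inv := fun φ => ?_
      right_inv := fun φ => ?_ }
  · by_cases h : v = b
    · simp [h]
    · rw [Function.update_of_ne h]
      exact φ.2.1 v (by simp_all)
  · have h1 := φ.2.2 (a, b, k) (by simp)
    have h2 := φ.2.2 (b, c, l) (by simp)
    rcases List.mem_cons.1 hx with rfl | hx
    · simp only [Function.update_of_ne ha, Function.update_of_ne hc] at *
      rw [h2, h1, ← Equiv.Perm.mul_apply, ← zpow_add, add_comm]
    · rw [Function.update_of_ne (hL x hx).1, Function.update_of_ne (hL x hx).2]
      exact φ.2.2 x (by simp [hx])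
  · have h : v ≠ b := by rintro rfl; simp at hv
    rw [Function.update_of_ne h]
    exact φ.2.1 v (by simp_all)
  · have h1 := φ.2.2 (a, c, k + l) (by simp)
    rcases List.mem_cons.1 hx with rfl | hx
    · simp [Function.update_of_ne ha]
    rcases List.mem_cons.1 hx with rfl | hx
    · simp only [Function.update_self, Function.update_of_ne hc] at *
      rw [h1, ← Equiv.Perm.mul_apply, ← zpow_add, add_comm l k]
    · rw [Function.update_of_ne (hL x hx).1, Function.update_of_ne (hL x hx).2]
      exact φ.2.2 x (by simp [hx])
  · have h1 := φ.2.2 (a, b, k) (by simp)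
    apply Subtype.ext
    funext v
    by_cases h : v = b
    · subst h; simpa [Function.update_of_ne ha] using h1.symm
    · simp [Function.update_of_ne h]
  · apply Subtype.ext
    funext v
    by_cases h : v = b
    · subst h
      simp only [Function.update_self]
      exact (φ.2.1 v (by simp [hb, ha.symm, hc.symm])).symm
    · simp [Function.update_of_ne h]

/-- The colour of `a` is an arbitrary fixed point of `τ ^ k`, chosen independently of all other
colours. -/
theorem colourings_loop (τ : Equiv.Perm S) (s₀ : S) {a : α} (k : ℤ) {L : ArcSystem α}
    (ha : a ∉ ends L) :
    colourings τ s₀ ((a, a, k) :: L) = fixedPoints τ k * colourings τ s₀ L := by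
  have hL : ∀ x ∈ L, x.1 ≠ a ∧ x.2.1 ≠ a := fun x hx =>
    ⟨fun h => ha (mem_ends.2 ⟨x, hx, .inl h.symm⟩), fun h => ha (mem_ends.2 ⟨x, hx, .inr h.symm⟩)⟩
  rw [colourings, fixedPoints, colourings, ← Nat.card_prod]
  refine Nat.card_congr
    { toFun := fun φ => (⟨φ.1 a, φ.2.2 (a, a, k) (by simp)⟩,
        ⟨Function.update φ.1 a s₀, fun v hv => ?_, fun x hx => ?_⟩)
      invFun := fun φ => ⟨Function.update φ.2.1 a φ.1.1, fun v hv => ?_, fun x hx => ?_⟩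
      left_inv := fun φ => ?_
      right_inv := fun φ => ?_ }
  · by_cases h : v = a
    · simp [h]
    · rw [Function.update_of_ne h]
      exact φ.2.1 v (by simp_all)
  · rw [Function.update_of_ne (hL x hx).1, Function.update_of_ne (hL x hx).2]
    exact φ.2.2 x (by simp [hx])
  · have h : v ≠ a := by rintro rfl; simp at hv
    rw [Function.update_of_ne h]
    exact φ.2.2.1 v (by simp_all)
  · rcases List.mem_cons.1 hx with rfl | hx
    · simpa using φ.1.2
    · rw [Function.update_of_ne (hL x hx).1, Function.update_of_ne (hL x hx).2]
      exact φ.2.2.2 x hx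
  · apply Subtype.ext
    funext v
    by_cases h : v = a
    · subst h; simp
    · simp [Function.update_of_ne h]
  · refine Prod.ext (Subtype.ext (by simp)) (Subtype.ext (funext fun v => ?_))
    by_cases h : v = a
    · subst h
      simpa using (φ.2.2.1 v ha).symm
    · simp [Function.update_of_ne h]

/-- Every end point belongs to exactly two arcs. -/
def IsClosed (L : ArcSystem α) : Prop := ∀ v ∈ ends L, (ends L).count v = 2

theorem IsClosed.perm {L M : ArcSystem α} (hL : IsClosed L) (h : L.Perm M) : IsClosed M :=
  fun v hv => by
    rw [← (ends_perm h).count_eq]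
    exact hL v ((ends_perm h).mem_iff.2 hv)

theorem IsClosed.of_ends_perm {L : ArcSystem α} {l : List α} (h : (ends L).Perm (l ++ l))
    (hl : l.Nodup) : IsClosed L := fun v hv => by
  have hv' : v ∈ l := by simpa using h.mem_iff.1 hv
  rw [h.count_eq, List.count_append, List.count_eq_one_of_mem hl hv']

theorem IsClosed.flip {a b : α} {k l : ℤ} {L : ArcSystem α} (h : IsClosed ((a, b, k) :: L)) :
    IsClosed ((b, a, l) :: L) := by
  have hp : (ends ((a, b, k) :: L)).Perm (ends ((b, a, l) :: L)) := List.Perm.swap _ _ _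
  exact fun v hv => by
    rw [← hp.count_eq]
    exact h v (hp.mem_iff.2 hv)

theorem IsClosed.not_mem_of_loop {a : α} {k : ℤ} {L : ArcSystem α}
    (h : IsClosed ((a, a, k) :: L)) : a ∉ ends L := by
  have := h a (by simp)
  simp only [ends_cons, List.count_cons_self] at this
  exact List.count_eq_zero.1 (by omega)

theorem IsClosed.of_loop {a : α} {k : ℤ} {L : ArcSystem α} (h : IsClosed ((a, a, k) :: L)) :
    IsClosed L := fun v hv => by
  have hva : a ≠ v := by rintro rfl; exact h.not_mem_of_loop hv
  have := h v (by simp [hv])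
  simpa [List.count_cons, hva] using this

/-- The two displayed occurrences of `b` already exhaust its multiplicity. -/
theorem IsClosed.not_mem_of_contract {a b c : α} {k l : ℤ} {L : ArcSystem α}
    (h : IsClosed ((a, b, k) :: (b, c, l) :: L)) : a ≠ b ∧ c ≠ b ∧ b ∉ ends L := by
  have := h b (by simp)
  simp only [ends_cons, List.count_cons, beq_self_eq_true, if_true, beq_iff_eq] at this
  refine ⟨fun h => ?_, fun h => ?_, List.count_eq_zero.1 (by omega)⟩ <;> simp only [h, if_true] at this <;> omega

theorem IsClosed.contract {a b c : α} {k l m : ℤ} {L : ArcSystem α}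
    (h : IsClosed ((a, b, k) :: (b, c, l) :: L)) : IsClosed ((a, c, m) :: L) := fun v hv => by
  obtain ⟨ha, hc, hb⟩ := h.not_mem_of_contract
  have hvb : b ≠ v := by
    rintro rfl
    simp only [ends_cons, List.mem_cons] at hv
    rcases hv with h | h | h
    · exact ha h.symm
    · exact hc h.symm
    · exact hb h
  have := h v (by simp at hv ⊢; tauto)
  simpa [List.count_cons, hvb] using this

/-- Contraction read backwards: a fresh point subdivides an arc. This is what makes cutting a strand
possible. -/
theorem IsClosed.expand {a b c : α} {k l m : ℤ} {L : ArcSystem α}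
    (h : IsClosed ((a, c, m) :: L)) (hb : b ∉ ends ((a, c, m) :: L)) :
    IsClosed ((a, b, k) :: (b, c, l) :: L) := fun v hv => by
  have hb' : a ≠ b ∧ c ≠ b ∧ b ∉ ends L := by simp at hb; tauto
  by_cases hvb : b = v
  · subst hvb
    simp [hb'.1, hb'.2.1, List.count_eq_zero.2 hb'.2.2]
  · have := h v (by simp at hv ⊢; tauto)
    simpa [List.count_cons, hvb] using this

/-! ### Finding the closed loops by contraction -/

/-- Extract the first arc at `b`, read as an arc that starts at `b`. -/
def extract (b : α) : ArcSystem α → Option (α × ℤ × ArcSystem α)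
  | [] => none
  | (x, y, k) :: L =>
    if x = b then some (y, k, L)
    else if y = b then some (x, -k, L)
    else match extract b L with
      | none => none
      | some (c, l, M) => some (c, l, (x, y, k) :: M)

theorem extract_none {b : α} : ∀ {L : ArcSystem α}, extract b L = none → b ∉ ends L
  | [], _ => by simp
  | (x, y, k) :: L, h => by
    unfold extract at h
    split_ifs at h with h1 h2
    cases hL : extract b L with
    | none => simp [Ne.symm h1, Ne.symm h2, extract_none hL]
    | some r => simp [hL] at h

theorem extract_some {b c : α} {l : ℤ} : ∀ {L M : ArcSystem α}, extract b L = some (c, l, M) →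
    L.Perm ((b, c, l) :: M) ∨ L.Perm ((c, b, -l) :: M)
  | [], _, h => by simp [extract] at h
  | (x, y, k) :: L, M, h => by
    unfold extract at h
    split_ifs at h with h1 h2
    · simp only [Option.some.injEq, Prod.mk.injEq] at h
      obtain ⟨rfl, rfl, rfl⟩ := h
      subst h1
      exact .inl (.refl _)
    · simp only [Option.some.injEq, Prod.mk.injEq] at h
      obtain ⟨rfl, rfl, rfl⟩ := h
      subst h2
      exact .inr (by simp)
    · cases hL : extract b L with
      | none => simp [hL] at h
      | some r =>
        obtain ⟨c', l', N⟩ := r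
        simp only [hL, Option.some.injEq, Prod.mk.injEq] at h
        obtain ⟨rfl, rfl, rfl⟩ := h
        exact (extract_some hL).imp (fun h => (h.cons _).trans (.swap _ _ _))
          (fun h => (h.cons _).trans (.swap _ _ _))

theorem IsClosed.extract {b c : α} {l : ℤ} {N L M : ArcSystem α} (hL : IsClosed (N ++ L))
    (h : extract b L = some (c, l, M)) : IsClosed ((b, c, l) :: (N ++ M)) := by
  rcases extract_some h with h | h
  · exact hL.perm ((h.append_left N).trans List.perm_middle)
  · exact (hL.perm ((h.append_left N).trans List.perm_middle)).flip

theorem colourings_extract (τ : Equiv.Perm S) (s₀ : S) {b c : α} {l : ℤ} {N L M : ArcSystem α}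
    (h : extract b L = some (c, l, M)) :
    colourings τ s₀ (N ++ L) = colourings τ s₀ ((b, c, l) :: (N ++ M)) := by
  rcases extract_some h with h | h
  · exact colourings_perm _ _ ((h.append_left N).trans List.perm_middle)
  · rw [colourings_perm τ s₀ ((h.append_left N).trans List.perm_middle), colourings_flip]

/-- The weights, up to sign, of the closed loops of a system of arcs, found in at most the given
number of steps. -/
def loopWeightsAux : ℕ → ArcSystem α → List ℕ
  | 0, _ => []
  | _ + 1, [] => []
  | n + 1, (a, b, k) :: L =>
    if a = b then k.natAbs :: loopWeightsAux n L
    else match extract b L with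
      | some (c, l, M) => loopWeightsAux n ((a, c, k + l) :: M)
      | none => loopWeightsAux n L

/-- The weights, up to sign, of the closed loops of a system of arcs. -/
def loopWeights (L : ArcSystem α) : List ℕ := loopWeightsAux L.length L

theorem extract_length {b c : α} {l : ℤ} {L M : ArcSystem α} (h : extract b L = some (c, l, M)) :
    L.length = M.length + 1 := by
  rcases extract_some h with h | h <;> simpa using h.length_eq

/-- Every step of the algorithm removes one arc and keeps the system closed, so the number of arcs
suffices as a bound for the steps. A closed loop splits off a factor; a contraction leaves the
number unchanged. -/
theorem colourings_loopWeightsAux (τ : Equiv.Perm S) (s₀ : S) : ∀ (n : ℕ) (L : ArcSystem α),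
    L.length ≤ n → IsClosed L →
      colourings τ s₀ L = ((loopWeightsAux n L).map fun m : ℕ => fixedPoints τ (m : ℤ)).prod
  | 0, L, hn, _ => by
    obtain rfl : L = [] := List.length_eq_zero_iff.1 (by omega)
    simp [loopWeightsAux, colourings_nil]
  | n + 1, [], _, _ => by simp [loopWeightsAux, colourings_nil]
  | n + 1, (a, b, k) :: L, hn, hL => by
    have hn' : L.length ≤ n := by simpa using hn
    unfold loopWeightsAux
    split_ifs with hab
    · subst hab
      rw [colourings_loop τ s₀ k hL.not_mem_of_loop, List.map_cons, List.prod_cons,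
        fixedPoints_natAbs, colourings_loopWeightsAux τ s₀ n L hn' hL.of_loop]
    · cases h : extract b L with
      | none =>
        -- The fallback branch does not occur: in a closed system `b` must belong to a second arc.
        exfalso
        have := hL b (by simp)
        simp [hab, List.count_eq_zero.2 (extract_none h)] at this
      | some r =>
        obtain ⟨c, l, M⟩ := r
        have h1 := IsClosed.extract (N := [(a, b, k)]) hL h
        have h2 : IsClosed ((a, b, k) :: (b, c, l) :: M) := h1.perm (.swap _ _ _)
        obtain ⟨ha, hc, hb⟩ := h2.not_mem_of_contract
        rw [show (a, b, k) :: L = [(a, b, k)] ++ L from rfl, colourings_extract τ s₀ h,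
          List.singleton_append, colourings_perm τ s₀ (M := (a, b, k) :: (b, c, l) :: M) (List.Perm.swap _ _ _)]
        rw [colourings_contract τ s₀ k l ha hc (by simpa using hb)]
        refine colourings_loopWeightsAux τ s₀ n _ ?_ h2.contract
        have := extract_length h
        simp at hn ⊢
        omega

theorem colourings_eq_prod (τ : Equiv.Perm S) (s₀ : S) {L : ArcSystem α} (hL : IsClosed L) :
    colourings τ s₀ L = ((loopWeights L).map fun m : ℕ => fixedPoints τ (m : ℤ)).prod :=
  colourings_loopWeightsAux τ s₀ _ L le_rfl hL

/-! ### Recovering the loop weights from the numbers of colourings -/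

/-- A cycle of length `l` together with a fixed point. -/
def cycleAndPoint (l : ℕ) : Equiv.Perm (Option (ZMod l)) := Equiv.optionCongr (Equiv.addRight 1)

theorem cycleAndPoint_zpow (l : ℕ) (k : ℤ) :
    cycleAndPoint l ^ k = Equiv.optionCongr (Equiv.addRight (k : ZMod l)) := by
  induction k with
  | zero => ext s; cases s <;> simp
  | succ n ih =>
    rw [zpow_add_one, ih]
    ext s; cases s <;> simp [cycleAndPoint, add_comm, add_left_comm]
  | pred n ih =>
    rw [zpow_sub_one, ih, mul_inv_eq_iff_eq_mul]
    ext s; cases s <;> simp [cycleAndPoint]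

/-- A translation of `ZMod l` fixes everything or nothing. The extra point keeps the number nonzero,
so a product over several loops still counts the weights divisible by `l`. -/
theorem fixedPoints_cycleAndPoint (l : ℕ) [NeZero l] (n : ℕ) :
    fixedPoints (cycleAndPoint l) (n : ℤ) = if l ∣ n then l + 1 else 1 := by
  rw [fixedPoints, cycleAndPoint_zpow]
  split_ifs with h
  · have h0 : (n : ZMod l) = 0 := (ZMod.natCast_eq_zero_iff n l).2 h
    rw [Nat.card_congr (Equiv.subtypeUnivEquiv fun s => by cases s <;> simp [h0])]
    rw [Nat.card_eq_fintype_card, Fintype.card_option, ZMod.card]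
  · have h0 : (n : ZMod l) ≠ 0 := fun h' => h ((ZMod.natCast_eq_zero_iff n l).1 h')
    refine Nat.card_eq_one_iff_exists.2 ⟨⟨none, by simp⟩, fun s => Subtype.ext ?_⟩
    obtain ⟨s, hs⟩ := s
    cases s with
    | none => rfl
    | some s => simp [h0] at hs

theorem prod_map_ite_dvd (l : ℕ) (M : Multiset ℕ) :
    (M.map fun n => if l ∣ n then l + 1 else 1).prod = (l + 1) ^ M.countP (l ∣ ·) := by
  induction M using Multiset.induction_on with
  | empty => simp
  | cons a M ih =>
    by_cases h : l ∣ a <;> simp [ih, h, pow_succ, mul_comm]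

/-- It suffices to find a common element and remove it. If 0 occurs on one side it occurs on the
other. Otherwise let `a` be the largest element of both multisets: the other side has an element
divisible by `a`, which is positive and at most `a`, hence equal to `a`. -/
theorem multiset_eq_of_countP_dvd (M N : Multiset ℕ)
    (h : ∀ l, 0 < l → M.countP (l ∣ ·) = N.countP (l ∣ ·)) : M = N := by
  induction hn : M.card generalizing M N with
  | zero =>
    obtain rfl := Multiset.card_eq_zero.1 hn
    have := h 1 one_pos
    simp only [one_dvd, Multiset.countP_True, Multiset.card_zero] at this
    exact (Multiset.card_eq_zero.1 this.symm).symm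
  | succ n ih =>
    have key : ∃ a, a ∈ M ∧ a ∈ N := by
      have hcard : N.card = n + 1 := by
        have := h 1 one_pos
        simp only [one_dvd, Multiset.countP_True] at this
        omega
      have hcomm : ∀ P Q : Multiset ℕ, (∀ l, 0 < l → P.countP (l ∣ ·) = Q.countP (l ∣ ·)) →
          ∀ a ∈ P, (∀ b ∈ Q, b ≤ a) → 0 ∉ P → 0 ∉ Q → a ∈ Q := by
        intro P Q hPQ a ha hmax h0 h0'
        have hpos : 0 < a := Nat.pos_of_ne_zero fun h => h0 (h ▸ ha)
        have : 0 < Q.countP (a ∣ ·) := by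
          rw [← hPQ a hpos]
          exact Multiset.countP_pos.2 ⟨a, ha, dvd_rfl⟩
        obtain ⟨b, hb, hab⟩ := Multiset.countP_pos.1 this
        have hb0 : 0 < b := Nat.pos_of_ne_zero fun h => h0' (h ▸ hb)
        rwa [le_antisymm (Nat.le_of_dvd hb0 hab) (hmax b hb)]
      have hzero : ∀ P Q : Multiset ℕ, (∀ l, 0 < l → P.countP (l ∣ ·) = Q.countP (l ∣ ·)) →
          0 ∈ P → 0 ∈ Q := by
        intro P Q hPQ h0
        -- The number `Q.sum + 1` exceeds every element of `Q`, so among these it can divide only 0.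
        have : 0 < Q.countP ((Q.sum + 1) ∣ ·) := by
          rw [← hPQ _ (Nat.succ_pos _)]
          exact Multiset.countP_pos.2 ⟨0, h0, dvd_zero _⟩
        obtain ⟨b, hb, hab⟩ := Multiset.countP_pos.1 this
        rcases Nat.eq_zero_or_pos b with rfl | hb0
        · exact hb
        · have := Nat.le_of_dvd hb0 hab
          have := Multiset.single_le_sum (fun _ _ => Nat.zero_le _) b hb
          omega
      by_cases h0 : 0 ∈ M
      · exact ⟨0, h0, hzero M N h h0⟩
      have h0' : 0 ∉ N := fun h' => h0 (hzero N M (fun l hl => (h l hl).symm) h')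
      have hne : (M + N).toFinset.Nonempty := by
        obtain ⟨a, ha⟩ := Multiset.card_pos_iff_exists_mem.1 (show 0 < M.card by omega)
        exact ⟨a, by simp [ha]⟩
      obtain ⟨a, ha, hmax⟩ := (M + N).toFinset.exists_max_image id hne
      simp only [Multiset.mem_toFinset, Multiset.mem_add, id] at ha hmax
      rcases ha with ha | ha
      · exact ⟨a, ha, hcomm M N h a ha (fun b hb => hmax b (.inr hb)) h0 h0'⟩
      · exact ⟨a, hcomm N M (fun l hl => (h l hl).symm) a ha (fun b hb => hmax b (.inl hb)) h0' h0,
          ha⟩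
    obtain ⟨a, haM, haN⟩ := key
    obtain ⟨M', rfl⟩ := Multiset.exists_cons_of_mem haM
    obtain ⟨N', rfl⟩ := Multiset.exists_cons_of_mem haN
    rw [ih M' N' (fun l hl => by have := h l hl; simpa [Multiset.countP_cons] using this)
      (by simpa using hn)]

/-- A multiset of weights is determined by the numbers of colourings. -/
theorem multiset_eq_of_prod_fixedPoints (M N : Multiset ℕ)
    (h : ∀ l : ℕ, 0 < l → (M.map fun m : ℕ => fixedPoints (cycleAndPoint l) (m : ℤ)).prod =
      (N.map fun m : ℕ => fixedPoints (cycleAndPoint l) (m : ℤ)).prod) : M = N := by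
  refine multiset_eq_of_countP_dvd M N fun l hl => ?_
  have : NeZero l := ⟨hl.ne'⟩
  have := h l hl
  simp only [fixedPoints_cycleAndPoint, prod_map_ite_dvd] at this
  exact Nat.pow_right_injective (show 2 ≤ l + 1 by omega) this

/-! ### Operations on arc systems that preserve the loop weights -/

theorem extract_mapArcs {f : α → β} (hf : f.Injective) (b : α) : ∀ L : ArcSystem α,
    extract (f b) (mapArcs f L) =
      (extract b L).map fun r => (f r.1, r.2.1, mapArcs f r.2.2)
  | [] => rfl
  | (x, y, k) :: L => by
    rw [mapArcs_cons]
    unfold extract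
    simp only [hf.eq_iff]
    split_ifs
    · simp
    · simp
    · rw [extract_mapArcs hf b L]
      cases extract b L <;> simp

theorem loopWeights_mapArcs {f : α → β} (hf : f.Injective) (L : ArcSystem α) :
    loopWeights (mapArcs f L) = loopWeights L := by
  have key : ∀ (n : ℕ) (L : ArcSystem α),
      loopWeightsAux n (mapArcs f L) = loopWeightsAux n L := by
    intro n
    induction n with
    | zero => intro L; rfl
    | succ n ih =>
      rintro (_ | ⟨⟨a, b, k⟩, L⟩)
      · rfl
      · rw [mapArcs_cons]
        unfold loopWeightsAux
        simp only [hf.eq_iff, extract_mapArcs hf, ih]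
        split_ifs
        · rfl
        · cases extract b L with
          | none => rfl
          | some r => exact ih ((a, r.1, k + r.2.1) :: r.2.2)
  simpa [loopWeights, mapArcs] using key L.length L

/-- The algorithm behind `loopWeights` depends on the order of the arcs and on their directions;
comparing numbers of colourings avoids following it through a change of the system. -/
theorem loopWeights_perm_of_colourings {L : ArcSystem α} {M : ArcSystem β} (hL : IsClosed L)
    (hM : IsClosed M)
    (h : ∀ l : ℕ, colourings (cycleAndPoint l) none L = colourings (cycleAndPoint l) none M) :
    (loopWeights L : Multiset ℕ) = loopWeights M :=
  multiset_eq_of_prod_fixedPoints _ _ fun l _ => by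
    simpa [colourings_eq_prod _ _ hL, colourings_eq_prod _ _ hM] using h l

theorem loopWeights_perm {L M : ArcSystem α} (hL : IsClosed L) (h : L.Perm M) :
    (loopWeights L : Multiset ℕ) = loopWeights M :=
  loopWeights_perm_of_colourings hL (hL.perm h) fun _ => colourings_perm _ _ h

theorem loopWeights_flip {a b : α} {k : ℤ} {L : ArcSystem α} (h : IsClosed ((a, b, k) :: L)) :
    (loopWeights ((b, a, -k) :: L) : Multiset ℕ) = loopWeights ((a, b, k) :: L) :=
  loopWeights_perm_of_colourings h.flip h fun _ => colourings_flip _ _ _ _ _ _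

theorem loopWeights_contract {a b c : α} {k l : ℤ} {L : ArcSystem α}
    (h : IsClosed ((a, b, k) :: (b, c, l) :: L)) :
    (loopWeights ((a, b, k) :: (b, c, l) :: L) : Multiset ℕ) = loopWeights ((a, c, k + l) :: L) :=
  have h' := h.not_mem_of_contract
  loopWeights_perm_of_colourings h h.contract fun _ =>
    colourings_contract _ _ _ _ h'.1 h'.2.1 h'.2.2

theorem loopWeights_loop {a : α} {k : ℤ} {L : ArcSystem α} :
    loopWeights ((a, a, k) :: L) = k.natAbs :: loopWeights L := by
  simp [loopWeights, loopWeightsAux]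

end ArcSystem

end VirtualKnot

namespace VirtualKnot

/-! ### The arc system of a state of a word -/

@[simp] theorem Passage.opp_opp (x : Passage) : x.opp.opp = x := by
  obtain ⟨c, l, t⟩ := x
  cases l <;> simp [Passage.opp, Level.swap]

@[simp] theorem Passage.opp_crossing (x : Passage) : x.opp.crossing = x.crossing := rfl

@[simp] theorem Passage.opp_toLeft (x : Passage) : x.opp.toLeft = !x.toLeft := rfl

@[simp] theorem Passage.opp_level (x : Passage) : x.opp.level = x.level.swap := rfl

@[simp] theorem Level.swap_eq_virt {l : Level} : l.swap = .virt ↔ l = .virt := by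
  cases l <;> simp [Level.swap]

@[simp] theorem Level.swap_eq_over {l : Level} : l.swap = .over ↔ l = .under := by
  cases l <;> simp [Level.swap]

theorem Level.cases_classical {l : Level} (h : l ≠ .virt) : l = .over ∨ l = .under := by
  cases l <;> simp_all

theorem Passage.opp_positive {x : Passage} (h : x.level ≠ .virt) :
    x.opp.positive = x.positive := by
  rcases Level.cases_classical h with h | h <;> simp [Passage.positive, h, Level.swap]

/-- The point of a strand just before a visit. -/
def inn (x : Passage) : ℕ × ℕ := (x.crossing + 1, x.toLeft.toNat)

/-- The point of a strand just after a visit. -/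
def out (x : Passage) : ℕ × ℕ := (x.crossing + 1, x.toLeft.toNat + 2)

/-- The level need not enter the coordinates, as the two strands at a double point are told apart by
their directions. First coordinate 0 stays free for the base point and for cuts. -/
theorem inn_eq_inn {x y : Passage} :
    inn x = inn y ↔ x.crossing = y.crossing ∧ x.toLeft = y.toLeft := by
  rcases x with ⟨c, l, _ | _⟩ <;> rcases y with ⟨c', l', _ | _⟩ <;> simp [inn]

theorem out_eq_out {x y : Passage} :
    out x = out y ↔ x.crossing = y.crossing ∧ x.toLeft = y.toLeft := by
  rcases x with ⟨c, l, _ | _⟩ <;> rcases y with ⟨c', l', _ | _⟩ <;> simp [out]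

theorem inn_ne_out (x y : Passage) : inn x ≠ out y := by
  rcases x with ⟨c, l, _ | _⟩ <;> rcases y with ⟨c', l', _ | _⟩ <;> simp [inn, out]

/-- The arcs of a strand that starts at `p`, makes the visits in `u`, and ends at `q`. -/
def seg (p : ℕ × ℕ) : List Passage → ℕ × ℕ → ArcSystem (ℕ × ℕ)
  | [], q => [(p, q, 0)]
  | x :: u, q => (p, inn x, 0) :: seg (out x) u q

/-- The sign of the nodal arrow met when the strand of a visit arrives at a disoriented smoothing. -/
def nodalSign (x : Passage) : ℤ := if x.toLeft then 1 else -1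

/-- The arcs inside a smoothed crossing, or inside a virtual crossing.  The crossing receives the
smoothing with coefficient `A` if `χ` is true.  The weights are the signs of the nodal arrows. -/
def smoothing (χ : ℕ → Bool) (x : Passage) : ArcSystem (ℕ × ℕ) :=
  if x.level = .virt then [(inn x, out x, 0)]
  else if χ x.crossing == x.positive then [(inn x, out x.opp, 0)]
  else if x.level = .over then
    [(inn x, inn x.opp, nodalSign x), (out x, out x.opp, -nodalSign x)]
  else []

/-- The arcs inside all crossings of a word. -/
def smoothings (χ : ℕ → Bool) (w : List Passage) : ArcSystem (ℕ × ℕ) := w.flatMap (smoothing χ)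

@[simp] theorem smoothings_append (χ : ℕ → Bool) (u v : List Passage) :
    smoothings χ (u ++ v) = smoothings χ u ++ smoothings χ v := by
  simp [smoothings]

@[simp] theorem smoothings_cons (χ : ℕ → Bool) (x : Passage) (v : List Passage) :
    smoothings χ (x :: v) = smoothing χ x ++ smoothings χ v := by
  simp [smoothings]

/-- The arcs of the state `χ` of the closed curve with word `w` and base point `(0, 0)`. -/
def stateArcs (χ : ℕ → Bool) (w : List Passage) : ArcSystem (ℕ × ℕ) :=
  seg (0, 0) w (0, 0) ++ smoothings χ w

/-- The visits are distinguished by label and direction, and every classical crossing is visited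
by two transverse strands. -/
structure IsProper (w : List Passage) : Prop where
  nodup : (w.map fun x => (x.crossing, x.toLeft)).Nodup
  opp_mem : ∀ x ∈ w, x.level ≠ .virt → x.opp ∈ w

theorem IsProper.eq {w : List Passage} (hw : IsProper w) {x y : Passage} (hx : x ∈ w) (hy : y ∈ w)
    (hc : x.crossing = y.crossing) (ht : x.toLeft = y.toLeft) : x = y :=
  List.inj_on_of_nodup_map hw.nodup hx hy (by simp [hc, ht])

/-- Two visits with equal label and direction, together with an opposite one, would make three
visits to one double point. The weaker notion survives the deletion of a single visit to a virtual
crossing, which a Gauss word does not. -/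
theorem IsGaussWord.isProper {w : List Passage} (hw : IsGaussWord w) : IsProper w := by
  refine ⟨List.nodup_iff_count_le_one.2 ?_, fun x hx _ => (hw x hx).1⟩
  rintro ⟨c, t⟩
  by_contra! h
  rw [List.count_eq_countP, List.countP_map] at h
  obtain ⟨x, hx, hxk⟩ := List.countP_pos_iff.1 (zero_lt_one.trans h)
  simp only [Function.comp_apply, beq_iff_eq, Prod.mk.injEq] at hxk
  obtain ⟨rfl, rfl⟩ := hxk
  have h1 : 0 < w.countP fun y => (y.crossing, y.toLeft) == (x.crossing, !x.toLeft) :=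
    List.countP_pos_iff.2 ⟨x.opp, (hw x hx).1, by simp⟩
  have h2 := (hw x hx).2
  have h3 : ∀ v : List Passage, (v.countP fun y => y.crossing == x.crossing) =
      (v.countP ((fun y => y == (x.crossing, x.toLeft)) ∘ fun y => (y.crossing, y.toLeft))) +
      v.countP fun y => (y.crossing, y.toLeft) == (x.crossing, !x.toLeft) := by
    intro v
    induction v with
    | nil => rfl
    | cons y v ih =>
      simp only [List.countP_cons, ih, Function.comp_apply, beq_iff_eq, Prod.mk.injEq]
      by_cases hc : y.crossing = x.crossing <;> cases y.toLeft <;> cases x.toLeft <;>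
        simp [hc] <;> omega
  rw [h3] at h2
  omega

/-- The end points of the strands at the visits in `w`. -/
def ports (w : List Passage) : List (ℕ × ℕ) := w.flatMap fun x => [inn x, out x]

theorem mem_ports {w : List Passage} {v : ℕ × ℕ} :
    v ∈ ports w ↔ ∃ x ∈ w, v = inn x ∨ v = out x := by
  simp [ports]

theorem zero_not_mem_ports (w : List Passage) (i : ℕ) : (0, i) ∉ ports w := by
  simp [mem_ports, inn, out]

theorem IsProper.nodup_ports {w : List Passage} (hw : IsProper w) : (ports w).Nodup := by
  rw [ports, List.nodup_flatMap]
  refine ⟨fun x _ => ?_, hw.nodup.of_map.pairwise_of_forall_ne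
    fun x hx y hy hxy v hvx hvy => ?_⟩
  · simp [inn_ne_out]
  · simp only [List.mem_cons, List.not_mem_nil, or_false] at hvx hvy
    rcases hvx with rfl | rfl <;> rcases hvy with h | h
    · exact hxy (hw.eq hx hy (inn_eq_inn.1 h).1 (inn_eq_inn.1 h).2)
    · exact inn_ne_out _ _ h
    · exact inn_ne_out _ _ h.symm
    · exact hxy (hw.eq hx hy (out_eq_out.1 h).1 (out_eq_out.1 h).2)

theorem ends_seg (p : ℕ × ℕ) (w : List Passage) (q : ℕ × ℕ) :
    (ends (seg p w q)).Perm (p :: q :: ports w) := by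
  induction w generalizing p with
  | nil => simp [seg, ports]
  | cons x w ih =>
    simp only [seg, ends_cons]
    refine .cons _ ?_
    refine ((ih (out x)).cons (inn x)).trans ?_
    simp only [ports, List.flatMap_cons, List.cons_append, List.nil_append]
    exact (List.perm_middle (l₁ := [inn x, out x])).symm.symm

theorem mem_ends_smoothing {χ : ℕ → Bool} {x : Passage} {v : ℕ × ℕ} (h : v ∈ ends (smoothing χ x)) :
    (x.level = .virt ∧ (v = inn x ∨ v = out x)) ∨
    (x.level ≠ .virt ∧ (χ x.crossing == x.positive) ∧ (v = inn x ∨ v = out x.opp)) ∨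
    (x.level = .over ∧ ¬ (χ x.crossing == x.positive) ∧
      (v = inn x ∨ v = out x ∨ v = inn x.opp ∨ v = out x.opp)) := by
  unfold smoothing at h
  split_ifs at h with h1 h2 h3
  · simp_all
  · simp_all
  · simp only [ends_cons, ends_nil, List.mem_cons, List.not_mem_nil, or_false] at h
    exact .inr (.inr ⟨h3, h2, by tauto⟩)
  · simp at h

theorem ends_smoothings (χ : ℕ → Bool) (w : List Passage) :
    ends (smoothings χ w) = w.flatMap fun x => ends (smoothing χ x) := by
  simp [ends, smoothings, List.flatMap_assoc]

/-- Inside the crossings every port lies on exactly one arc. With an oriented smoothing each of the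
two visits supplies one arc; with a disoriented one the over visit supplies both arcs and the under
visit none. -/
theorem IsProper.ends_smoothings_perm {w : List Passage} (hw : IsProper w) (χ : ℕ → Bool) :
    (ends (smoothings χ w)).Perm (ports w) := by
  have hnd : w.Nodup := hw.nodup.of_map
  refine (List.perm_ext_iff_of_nodup ?_ ?_).2 fun v => ?_
  · rw [ends_smoothings, List.nodup_flatMap]
    refine ⟨fun x _ => ?_, hnd.pairwise_of_forall_ne fun x hx y hy hxy v hvx hvy => ?_⟩
    · have h1 : inn x ≠ inn x.opp := by simp [inn_eq_inn]
      have h2 : out x ≠ out x.opp := by simp [out_eq_out]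
      have hio := inn_ne_out
      unfold smoothing
      split_ifs <;> simp [hio, h1, h2]
    · have hport : ∀ x ∈ w, v ∈ ends (smoothing χ x) → ∃ z ∈ w,
          (z = x ∨ x.level ≠ .virt ∧ z = x.opp) ∧ (v = inn z ∨ v = out z) := by
        intro x hx hv
        have hx' := hw.opp_mem x hx
        rcases mem_ends_smoothing hv with ⟨h1, h⟩ | ⟨h1, h2, h | h⟩ | ⟨h1, h2, h | h | h | h⟩
        · exact ⟨x, hx, .inl rfl, h⟩
        · exact ⟨x, hx, .inl rfl, .inl h⟩
        · exact ⟨x.opp, hx' h1, .inr ⟨h1, rfl⟩, .inr h⟩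
        · exact ⟨x, hx, .inl rfl, .inl h⟩
        · exact ⟨x, hx, .inl rfl, .inr h⟩
        · exact ⟨x.opp, hx' (by simp [h1]), .inr ⟨by simp [h1], rfl⟩, .inl h⟩
        · exact ⟨x.opp, hx' (by simp [h1]), .inr ⟨by simp [h1], rfl⟩, .inr h⟩
      obtain ⟨z, hz, hzx, hvz⟩ := hport x hx hvx
      obtain ⟨z', hz', hzy, hvz'⟩ := hport y hy hvy
      have hzz : z = z' := by
        rcases hvz with rfl | rfl <;> rcases hvz' with h | h
        · exact hw.eq hz hz' (inn_eq_inn.1 h).1 (inn_eq_inn.1 h).2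
        · exact absurd h (inn_ne_out _ _)
        · exact absurd h.symm (inn_ne_out _ _)
        · exact hw.eq hz hz' (out_eq_out.1 h).1 (out_eq_out.1 h).2
      subst hzz
      -- Distinct visits can share a port only if they are the two visits to one classical crossing,
      -- where their arcs are disjoint by inspection.
      have hxy' : x = y.opp ∧ y.level ≠ .virt := by
        rcases hzx with rfl | ⟨h1, rfl⟩ <;> rcases hzy with h | ⟨h2, h⟩
        · exact absurd h hxy
        · exact ⟨h, h2⟩
        · subst h; simpa using h1
        · exact absurd (by simpa using congrArg Passage.opp h) hxy
      obtain ⟨rfl, hl⟩ := hxy'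
      have hpos := Passage.opp_positive hl
      have h1 : inn y.opp ≠ inn y := by simp [inn_eq_inn]
      have h2 : out y.opp ≠ out y := by simp [out_eq_out]
      rcases mem_ends_smoothing hvx with ⟨h, -⟩ | ⟨-, h, h'⟩ | ⟨h, ho, -⟩
      · simp [hl] at h
      · rw [hpos] at h
        rcases mem_ends_smoothing hvy with ⟨h'', -⟩ | ⟨-, -, h''⟩ | ⟨-, h'', -⟩
        · exact hl h''
        · rw [Passage.opp_opp] at h'
          rcases h' with rfl | rfl <;> rcases h'' with h'' | h''
          exacts [h1 h'', inn_ne_out _ _ h'', inn_ne_out _ _ h''.symm, h2 h''.symm]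
        · exact h'' h
      · rw [hpos] at ho
        rcases mem_ends_smoothing hvy with ⟨h'', -⟩ | ⟨-, h'', -⟩ | ⟨h'', -, -⟩
        · exact hl h''
        · exact ho h''
        · simp [h'', Level.swap] at h
  · exact hw.nodup_ports
  · rw [ends_smoothings, List.mem_flatMap, mem_ports]
    constructor
    · rintro ⟨x, hx, hv⟩
      rcases mem_ends_smoothing hv with ⟨_, h⟩ | ⟨h1, _, h | h⟩ | ⟨h1, _, h⟩
      · exact ⟨x, hx, h⟩
      · exact ⟨x, hx, .inl h⟩
      · exact ⟨x.opp, hw.opp_mem x hx h1, .inr h⟩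
      · have hx' := hw.opp_mem x hx (by simp [h1])
        rcases h with h | h | h | h
        exacts [⟨x, hx, .inl h⟩, ⟨x, hx, .inr h⟩, ⟨x.opp, hx', .inl h⟩, ⟨x.opp, hx', .inr h⟩]
    · rintro ⟨x, hx, hv⟩
      by_cases h1 : x.level = .virt
      · exact ⟨x, hx, by simpa [smoothing, h1] using hv⟩
      have hx' := hw.opp_mem x hx h1
      by_cases h2 : χ x.crossing == x.positive
      · rcases hv with rfl | rfl
        · exact ⟨x, hx, by simp [smoothing, h1, h2]⟩
        · refine ⟨x.opp, hx', ?_⟩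
          have : χ x.opp.crossing == x.opp.positive := by simpa [Passage.opp_positive h1] using h2
          rw [smoothing, if_neg (by simpa using h1), if_pos this]
          simp
      · rcases Level.cases_classical h1 with h3 | h3
        · refine ⟨x, hx, ?_⟩
          rw [smoothing, if_neg h1, if_neg h2, if_pos h3]
          simp; tauto
        · refine ⟨x.opp, hx', ?_⟩
          have : ¬ (χ x.opp.crossing == x.opp.positive) := by
            simpa [Passage.opp_positive h1] using h2
          rw [smoothing, if_neg (by simpa using h1), if_neg this, if_pos (by simp [h3])]
          simp; tauto

/-- Each port is met once by the strand outside the crossings and once by an arc inside a crossing;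
the base point is both ends of the strand. -/
theorem IsProper.isClosed_stateArcs {w : List Passage} (hw : IsProper w) (χ : ℕ → Bool) :
    IsClosed (stateArcs χ w) := by
  have hp : (ends (stateArcs χ w)).Perm (((0, 0) :: ports w) ++ (0, 0) :: ports w) := by
    rw [stateArcs, ends_append]
    refine ((ends_seg _ _ _).append (hw.ends_smoothings_perm χ)).trans ?_
    simp only [List.cons_append]
    exact .cons _ List.perm_middle.symm
  exact .of_ends_perm hp (List.nodup_cons.2 ⟨zero_not_mem_ports w 0, hw.nodup_ports⟩)

/-! ### Cutting strands, deleting virtual crossings -/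

/-- Isolates the one arc between `u` and `v`: cutting there or inserting a visit replaces this arc
by two and leaves `L` and `M` alone. -/
theorem seg_decomp (p : ℕ × ℕ) (u v : List Passage) (q : ℕ × ℕ) :
    ∃ (L : ArcSystem (ℕ × ℕ)) (a b : ℕ × ℕ) (M : ArcSystem (ℕ × ℕ)),
      (∀ m, seg p u m = L ++ [(a, m, 0)]) ∧ (∀ m, seg m v q = (m, b, 0) :: M) ∧
      seg p (u ++ v) q = L ++ (a, b, 0) :: M ∧
      ∀ x, seg p (u ++ x :: v) q = L ++ (a, inn x, 0) :: (out x, b, 0) :: M := by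
  induction u generalizing p with
  | nil =>
    cases v with
    | nil => exact ⟨[], p, q, [], by simp [seg]⟩
    | cons y v => exact ⟨[], p, inn y, seg (out y) v q, by simp [seg]⟩
  | cons y u ih =>
    obtain ⟨L, a, b, M, h1, h2, h3, h4⟩ := ih (out y)
    exact ⟨(p, inn y, 0) :: L, a, b, M, by simp [seg, h1], h2, by simp [seg, h3], by simp [seg, h4]⟩

/-- The cut point is fresh, so contracting it restores the uncut strand. -/
theorem IsClosed.cut {p q m : ℕ × ℕ} {u v : List Passage} {L : ArcSystem (ℕ × ℕ)}
    (h : IsClosed (seg p (u ++ v) q ++ L)) (hm : m ∉ ends (seg p (u ++ v) q ++ L)) :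
    IsClosed (seg p u m ++ (seg m v q ++ L)) ∧
    (loopWeights (seg p (u ++ v) q ++ L) : Multiset ℕ) =
      loopWeights (seg p u m ++ (seg m v q ++ L)) := by
  obtain ⟨N, a, b, M, h1, h2, h3, -⟩ := seg_decomp p u v q
  have hp : (seg p (u ++ v) q ++ L).Perm ((a, b, 0) :: (N ++ M ++ L)) := by
    rw [h3]; simp
  have hp' : (seg p u m ++ (seg m v q ++ L)).Perm ((a, m, 0) :: (m, b, 0) :: (N ++ M ++ L)) := by
    rw [h1, h2]
    simp only [List.append_assoc, List.cons_append, List.nil_append]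
    refine List.perm_middle.trans (.cons _ (List.perm_middle.trans (.cons _ (by simp))))
  have hc := (h.perm hp).expand (k := 0) (l := 0) (fun h' => hm ((ends_perm hp).mem_iff.2 h'))
  refine ⟨hc.perm hp'.symm, ?_⟩
  rw [loopWeights_perm h hp, loopWeights_perm (hc.perm hp'.symm) hp', loopWeights_contract hc]
  rfl

/-- The strand passes `a`, `inn x`, `out x`, `b` along three arcs of weight 0, and two contractions
leave the arc from `a` to `b`. -/
theorem loopWeights_delete_virtual {p q : ℕ × ℕ} {u v : List Passage} {x : Passage}
    {L : ArcSystem (ℕ × ℕ)} (h : IsClosed (seg p (u ++ x :: v) q ++ (inn x, out x, 0) :: L)) :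
    (loopWeights (seg p (u ++ x :: v) q ++ (inn x, out x, 0) :: L) : Multiset ℕ) =
      loopWeights (seg p (u ++ v) q ++ L) := by
  obtain ⟨N, a, b, M, -, -, h3, h4⟩ := seg_decomp p u v q
  have hp : (seg p (u ++ x :: v) q ++ (inn x, out x, 0) :: L).Perm
      ((a, inn x, 0) :: (inn x, out x, 0) :: (out x, b, 0) :: (N ++ M ++ L)) := by
    rw [h4]
    simp only [List.append_assoc, List.cons_append]
    refine List.perm_middle.trans (.cons _ ?_)
    refine (List.perm_middle.trans (.cons _ ?_)).trans (.swap _ _ _)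
    rw [← List.append_assoc, ← List.append_assoc]
    exact List.perm_middle
  have hc := h.perm hp
  have hc' := hc.contract (m := 0 + 0)
  rw [loopWeights_perm h hp, loopWeights_contract hc, loopWeights_contract hc']
  refine loopWeights_perm hc'.contract ?_
  rw [h3]
  simp only [List.append_assoc, List.cons_append]
  exact List.perm_middle.symm

theorem IsProper.delete_virtual {u v : List Passage} {x : Passage} (hw : IsProper (u ++ x :: v))
    (hx : x.level = .virt) : IsProper (u ++ v) := by
  refine ⟨hw.nodup.sublist (List.Sublist.map _ ?_), fun y hy hl => ?_⟩
  · exact (List.Sublist.refl u).append (List.sublist_cons_self x v)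
  · have := hw.opp_mem y (by simp at hy ⊢; tauto) hl
    simp only [List.mem_append, List.mem_cons] at this ⊢
    rcases this with h | h | h
    · exact .inl h
    · rw [← h] at hx
      simp at hx
      exact absurd hx hl
    · exact .inr h

theorem loopWeights_delete_virtual_passage {u v : List Passage} {x : Passage}
    (hw : IsProper (u ++ x :: v)) (hx : x.level = .virt) (χ : ℕ → Bool) :
    (loopWeights (stateArcs χ (u ++ x :: v)) : Multiset ℕ) = loopWeights (stateArcs χ (u ++ v)) := by
  have h := hw.isClosed_stateArcs χ
  have hp : (stateArcs χ (u ++ x :: v)).Perm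
      (seg (0, 0) (u ++ x :: v) (0, 0) ++ (inn x, out x, 0) :: smoothings χ (u ++ v)) := by
    simp only [stateArcs, smoothings_append, smoothings_cons, smoothing, hx, if_true]
    exact List.Perm.append_left _ (by simp)
  rw [loopWeights_perm h hp, loopWeights_delete_virtual (h.perm hp)]
  rfl

/-- The visits to virtual crossings are deleted one at a time; the prefix `u` in the induction holds
the letters already treated. -/
theorem loopWeights_gaussCode {w : List Passage} (hw : IsProper w) (χ : ℕ → Bool) :
    (loopWeights (stateArcs χ w) : Multiset ℕ) = loopWeights (stateArcs χ (gaussCode w)) := by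
  suffices H : ∀ v u : List Passage, IsProper (u ++ v) →
      (loopWeights (stateArcs χ (u ++ v)) : Multiset ℕ) =
        loopWeights (stateArcs χ (u ++ gaussCode v)) from H w [] hw
  intro v
  induction v with
  | nil => intro u _; rfl
  | cons x v ih =>
    intro u hu
    by_cases hx : x.level = .virt
    · rw [loopWeights_delete_virtual_passage hu hx, ih u (hu.delete_virtual hx)]
      simp [gaussCode, hx]
    · have := ih (u ++ [x]) (by simpa using hu)
      simpa [gaussCode, hx] using this

/-! ### Change of base point and of labels -/

theorem seg_map {f : ℕ × ℕ → ℕ × ℕ} {u : List Passage} (hf : ∀ v ∈ ports u, f v = v)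
    (p q : ℕ × ℕ) : mapArcs f (seg p u q) = seg (f p) u (f q) := by
  induction u generalizing p with
  | nil => rfl
  | cons x u ih =>
    have h1 : f (inn x) = inn x := hf _ (by simp [ports])
    have h2 : f (out x) = out x := hf _ (by simp [ports])
    simp only [seg, mapArcs_cons, h1]
    rw [ih (fun v hv => hf v (by simp [ports] at hv ⊢; exact .inr (.inr hv))), h2]

theorem mapArcs_eq_self {f : ℕ × ℕ → ℕ × ℕ} {L : ArcSystem (ℕ × ℕ)} (hf : ∀ v ∈ ends L, f v = v) :
    mapArcs f L = L := by
  conv_rhs => rw [← List.map_id L]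
  refine List.map_congr_left fun x hx => ?_
  rw [hf _ (mem_ends.2 ⟨x, hx, .inl rfl⟩), hf _ (mem_ends.2 ⟨x, hx, .inr rfl⟩)]
  rfl

theorem IsProper.perm {u v : List Passage} (hu : IsProper u) (h : u.Perm v) : IsProper v :=
  ⟨(h.map _).nodup_iff.1 hu.nodup,
    fun x hx hl => h.mem_iff.1 (hu.opp_mem x (h.mem_iff.2 hx) hl)⟩

theorem boundary_not_mem_ends {w : List Passage} (hw : IsProper w) (χ : ℕ → Bool) {i : ℕ}
    (hi : i ≠ 0) : (0, i) ∉ ends (stateArcs χ w) := by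
  rw [stateArcs, ends_append, List.mem_append, (ends_seg _ _ _).mem_iff,
    (hw.ends_smoothings_perm χ).mem_iff]
  simp [zero_not_mem_ports, hi]

/-- Cut both closed curves at a second base point `(0, 1)`. They then consist of the same two open
strands, with the two base points exchanged, and a transposition of these identifies the systems up
to order. -/
theorem loopWeights_rotate {u v : List Passage} (hw : IsProper (u ++ v)) (χ : ℕ → Bool) :
    (loopWeights (stateArcs χ (u ++ v)) : Multiset ℕ) = loopWeights (stateArcs χ (v ++ u)) := by
  have hw' : IsProper (v ++ u) := hw.perm List.perm_append_comm
  have h1 := (hw.isClosed_stateArcs χ).cut (boundary_not_mem_ends hw χ one_ne_zero)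
  have h2 := (hw'.isClosed_stateArcs χ).cut (boundary_not_mem_ends hw' χ one_ne_zero)
  rw [stateArcs, stateArcs, h1.2, h2.2]
  have hs : ∀ x : List Passage, ∀ y ∈ ports x, Equiv.swap ((0, 0) : ℕ × ℕ) (0, 1) y = y := by
    intro x y hy
    refine Equiv.swap_apply_of_ne_of_ne ?_ ?_ <;> rintro rfl
    exacts [zero_not_mem_ports _ _ hy, zero_not_mem_ports _ _ hy]
  rw [← loopWeights_mapArcs (Equiv.swap ((0, 0) : ℕ × ℕ) (0, 1)).injective]
  have hL : mapArcs (Equiv.swap ((0, 0) : ℕ × ℕ) (0, 1)) (smoothings χ (u ++ v)) =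
      smoothings χ (u ++ v) :=
    mapArcs_eq_self fun y hy => hs _ _ ((hw.ends_smoothings_perm χ).mem_iff.1 hy)
  rw [mapArcs_append, mapArcs_append, hL, seg_map (hs u), seg_map (hs v), Equiv.swap_apply_left,
    Equiv.swap_apply_right]
  refine (loopWeights_perm h2.1 ?_).symm
  rw [← List.append_assoc, ← List.append_assoc]
  refine List.perm_append_comm.append ?_
  simp only [smoothings_append]
  exact List.perm_append_comm

/-- Change the label of a visit. -/
def relabel (f : ℕ → ℕ) (x : Passage) : Passage := { x with crossing := f x.crossing }

/-- The change of the end points of the strands that belongs to a change of labels. -/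
def relabelPort (f : ℕ → ℕ) : ℕ × ℕ → ℕ × ℕ
  | (0, j) => (0, j)
  | (i + 1, j) => (f i + 1, j)

theorem relabelPort_injective {f : ℕ → ℕ} (hf : f.Injective) : (relabelPort f).Injective := by
  rintro ⟨_ | i, j⟩ ⟨_ | i', j'⟩ h <;> simp_all [relabelPort, hf.eq_iff]

theorem seg_relabel (f : ℕ → ℕ) (p : ℕ × ℕ) (u : List Passage) (q : ℕ × ℕ) :
    seg (relabelPort f p) (u.map (relabel f)) (relabelPort f q) =
      mapArcs (relabelPort f) (seg p u q) := by
  induction u generalizing p with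
  | nil => rfl
  | cons x u ih => simp only [seg, List.map_cons, mapArcs_cons, ← ih]; rfl

theorem smoothings_relabel (f : ℕ → ℕ) {χ χ' : ℕ → Bool} {u : List Passage}
    (h : ∀ x ∈ u, χ (f x.crossing) = χ' x.crossing) :
    smoothings χ (u.map (relabel f)) = mapArcs (relabelPort f) (smoothings χ' u) := by
  induction u with
  | nil => rfl
  | cons x u ih =>
    rw [List.map_cons, smoothings_cons, smoothings_cons, mapArcs_append,
      ih fun y hy => h y (by simp [hy])]
    congr 1
    have hx := h x (by simp)
    have hp : (relabel f x).positive = x.positive := rfl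
    have hl : (relabel f x).level = x.level := rfl
    have hc : (relabel f x).crossing = f x.crossing := rfl
    unfold smoothing
    simp only [hp, hl, hc, hx]
    split_ifs <;> rfl

end VirtualKnot

namespace VirtualKnot

/-! ### Loops formed by two involutions -/

section Dihedral

variable {X S : Type*}

theorem iterate_conj (E V : X → X) (k : ℕ) (x : X) :
    (E ∘ V)^[k] (E x) = E ((V ∘ E)^[k] x) :=
  (Function.Semiconj.iterate_right (f := E) (ga := V ∘ E) (gb := E ∘ V) (fun _ => rfl) k x).symm

/-- An alternating word of odd length in two involutions is conjugate to one of them, hence has no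
fixed point. The induction moves one letter to the other side and exchanges the roles of `E` and
`V`. -/
theorem apply_iterate_ne (k : ℕ) : ∀ (E V : X → X), E.Involutive → (∀ x, E x ≠ x) →
    V.Involutive → (∀ x, V x ≠ x) → ∀ x, V ((E ∘ V)^[k] x) ≠ x := by
  induction k with
  | zero => intro E V _ _ _ h x; exact h x
  | succ k ih =>
    intro E V hE hE' hV hV' x h
    rw [Function.iterate_succ_apply, Function.comp_apply, iterate_conj] at h
    exact ih V E hV hV' hE hE' (V x) (hV.eq_iff.1 h)

/-- Following a loop never leads back to the same edge in the opposite direction: the two directions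
of a loop are different cycles. -/
theorem iterate_ne_apply {E V : X → X} (hE : E.Involutive) (hE' : ∀ x, E x ≠ x)
    (hV : V.Involutive) (hV' : ∀ x, V x ≠ x) (k : ℕ) (x : X) : (E ∘ V)^[k] x ≠ E x := by
  cases k with
  | zero => exact (hE' x).symm
  | succ k =>
    rw [Function.iterate_succ_apply']
    intro h
    exact apply_iterate_ne k E V hE hE' hV hV' x (hE.injective h)

/-- The sum of `c` over the first `k` points of the orbit of `x`. -/
def orbitSum (f : X → X) (c : X → ℤ) (k : ℕ) (x : X) : ℤ := ∑ j ∈ Finset.range k, c (f^[j] x)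

theorem orbitSum_succ (f : X → X) (c : X → ℤ) (k : ℕ) (x : X) :
    orbitSum f c (k + 1) x = orbitSum f c k x + c (f^[k] x) := Finset.sum_range_succ _ _

theorem orbitSum_add (f : X → X) (c : X → ℤ) (k l : ℕ) (x : X) :
    orbitSum f c (k + l) x = orbitSum f c k x + orbitSum f c l (f^[k] x) := by
  rw [orbitSum, Finset.sum_range_add]
  simp only [orbitSum, ← Function.iterate_add_apply, add_comm]

/-- The sum of `c` over the cycle of `x`. -/
noncomputable def cycleSum (f : X → X) (c : X → ℤ) (x : X) : ℤ :=
  orbitSum f c (f.minimalPeriod x) x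

theorem orbitSum_mod (f : X → X) (c : X → ℤ) (k : ℕ) (x : X) :
    orbitSum f c k x =
      (k / f.minimalPeriod x : ℕ) * cycleSum f c x + orbitSum f c (k % f.minimalPeriod x) x := by
  set m := f.minimalPeriod x with hm
  have key : ∀ q r, orbitSum f c (q * m + r) x = q * cycleSum f c x + orbitSum f c r x := by
    intro q r
    induction q with
    | zero => simp
    | succ q ih =>
      rw [show (q + 1) * m + r = m + (q * m + r) by ring, orbitSum_add, hm,
        Function.iterate_minimalPeriod, ← hm, ih]
      push_cast
      rw [cycleSum, ← hm]
      ring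
  conv_lhs => rw [← Nat.div_add_mod' k m]
  exact key _ _

/-- If the colour is fixed by the holonomy of the cycle, its transport depends only on the point
reached and not on the number of turns made. -/
theorem zpow_orbitSum_eq {f : X → X} (hf : f.Injective) (c : X → ℤ) (τ : Equiv.Perm S) {s : S}
    {x : X} (hs : s = (τ ^ cycleSum f c x) s) {k l : ℕ} (h : f^[k] x = f^[l] x) :
    (τ ^ orbitSum f c k x) s = (τ ^ orbitSum f c l x) s := by
  have hmod : k % f.minimalPeriod x = l % f.minimalPeriod x := by
    wlog hkl : k ≤ l generalizing k l
    · exact (this h.symm (by omega)).symm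
    have h1 : f^[k] (f^[l - k] x) = f^[k] x := by
      rw [← Function.iterate_add_apply, Nat.add_sub_cancel' hkl, h]
    have h2 : Function.IsPeriodicPt f (l - k) x := hf.iterate k h1
    exact (Nat.modEq_iff_dvd' hkl).2 h2.minimalPeriod_dvd
  have hfix : ∀ n : ℕ, (τ ^ ((n : ℤ) * cycleSum f c x)) s = s := by
    intro n
    induction n with
    | zero => simp
    | succ n ih =>
      push_cast
      rw [add_mul, one_mul, zpow_add, Equiv.Perm.mul_apply, ← hs, ih]
  have hk : ∀ n : ℕ, (τ ^ orbitSum f c n x) s = (τ ^ orbitSum f c (n % f.minimalPeriod x) x) s := by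
    intro n
    rw [orbitSum_mod, add_comm, zpow_add, Equiv.Perm.mul_apply, hfix]
  rw [hk k, hk l, hmod]

variable {E V : X → X} {c : X → ℤ}

theorem colour_iterate {τ : Equiv.Perm S} {φ : X → S} (h1 : ∀ x, φ (E x) = φ x)
    (h2 : ∀ x, φ (V x) = (τ ^ c x) (φ x)) (k : ℕ) (x : X) :
    φ ((E ∘ V)^[k] x) = (τ ^ orbitSum (E ∘ V) c k x) (φ x) := by
  induction k with
  | zero => simp [orbitSum]
  | succ k ih =>
    rw [Function.iterate_succ_apply', Function.comp_apply, h1, h2, ih, orbitSum_succ,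
      ← Equiv.Perm.mul_apply, ← zpow_add, add_comm]

/-- The colourings of a family of loops: the colour of one point of each loop can be chosen among
the fixed points of the holonomy. -/
theorem card_dihedral_colourings [Finite X] {ι : Type*} [Fintype ι] (hE : E.Involutive)
    (hE' : ∀ x, E x ≠ x) (hV : V.Involutive) (hV' : ∀ x, V x ≠ x) (hc : ∀ x, c (V x) = -c x)
    (rep : ι → X)
    (hrep : ∀ x, ∃! i, (∃ k, (E ∘ V)^[k] (rep i) = x) ∨ ∃ k, (E ∘ V)^[k] (rep i) = E x)
    (τ : Equiv.Perm S) :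
    Nat.card {φ : X → S // (∀ x, φ (E x) = φ x) ∧ ∀ x, φ (V x) = (τ ^ c x) (φ x)} =
      ∏ i, fixedPoints τ (cycleSum (E ∘ V) c (rep i)) := by
  set f := E ∘ V with hf
  have hfi : f.Injective := hE.injective.comp hV.injective
  have hper : ∀ x, ∃ k, 0 < k ∧ f^[k] x = x := fun x => by
    obtain ⟨k, hk, h⟩ := Function.Injective.mem_periodicPts hfi x
    exact ⟨k, hk, h⟩
  rw [show (∏ i, fixedPoints τ (cycleSum f c (rep i))) =
    Nat.card (∀ i, {s : S // s = (τ ^ cycleSum f c (rep i)) s}) from Nat.card_pi.symm]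
  refine Nat.card_congr (Equiv.ofBijective (fun φ i => ⟨φ.1 (rep i), ?_⟩) ⟨?_, ?_⟩)
  · have := colour_iterate φ.2.1 φ.2.2 (f.minimalPeriod (rep i)) (rep i)
    rwa [← hf, Function.iterate_minimalPeriod] at this
  · rintro ⟨φ, h1, h2⟩ ⟨ψ, h3, h4⟩ h
    refine Subtype.ext (funext fun x => ?_)
    have key : ∀ i, φ (rep i) = ψ (rep i) := fun i => congrArg Subtype.val (congrFun h i)
    obtain ⟨i, ⟨k, hk⟩ | ⟨k, hk⟩, -⟩ := hrep x
    · simp only [← hk, hf, colour_iterate h1 h2, colour_iterate h3 h4, key]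
    · change φ x = ψ x
      rw [← h1 x, ← h3 x]
      simp only [← hk, hf, colour_iterate h1 h2, colour_iterate h3 h4, key]
  · intro s
    choose i hi huniq using hrep
    -- The colour of `x` is transported from the representative of its loop to whichever of `x` and
    -- `E x` lies on the forward cycle; what must be seen is that all ways of doing this agree.
    have hex : ∀ x, ∃ t : S, ∀ j k, (f^[k] (rep j) = x ∨ f^[k] (rep j) = E x) →
        t = (τ ^ orbitSum f c k (rep j)) (s j).1 := by
      intro x
      have hj : ∀ j k, (f^[k] (rep j) = x ∨ f^[k] (rep j) = E x) → j = i x := fun j k h =>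
        huniq x j (h.imp (fun h => ⟨k, h⟩) fun h => ⟨k, h⟩)
      -- The forward cycle cannot contain both `x` and `E x`.
      have hne : ∀ k l, f^[k] (rep (i x)) = x → f^[l] (rep (i x)) = E x → False := by
        intro k l hk hl
        rcases le_total k l with hkl | hkl
        · have : f^[l - k] x = E x := by
            conv_lhs => rw [← hk]
            rw [← hl, ← Function.iterate_add_apply, Nat.sub_add_cancel hkl]
          exact iterate_ne_apply hE hE' hV hV' _ _ this
        · have : f^[k - l] (E x) = E (E x) := by
            rw [hE, ← hl, ← Function.iterate_add_apply, Nat.sub_add_cancel hkl, hk]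
          exact iterate_ne_apply hE hE' hV hV' _ _ this
      rcases hi x with ⟨k, hk⟩ | ⟨k, hk⟩
      · refine ⟨(τ ^ orbitSum f c k (rep (i x))) (s (i x)).1, fun j l h => ?_⟩
        obtain rfl := hj j l h
        rcases h with h | h
        · exact zpow_orbitSum_eq hfi c τ (s (i x)).2 (hk.trans h.symm)
        · exact (hne _ _ hk h).elim
      · refine ⟨(τ ^ orbitSum f c k (rep (i x))) (s (i x)).1, fun j l h => ?_⟩
        obtain rfl := hj j l h
        rcases h with h | h
        · exact (hne _ _ h hk).elim
        · exact zpow_orbitSum_eq hfi c τ (s (i x)).2 (hk.trans h.symm)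
    choose φ hφ using hex
    have hφE : ∀ x, φ (E x) = φ x := by
      intro x
      rcases hi x with ⟨k, hk⟩ | ⟨k, hk⟩
      · rw [hφ x _ k (.inl hk), hφ (E x) _ k (.inr (by rw [hE, hk]))]
      · rw [hφ x _ k (.inr hk), hφ (E x) _ k (.inl hk)]
    have hφf : ∀ x, (∃ k, f^[k] (rep (i x)) = x) → φ (f x) = (τ ^ c x) (φ x) := by
      rintro x ⟨k, hk⟩
      rw [hφ x _ k (.inl hk), hφ (f x) (i x) (k + 1) (.inl (by rw [Function.iterate_succ_apply', hk])),
        orbitSum_succ, hk, ← Equiv.Perm.mul_apply, ← zpow_add, add_comm]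
    refine ⟨⟨φ, hφE, fun x => ?_⟩, ?_⟩
    · rcases hi x with ⟨k, hk⟩ | ⟨k, hk⟩
      · rw [← hφE (V x)]
        exact hφf x ⟨k, hk⟩
      · have h1 : f (V x) = E x := by simp [hf, hV x]
        -- As `f (V x) = E x`, the point `V x` precedes `E x` on a cycle, so it too is reached from
        -- the representative. The colour condition at `V x`, inverted, is the one at `x`.
        obtain ⟨l, hl0, hl⟩ := hper (V x)
        obtain ⟨l, rfl⟩ := Nat.exists_eq_succ_of_ne_zero hl0.ne'
        have h2 : f^[l + k] (rep (i x)) = V x := by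
          rw [Function.iterate_add_apply, hk, ← h1, ← Function.iterate_succ_apply, hl]
        have h3 : i x = i (V x) := huniq (V x) _ (.inl ⟨_, h2⟩)
        have h4 := hφf (V x) ⟨l + k, h3 ▸ h2⟩
        rw [h1, hφE, hc, zpow_neg, Equiv.Perm.eq_inv_iff_eq] at h4
        exact h4.symm
    · funext j
      refine Subtype.ext ?_
      have := hφ (rep j) j 0 (.inl rfl)
      simpa [orbitSum] using this

end Dihedral

end VirtualKnot

namespace VirtualKnot

/-! ### The loops of a state, by arc systems -/

theorem IsProper.get_injective {w : List Passage} (hw : IsProper w) {p q : Fin w.length}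
    (hc : (w.get p).crossing = (w.get q).crossing) (ht : (w.get p).toLeft = (w.get q).toLeft) :
    p = q :=
  List.nodup_iff_injective_get.1 hw.nodup.of_map (hw.eq (w.get_mem p) (w.get_mem q) hc ht)

theorem get_partner {w : List Passage} (hw : IsGaussWord w) (p : Fin w.length) :
    w.get (partner w p) = (w.get p).opp := by
  obtain ⟨q, hq⟩ := List.get_of_mem (hw _ (w.get_mem p)).1
  have hqp : q ≠ p := by
    rintro rfl
    have := congrArg Passage.toLeft hq
    simp at this
  cases h : (List.finRange w.length).find?
    (fun q => q ≠ p ∧ (w.get q).crossing = (w.get p).crossing) with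
  | none =>
    -- The opposite visit exists, so the search succeeds and the default value in `partner` is not
    -- used.
    have := List.find?_eq_none.1 h q (List.mem_finRange q)
    simp [hqp, -List.get_eq_getElem, hq] at this
  | some r =>
    have hr := List.find?_some h
    simp only [decide_eq_true_eq] at hr
    have ht : (w.get r).toLeft = !(w.get p).toLeft := by
      by_contra hne
      exact hr.1 (hw.isProper.get_injective hr.2 (by simpa using hne))
    rw [show partner w p = r by rw [partner, h]; rfl]
    exact hw.isProper.eq (w.get_mem r) (hw _ (w.get_mem p)).1 hr.2 ht

theorem partner_partner {w : List Passage} (hw : IsGaussWord w) (p : Fin w.length) :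
    partner w (partner w p) = p :=
  hw.isProper.get_injective (by simp only [get_partner hw, Passage.opp_opp])
    (by simp only [get_partner hw, Passage.opp_opp])

theorem partner_ne {w : List Passage} (hw : IsGaussWord w) (p : Fin w.length) :
    partner w p ≠ p := fun h => by
  have := congrArg (fun q => (w.get q).toLeft) h
  simp only [get_partner hw] at this
  simp at this

/-- The same edge, seen from its other end. -/
def across (w : List Passage) (x : Dart w) : Dart w := leave w x.1 (!x.2)

/-- The other end of the arc inside a smoothed or virtual crossing. -/
def through (w : List Passage) (s : Finset ℕ) (x : Dart w) : Dart w :=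
  if (w.get x.1).level = Level.virt then (x.1, !x.2)
  else if smoothedOriented s (w.get x.1) then (partner w x.1, !x.2)
  else (partner w x.1, x.2)

/-- One step along a loop is an arc inside a double point followed by an edge. In a Gauss word both
factors are involutions without fixed points, so the colouring count for two involutions applies. -/
theorem follow_eq (w : List Passage) (s : Finset ℕ) : follow w s = across w ∘ through w s := by
  funext x
  simp only [follow, Function.comp_apply, across, through]
  split_ifs <;> simp

theorem across_across (w : List Passage) : Function.Involutive (across w) := by
  rintro ⟨p, _ | _⟩ <;> simp [across, leave, -finRotate_apply, -finRotate_symm_apply]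

theorem across_ne (w : List Passage) (x : Dart w) : across w x ≠ x := by
  obtain ⟨p, _ | _⟩ := x <;> simp [across, leave]

theorem edgeOf_across (w : List Passage) (x : Dart w) : edgeOf w (across w x) = edgeOf w x := by
  obtain ⟨p, _ | _⟩ := x <;>
    simp [across, leave, edgeOf, -finRotate_apply, -finRotate_symm_apply]

theorem edgeOf_eq {w : List Passage} {x y : Dart w} (h : edgeOf w x = edgeOf w y) :
    x = y ∨ x = across w y := by
  obtain ⟨p, _ | _⟩ := x <;> obtain ⟨q, _ | _⟩ := y <;>
    simp_all [edgeOf, across, leave, -finRotate_apply, -finRotate_symm_apply, Equiv.symm_apply_eq]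

theorem smoothedOriented_partner {w : List Passage} (hw : IsGaussWord w) (s : Finset ℕ)
    {p : Fin w.length} (hp : (w.get p).level ≠ .virt) :
    smoothedOriented s (w.get (partner w p)) = smoothedOriented s (w.get p) := by
  simp only [get_partner hw, smoothedOriented, Passage.opp_positive hp, Passage.opp_crossing]

theorem through_through {w : List Passage} (hw : IsGaussWord w) (s : Finset ℕ) :
    Function.Involutive (through w s) := by
  rintro ⟨p, d⟩
  by_cases h1 : (w.get p).level = .virt
  · simp [through, h1, -List.get_eq_getElem]
  have h1' : (w.get (partner w p)).level ≠ .virt := by rw [get_partner hw]; simpa using h1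
  have h2 := smoothedOriented_partner hw s h1
  by_cases h3 : smoothedOriented s (w.get p)
  · simp only [through, h1, if_false, h3, if_true, h1', h2, partner_partner hw, Bool.not_not]
  · simp only [through, h1, if_false, h3, h1', h2, partner_partner hw, Bool.false_eq_true]

theorem through_ne {w : List Passage} (hw : IsGaussWord w) (s : Finset ℕ) (x : Dart w) :
    through w s x ≠ x := by
  obtain ⟨p, d⟩ := x
  unfold through
  split_ifs
  · simp
  · simp
  · simp [partner_ne hw]

/-- The same nodal arrow met in the opposite direction has the opposite sign. -/
theorem arrowSign_through {w : List Passage} (hw : IsGaussWord w) (s : Finset ℕ) (x : Dart w) :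
    arrowSign w s (through w s x) = -arrowSign w s x := by
  obtain ⟨p, d⟩ := x
  by_cases h1 : (w.get p).level = .virt
  · simp [through, arrowSign, h1, -List.get_eq_getElem]
  have h1' : (w.get (partner w p)).level ≠ .virt := by rw [get_partner hw]; simpa using h1
  have h2 := smoothedOriented_partner hw s h1
  by_cases h3 : smoothedOriented s (w.get p)
  · simp only [through, arrowSign, h1, if_false, h3, if_true, h1', h2, or_true, neg_zero]
  · have h4 : (w.get (partner w p)).toLeft = !(w.get p).toLeft := by rw [get_partner hw]; rfl
    simp only [through, arrowSign, h1, if_false, h3, h1', h2, Bool.false_eq_true, or_false, h4]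
    cases (w.get p).toLeft <;> cases d <;> rfl

theorem follow_injective {w : List Passage} (hw : IsGaussWord w) (s : Finset ℕ) :
    (follow w s).Injective := by
  rw [follow_eq]
  exact (across_across w).injective.comp (through_through hw s).injective

/-- There are `2 * w.length` darts, so a cycle closes within the number of iterations used in
`orbit`. -/
theorem orbit_eq {w : List Passage} {f : Dart w → Dart w} (hf : f.Injective) (x : Dart w) :
    orbit w f x = (Finset.range (f.minimalPeriod x)).image fun k => f^[k] x := by
  have hpos : 0 < f.minimalPeriod x :=
    Function.minimalPeriod_pos_of_mem_periodicPts (hf.mem_periodicPts x)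
  have hle : f.minimalPeriod x ≤ 2 * w.length := by
    have := Finset.card_le_univ ((Finset.range (f.minimalPeriod x)).image fun k => f^[k] x)
    rw [Finset.card_image_of_injOn] at this
    · simpa [mul_comm] using this
    · simpa using Function.iterate_injOn_Iio_minimalPeriod (f := f) (x := x)
  ext y
  simp only [orbit, Finset.mem_image, Finset.mem_range]
  constructor
  · rintro ⟨k, -, rfl⟩
    exact ⟨k % f.minimalPeriod x, Nat.mod_lt _ hpos, Function.iterate_mod_minimalPeriod_eq⟩
  · rintro ⟨k, hk, rfl⟩
    exact ⟨k, hk.trans_le hle, rfl⟩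

theorem mem_orbit {w : List Passage} {f : Dart w → Dart w} (hf : f.Injective) {x y : Dart w} :
    y ∈ orbit w f x ↔ ∃ k, f^[k] x = y := by
  have hpos : 0 < f.minimalPeriod x :=
    Function.minimalPeriod_pos_of_mem_periodicPts (hf.mem_periodicPts x)
  simp only [orbit_eq hf, Finset.mem_image, Finset.mem_range]
  exact ⟨fun ⟨k, _, h⟩ => ⟨k, h⟩, fun ⟨k, h⟩ => ⟨k % f.minimalPeriod x, Nat.mod_lt _ hpos,
    by rw [Function.iterate_mod_minimalPeriod_eq, h]⟩⟩

theorem sum_orbit {w : List Passage} {f : Dart w → Dart w} (hf : f.Injective) (c : Dart w → ℤ)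
    (x : Dart w) : ∑ y ∈ orbit w f x, c y = cycleSum f c x := by
  rw [orbit_eq hf, Finset.sum_image]
  · rfl
  · simpa using Function.iterate_injOn_Iio_minimalPeriod (f := f) (x := x)

theorem orbit_apply {w : List Passage} {f : Dart w → Dart w} (hf : f.Injective) (x : Dart w) :
    orbit w f (f x) = orbit w f x := by
  ext y
  rw [mem_orbit hf, mem_orbit hf]
  refine ⟨fun ⟨k, h⟩ => ⟨k + 1, h⟩, ?_⟩
  rintro ⟨k, rfl⟩
  obtain ⟨l, hl, h⟩ := hf.mem_periodicPts x
  refine ⟨k + (l - 1), ?_⟩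
  rw [← Function.iterate_succ_apply, show (k + (l - 1)).succ = k + l by omega,
    Function.iterate_add_apply, h]

theorem orbit_eq_of_mem {w : List Passage} {f : Dart w → Dart w} (hf : f.Injective) {x y : Dart w}
    (h : y ∈ orbit w f x) : orbit w f y = orbit w f x := by
  obtain ⟨k, rfl⟩ := (mem_orbit hf).1 h
  clear h
  induction k with
  | zero => rfl
  | succ k ih => rw [Function.iterate_succ_apply', orbit_apply hf, ih]

theorem self_mem_orbit {w : List Passage} {f : Dart w → Dart w} (hf : f.Injective) (x : Dart w) :
    x ∈ orbit w f x := (mem_orbit hf).2 ⟨0, rfl⟩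

/-- Reversal of direction conjugates `follow` to its inverse, as `hstep` says, so it carries a cycle
to the reversed cycle. -/
theorem orbit_across {w : List Passage} (hw : IsGaussWord w) (s : Finset ℕ) (x : Dart w) :
    orbit w (follow w s) (across w x) = (orbit w (follow w s) x).image (across w) := by
  have hf := follow_injective hw s
  have hE := across_across w
  have hstep : ∀ y, follow w s (across w (follow w s y)) = across w y := by
    intro y
    simp only [follow_eq, Function.comp_apply]
    rw [hE, through_through hw s]
  have key : ∀ z, (orbit w (follow w s) z).image (across w) ⊆
      orbit w (follow w s) (across w z) := by
    intro z y hy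
    obtain ⟨u, hu, rfl⟩ := Finset.mem_image.1 hy
    obtain ⟨k, rfl⟩ := (mem_orbit hf).1 hu
    clear hu hy
    induction k with
    | zero => exact self_mem_orbit hf _
    | succ k ih =>
      rw [Function.iterate_succ_apply']
      have h1 := orbit_apply hf (across w (follow w s ((follow w s)^[k] z)))
      rw [hstep, orbit_eq_of_mem hf ih] at h1
      rw [h1]
      exact self_mem_orbit hf _
  refine Finset.Subset.antisymm (fun y hy => ?_) (key x)
  have h2 := key (across w x) (Finset.mem_image_of_mem (across w) hy)
  rw [hE] at h2
  exact Finset.mem_image.2 ⟨_, h2, hE y⟩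

/-- The loop through a dart. -/
def loopOf (w : List Passage) (s : Finset ℕ) (x : Dart w) : Finset (Fin w.length) × ℕ :=
  ((orbit w (follow w s) x).image (edgeOf w),
    (∑ y ∈ orbit w (follow w s) x, arrowSign w s y).natAbs / 2)

/-- Reversal keeps the edges and negates the sum of the signs, whose absolute value alone is
recorded. The sum is first shifted by one step of `follow`, so that the sign at `through w s y` can
be compared with the one at `y`. -/
theorem loopOf_across {w : List Passage} (hw : IsGaussWord w) (s : Finset ℕ) (x : Dart w) :
    loopOf w s (across w x) = loopOf w s x := by
  have hf := follow_injective hw s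
  have hE := across_across w
  have h1 : ∑ y ∈ orbit w (follow w s) (across w x), arrowSign w s y =
      -∑ y ∈ orbit w (follow w s) x, arrowSign w s y := by
    rw [orbit_across hw, Finset.sum_image fun a _ b _ h => hE.injective h]
    have h2 : (orbit w (follow w s) x).image (follow w s) = orbit w (follow w s) x := by
      refine Finset.eq_of_subset_of_card_le (fun y hy => ?_) ?_
      · obtain ⟨u, hu, rfl⟩ := Finset.mem_image.1 hy
        rw [← orbit_eq_of_mem hf hu, ← orbit_apply hf]
        exact self_mem_orbit hf _
      · rw [Finset.card_image_of_injective _ hf]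
    conv_lhs => rw [← h2]
    rw [Finset.sum_image fun a _ b _ h => hf h, ← Finset.sum_neg_distrib]
    refine Finset.sum_congr rfl fun y _ => ?_
    rw [follow_eq, Function.comp_apply, hE, arrowSign_through hw]
  unfold loopOf
  rw [h1, Int.natAbs_neg, orbit_across hw, Finset.image_image]
  congr 1
  exact Finset.image_congr fun y _ => edgeOf_across w y

/-- A loop is recorded by its set of edges. An edge has only two darts, exchanged by `across`, so
its edges determine the loop up to direction. -/
theorem existsUnique_loop {w : List Passage} (hw : IsGaussWord w) (s : Finset ℕ)
    (rep : {l // l ∈ loops w s} → Dart w) (hrep : ∀ l, loopOf w s (rep l) = l.1) (x : Dart w) :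
    ∃! l, (∃ k, (across w ∘ through w s)^[k] (rep l) = x) ∨
      ∃ k, (across w ∘ through w s)^[k] (rep l) = across w x := by
  have hf := follow_injective hw s
  rw [← follow_eq]
  simp only [← mem_orbit hf]
  have hloop : ∀ l y, y ∈ orbit w (follow w s) (rep l) → l.1 = loopOf w s y := by
    intro l y hy
    rw [← hrep l]
    unfold loopOf
    rw [orbit_eq_of_mem hf hy]
  refine ⟨⟨loopOf w s x, Finset.mem_image_of_mem _ (Finset.mem_univ x)⟩, ?_, fun l hl => ?_⟩
  · set l : {l // l ∈ loops w s} :=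
      ⟨loopOf w s x, Finset.mem_image_of_mem _ (Finset.mem_univ x)⟩ with hl
    have h1 : edgeOf w x ∈ (loopOf w s (rep l)).1 := by
      rw [hrep]
      exact Finset.mem_image_of_mem _ (self_mem_orbit hf x)
    obtain ⟨y, hy, hyx⟩ := Finset.mem_image.1 h1
    rcases edgeOf_eq hyx with rfl | rfl
    exacts [.inl hy, .inr hy]
  · refine Subtype.ext ?_
    rcases hl with h | h
    · exact hloop l x h
    · exact (hloop l _ h).trans (loopOf_across hw s x)

/-! ### Colourings of darts and colourings of the arcs of a state -/

/-- The point on the strands where a dart ends. -/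
def port (w : List Passage) (x : Dart w) : ℕ × ℕ :=
  if x.2 then inn (w.get x.1) else out (w.get x.1)

theorem port_injective {w : List Passage} (hw : IsProper w) : (port w).Injective := by
  rintro ⟨p, _ | _⟩ ⟨q, _ | _⟩ h
  · have := out_eq_out.1 (show out (w.get p) = out (w.get q) from h)
    rw [hw.get_injective this.1 this.2]
  · exact absurd h.symm (inn_ne_out _ _)
  · exact absurd h (inn_ne_out _ _)
  · have := inn_eq_inn.1 (show inn (w.get p) = inn (w.get q) from h)
    rw [hw.get_injective this.1 this.2]

theorem mem_ports_iff {w : List Passage} {v : ℕ × ℕ} : v ∈ ports w ↔ ∃ x, port w x = v := by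
  rw [mem_ports]
  constructor
  · rintro ⟨y, hy, h⟩
    obtain ⟨p, rfl⟩ := List.get_of_mem hy
    rcases h with rfl | rfl
    exacts [⟨(p, true), rfl⟩, ⟨(p, false), rfl⟩]
  · rintro ⟨⟨p, _ | _⟩, rfl⟩
    exacts [⟨_, w.get_mem p, .inr rfl⟩, ⟨_, w.get_mem p, .inl rfl⟩]

theorem forall_seg {S : Type*} (φ : ℕ × ℕ → S) (x : Passage) (l : List Passage) (p q : ℕ × ℕ) :
    (∀ a ∈ seg p (x :: l) q, φ a.2.1 = φ a.1) ↔
      φ (inn x) = φ p ∧ (∀ i (h : i < l.length), φ (inn ((x :: l)[i + 1]'(by simp; omega))) =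
        φ (out ((x :: l)[i]'(by simp; omega)))) ∧
        φ q = φ (out ((x :: l)[l.length])) := by
  induction l generalizing x p with
  | nil => simp [seg]
  | cons y l ih =>
    rw [seg]
    simp only [List.mem_cons, forall_eq_or_imp]
    rw [ih]
    refine and_congr_right fun _ => ?_
    rw [← and_assoc]
    refine and_congr ⟨fun ⟨h1, h2⟩ i hi => ?_, fun h => ⟨h 0 (by simp), fun i hi => ?_⟩⟩ (by simp)
    · cases i with
      | zero => simpa using h1
      | succ i => simpa using h2 i (by simpa using hi)
    · simpa using h (i + 1) (by simpa using hi)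

theorem seg_weight {p q : ℕ × ℕ} {u : List Passage} {a : (ℕ × ℕ) × (ℕ × ℕ) × ℤ}
    (ha : a ∈ seg p u q) : a.2.2 = 0 := by
  induction u generalizing p with
  | nil => simp [seg] at ha; simp [ha]
  | cons x u ih =>
    rcases List.mem_cons.1 ha with rfl | ha
    exacts [rfl, ih ha]

/-- The arcs of the strand are the edges of the diagram, except that the edge arriving at visit 0 is
subdivided by the base point. -/
theorem forall_seg_closed {S : Type*} (φ : ℕ × ℕ → S) (x : Passage) (l : List Passage) :
    (∀ a ∈ seg (0, 0) (x :: l) (0, 0), φ a.2.1 = φ a.1) ↔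
      φ (0, 0) = φ (port (x :: l) (⟨0, by simp⟩, true)) ∧
        ∀ y : Dart (x :: l), φ (port _ (across _ y)) = φ (port _ y) := by
  rw [forall_seg]
  set w := x :: l with hw
  -- The edge after the last visit returns to visit 0.
  have hlast : finRotate (l.length + 1) (Fin.last l.length) = ⟨0, by simp⟩ := by
    simp
  have hsucc : ∀ i (h : i < l.length), finRotate (l.length + 1) ⟨i, by omega⟩ = ⟨i + 1, by omega⟩ :=
    fun i h => Fin.ext (by rw [coe_finRotate_of_ne_last]; simp [Fin.ext_iff]; omega)
  have hE : (∀ y : Dart w, φ (port _ (across _ y)) = φ (port _ y)) ↔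
      ∀ p : Fin w.length, φ (inn (w.get (finRotate w.length p))) = φ (out (w.get p)) := by
    constructor
    · intro h p
      exact h (p, false)
    · rintro h ⟨p, _ | _⟩
      · exact h p
      · have := h ((finRotate w.length).symm p)
        rw [Equiv.apply_symm_apply] at this
        exact this.symm
  rw [hE]
  constructor
  · rintro ⟨h1, h2, h3⟩
    refine ⟨h1.symm, fun p => ?_⟩
    obtain ⟨i, hi⟩ := p
    by_cases h : i < l.length
    · have := h2 i h
      have e := hsucc i h
      change φ (inn (w.get (finRotate (l.length + 1) ⟨i, _⟩))) = _
      rw [e]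
      exact this
    · obtain rfl : i = l.length := by simp [hw] at hi; omega
      change φ (inn (w.get (finRotate (l.length + 1) (Fin.last l.length)))) = _
      rw [hlast]
      exact h1.trans h3
  · rintro ⟨h1, h2⟩
    refine ⟨h1.symm, fun i hi => ?_, ?_⟩
    · have := h2 ⟨i, by simp [hw]; omega⟩
      change φ (inn (w.get (finRotate (l.length + 1) ⟨i, _⟩))) = _ at this
      rw [hsucc i hi] at this
      exact this
    · have := h2 ⟨l.length, by simp [hw]⟩
      change φ (inn (w.get (finRotate (l.length + 1) (Fin.last l.length)))) = _ at this
      rw [hlast] at this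
      exact h1.trans this

theorem smoothing_oriented {s : Finset ℕ} {x : Passage} (h1 : x.level ≠ .virt)
    (h2 : smoothedOriented s x = true) :
    smoothing (fun n => decide (n ∈ s)) x = [(inn x, out x.opp, 0)] := by
  unfold smoothing
  rw [if_neg h1]
  exact if_pos h2

theorem smoothing_disoriented {s : Finset ℕ} {x : Passage} (h1 : x.level = .over)
    (h2 : ¬ smoothedOriented s x = true) :
    smoothing (fun n => decide (n ∈ s)) x =
      [(inn x, inn x.opp, nodalSign x), (out x, out x.opp, -nodalSign x)] := by
  unfold smoothing
  rw [if_neg (by simp [h1])]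
  exact (if_neg h2).trans (if_pos h1)

/-- The arc system lists every arc inside a crossing in one direction only, while the darts see
both. By `arrowSign_through` the two conditions are equivalent (`hflip`), and a disoriented
smoothing can be treated at its over visit. -/
theorem forall_smoothings {S : Type*} {w : List Passage} (hw : IsGaussWord w) (s : Finset ℕ)
    (τ : Equiv.Perm S) (φ : ℕ × ℕ → S) :
    (∀ a ∈ smoothings (fun n => decide (n ∈ s)) w, φ a.2.1 = (τ ^ a.2.2) (φ a.1)) ↔
      ∀ y : Dart w, φ (port _ (through w s y)) = (τ ^ arrowSign w s y) (φ (port _ y)) := by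
  have hflip : ∀ y : Dart w,
      φ (port _ (through w s (through w s y))) =
        (τ ^ arrowSign w s (through w s y)) (φ (port _ (through w s y))) ↔
      φ (port _ (through w s y)) = (τ ^ arrowSign w s y) (φ (port _ y)) := by
    intro y
    rw [through_through hw, arrowSign_through hw, zpow_neg, Equiv.Perm.eq_inv_iff_eq, eq_comm]
  have hsm : ∀ a, a ∈ smoothings (fun n => decide (n ∈ s)) w ↔
      ∃ p : Fin w.length, a ∈ smoothing (fun n => decide (n ∈ s)) (w.get p) := by
    intro a
    rw [smoothings, List.mem_flatMap]
    exact ⟨fun ⟨x, hx, h⟩ => by obtain ⟨p, rfl⟩ := List.get_of_mem hx; exact ⟨p, h⟩,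
      fun ⟨p, h⟩ => ⟨_, w.get_mem p, h⟩⟩
  simp only [hsm, forall_exists_index]
  rw [forall_comm]
  have hvirt : ∀ (p : Fin w.length) (d : Bool), (w.get p).level = .virt →
      through w s (p, d) = (p, !d) ∧ arrowSign w s (p, d) = 0 := by
    intro p d h
    exact ⟨by simp only [through, h, if_true], by simp only [arrowSign, h, true_or, if_true]⟩
  have hor : ∀ (p : Fin w.length) (d : Bool), (w.get p).level ≠ .virt →
      smoothedOriented s (w.get p) = true →
      through w s (p, d) = (partner w p, !d) ∧ arrowSign w s (p, d) = 0 := by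
    intro p d h h'
    exact ⟨by simp only [through, h, h', if_true, if_false],
      by simp only [arrowSign, h', or_true, if_true]⟩
  have hdis : ∀ (p : Fin w.length) (d : Bool), (w.get p).level ≠ .virt →
      ¬ smoothedOriented s (w.get p) = true →
      through w s (p, d) = (partner w p, d) ∧
        arrowSign w s (p, d) = if (w.get p).toLeft = d then 1 else -1 := by
    intro p d h h'
    exact ⟨by simp only [through, h, h', if_false, Bool.false_eq_true],
      by simp only [arrowSign, h, h', or_self, if_false, Bool.false_eq_true]⟩
  have hinn : ∀ p, port w (p, true) = inn (w.get p) := fun p => rfl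
  have hout : ∀ p, port w (p, false) = out (w.get p) := fun p => rfl
  constructor
  · rintro h ⟨p, d⟩
    by_cases h1 : (w.get p).level = .virt
    · have h2 := h p (inn (w.get p), out (w.get p), 0) (by simp only [smoothing, h1]; simp)
      obtain ⟨e1, e2⟩ := hvirt p d h1
      rw [e1, e2]
      cases d
      · simpa [hinn, hout] using h2.symm
      · simpa [hinn, hout] using h2
    by_cases h2 : smoothedOriented s (w.get p) = true
    · obtain ⟨e1, e2⟩ := hor p d h1 h2
      rw [e1, e2]
      cases d
      · have h3 := h (partner w p) (inn (w.get (partner w p)), out (w.get (partner w p)).opp, 0) (by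
          have h1' : (w.get (partner w p)).level ≠ .virt := by rw [get_partner hw]; simpa using h1
          rw [smoothing_oriented h1' ((smoothedOriented_partner hw s h1).trans h2)]
          simp)
        rw [get_partner hw, Passage.opp_opp] at h3
        simpa [hinn, hout, get_partner hw, -List.get_eq_getElem] using h3.symm
      · have h3 := h p (inn (w.get p), out (w.get p).opp, 0) (by
          rw [smoothing_oriented h1 h2]
          simp)
        simpa [hinn, hout, get_partner hw, -List.get_eq_getElem] using h3
    · have hover : ∀ q : Fin w.length, (w.get q).level = .over →
          ¬ smoothedOriented s (w.get q) = true → ∀ d, φ (port _ (through w s (q, d))) =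
            (τ ^ arrowSign w s (q, d)) (φ (port _ (q, d))) := by
        intro q hq hq' d
        have hq1 : (w.get q).level ≠ .virt := by simp [hq, -List.get_eq_getElem]
        obtain ⟨e1, e2⟩ := hdis q d hq1 hq'
        have hmem : smoothing (fun n => decide (n ∈ s)) (w.get q) =
          [(inn (w.get q), inn (w.get q).opp, nodalSign (w.get q)),
            (out (w.get q), out (w.get q).opp, -nodalSign (w.get q))] :=
          smoothing_disoriented hq hq'
        rw [e1, e2]
        cases d
        · have h3 := h q (out (w.get q), out (w.get q).opp, -nodalSign (w.get q)) (by simp [hmem, -List.get_eq_getElem])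
          simp only at h3
          rw [hout, hout, get_partner hw, h3]
          congr 2
          unfold nodalSign
          cases (w.get q).toLeft <;> rfl
        · have h3 := h q (inn (w.get q), inn (w.get q).opp, nodalSign (w.get q)) (by simp [hmem, -List.get_eq_getElem])
          rw [hinn, hinn, get_partner hw, h3]
          rfl
      rcases Level.cases_classical h1 with h3 | h3
      · exact hover p h3 h2 d
      · rw [← hflip, (hdis p d h1 h2).1]
        refine hover (partner w p) ?_ ?_ d
        · rw [get_partner hw]; simp [h3, -List.get_eq_getElem]
        · rwa [smoothedOriented_partner hw s h1]
  · intro h p a ha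
    unfold smoothing at ha
    split_ifs at ha with h1 h2 h3
    · have := h (p, true)
      rw [(hvirt p true h1).1, (hvirt p true h1).2] at this
      simp only [List.mem_singleton] at ha
      subst ha
      exact this
    · have := h (p, true)
      rw [(hor p true h1 h2).1, (hor p true h1 h2).2] at this
      simp only [List.mem_singleton] at ha
      subst ha
      simp only [← get_partner hw]
      exact this
    · simp only [List.mem_cons, List.not_mem_nil, or_false] at ha
      rcases ha with rfl | rfl
      · have := h (p, true)
        rw [(hdis p true h1 h2).1, (hdis p true h1 h2).2] at this
        simp only [← get_partner hw]
        exact this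
      · have := h (p, false)
        rw [(hdis p false h1 h2).1, (hdis p false h1 h2).2, hout, hout] at this
        simp only [← get_partner hw]
        rw [this]
        congr 2
        unfold nodalSign
        cases (w.get p).toLeft <;> rfl
    · simp at ha

/-- Restrict a colouring to the ports, which correspond to the darts; the colour of the base point
is forced by the edge on which it lies. -/
theorem card_colourings_stateArcs {S : Type*} {w : List Passage} (hw : IsGaussWord w)
    (hne : w ≠ []) (s : Finset ℕ) (τ : Equiv.Perm S) (s₀ : S) :
    colourings τ s₀ (stateArcs (fun n => decide (n ∈ s)) w) =
      Nat.card {φ : Dart w → S // (∀ x, φ (across w x) = φ x) ∧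
        ∀ x, φ (through w s x) = (τ ^ arrowSign w s x) (φ x)} := by
  obtain ⟨x, l, rfl⟩ := List.exists_cons_of_ne_nil hne
  set w := x :: l with hwdef
  set b : Dart w := (⟨0, by simp [hwdef]⟩, true) with hb
  have hsat : ∀ φ : ℕ × ℕ → S,
      (∀ a ∈ stateArcs (fun n => decide (n ∈ s)) w, φ a.2.1 = (τ ^ a.2.2) (φ a.1)) ↔
      φ (0, 0) = φ (port w b) ∧ (∀ y : Dart w, φ (port _ (across _ y)) = φ (port _ y)) ∧
      ∀ y : Dart w, φ (port _ (through w s y)) = (τ ^ arrowSign w s y) (φ (port _ y)) := by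
    intro φ
    rw [← forall_smoothings hw, ← and_assoc, ← forall_seg_closed, stateArcs]
    simp only [List.mem_append, or_imp, forall_and]
    refine and_congr_left fun _ => forall₂_congr fun a ha => ?_
    rw [seg_weight ha, zpow_zero, Equiv.Perm.one_apply]
  have hends : ∀ v, v ∈ ends (stateArcs (fun n => decide (n ∈ s)) w) ↔
      v = (0, 0) ∨ ∃ y, port w y = v := by
    intro v
    rw [stateArcs, ends_append, List.mem_append, (ends_seg _ _ _).mem_iff,
      (hw.isProper.ends_smoothings_perm _).mem_iff, ← mem_ports_iff]
    simp
  have h0 : ∀ y, port w y ≠ (0, 0) := fun y h =>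
    zero_not_mem_ports w 0 (mem_ports_iff.2 ⟨y, h⟩)
  have hpi := port_injective hw.isProper
  refine Nat.card_congr (Equiv.ofBijective (fun φ => ⟨fun y => φ.1 (port w y),
    ((hsat φ.1).1 φ.2.2).2⟩) ⟨fun φ ψ h => ?_, fun φ => ?_⟩)
  · have hval : ∀ y, φ.1 (port w y) = ψ.1 (port w y) := fun y =>
      congrFun (congrArg Subtype.val h) y
    refine Subtype.ext (funext fun v => ?_)
    by_cases hv : v ∈ ends (stateArcs (fun n => decide (n ∈ s)) w)
    · rcases (hends v).1 hv with rfl | ⟨y, rfl⟩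
      · rw [((hsat φ.1).1 φ.2.2).1, ((hsat ψ.1).1 ψ.2.2).1, hval]
      · exact hval y
    · rw [φ.2.1 v hv, ψ.2.1 v hv]
  · classical
    obtain ⟨φ, h1, h2⟩ := φ
    -- The base point takes the colour of the dart `b` arriving at visit 0; every other point that
    -- is not a port must have colour `s₀`.
    set ψ : ℕ × ℕ → S := fun v =>
      if h : ∃ y, port w y = v then φ h.choose else if v = (0, 0) then φ b else s₀ with hψ
    have hψp : ∀ y, ψ (port w y) = φ y := by
      intro y
      have hex : ∃ z, port w z = port w y := ⟨y, rfl⟩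
      simp only [hψ, dif_pos hex]
      rw [hpi hex.choose_spec]
    have hψ0 : ψ (0, 0) = φ b := by
      simp [hψ, h0]
    refine ⟨⟨ψ, fun v hv => ?_, (hsat ψ).2 ⟨by rw [hψ0, hψp], ?_, ?_⟩⟩, Subtype.ext (funext hψp)⟩
    · have := (not_congr (hends v)).1 hv
      push Not at this
      simp [hψ, this.1, this.2]
    · simpa only [hψp] using h1
    · simpa only [hψp] using h2

/-- Both sides count the same colourings, once by contracting arcs and once by choosing a colour on
one dart per loop. Hence the weights agree, and halving gives the indices stored in `loops`. -/
theorem loopWeights_stateArcs {w : List Passage} (hw : IsGaussWord w) (hne : w ≠ [])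
    (s : Finset ℕ) :
    (loopWeights (stateArcs (fun n => decide (n ∈ s)) w) : Multiset ℕ).map (· / 2) =
      (loops w s).val.map Prod.snd := by
  have hex : ∀ l : {l // l ∈ loops w s}, ∃ x, loopOf w s x = l.1 := fun l => by
    obtain ⟨x, -, h⟩ := Finset.mem_image.1 l.2
    exact ⟨x, h⟩
  choose rep hrep using hex
  have key : (loopWeights (stateArcs (fun n => decide (n ∈ s)) w) : Multiset ℕ) =
      (Finset.univ : Finset {l // l ∈ loops w s}).val.map fun l =>
        (cycleSum (follow w s) (arrowSign w s) (rep l)).natAbs := by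
    refine multiset_eq_of_prod_fixedPoints _ _ fun l _ => ?_
    rw [Multiset.map_coe, Multiset.prod_coe,
      ← colourings_eq_prod _ none (hw.isProper.isClosed_stateArcs _),
      card_colourings_stateArcs hw hne,
      card_dihedral_colourings (across_across w) (across_ne w) (through_through hw s)
        (through_ne hw s) (arrowSign_through hw s) rep (existsUnique_loop hw s rep hrep),
      Multiset.map_map, follow_eq]
    simp only [Function.comp_def, fixedPoints_natAbs]
    rfl
  rw [key, Multiset.map_map]
  have : ∀ l : {l // l ∈ loops w s},
      (cycleSum (follow w s) (arrowSign w s) (rep l)).natAbs / 2 = l.1.2 := by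
    intro l
    rw [← hrep l, ← sum_orbit (follow_injective hw s)]
    rfl
  simp only [Function.comp_def, this]
  change Multiset.map (Prod.snd ∘ Subtype.val) _ = _
  rw [← Multiset.map_map]
  congr 1
  exact Multiset.attach_map_val _

end VirtualKnot

namespace VirtualKnot

/-! ### The arrow polynomial as a state sum over arc systems -/

theorem A_zero : A 0 = 1 := by simp [A]

theorem A_mul (m n : ℤ) : A m * A n = A (m + n) := by
  rw [A, A, A, ← MvPolynomial.C_mul, LaurentPolynomial.T_add]

theorem K_zero : K 0 = 1 := by simp [K]

/-- The value `d` of an additional loop. -/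
noncomputable def loopFactor : ArrowRing := -A 2 - A (-2)

/-- The coefficient of `A ^ 2` is `-1`. -/
theorem loopFactor_ne_zero : loopFactor ≠ 0 := by
  have h : loopFactor = MvPolynomial.C (-LaurentPolynomial.T 2 - LaurentPolynomial.T (-2)) := by
    simp [loopFactor, A]
  rw [h, Ne, MvPolynomial.C_eq_zero]
  intro h0
  have := congrArg (fun f : ℤ[T;T⁻¹] => f.coeff 2) h0
  simp at this

/-- The product of the values of the loops with the given weights. -/
noncomputable def loopsValue (M : Multiset ℕ) : ArrowRing :=
  (M.map fun n => loopFactor * K (n / 2)).prod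

theorem loopsValue_add (M N : Multiset ℕ) :
    loopsValue (M + N) = loopsValue M * loopsValue N := by
  simp [loopsValue]

/-- The summand of the state whose crossings in `s` have the smoothing with coefficient `A`. -/
noncomputable def stateValue (w : List Passage) (s : Finset ℕ) : ArrowRing :=
  A (2 * s.card - (classicalCrossings w).card) *
    loopsValue (loopWeights (stateArcs (fun n => decide (n ∈ s)) w))

/-- The arrow polynomial, times `d`. -/
noncomputable def stateSum (w : List Passage) : ArrowRing :=
  ∑ s ∈ (classicalCrossings w).powerset, stateValue w s

/-- The exponent `|S| - 1` becomes `|S|`, one factor per loop; this uses that a state of a nonempty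
word has at least one loop. The empty word is one loop of weight 0. -/
theorem loopFactor_mul_arrowPolynomial {w : List Passage} (hw : IsGaussWord w) :
    loopFactor * arrowPolynomial w = stateSum w := by
  by_cases hne : w = []
  · subst hne
    simp [arrowPolynomial, stateSum, stateValue, classicalCrossings, A_zero, stateArcs, seg,
      smoothings, loopWeights, loopWeightsAux, loopsValue, K_zero]
  rw [arrowPolynomial, if_neg hne, stateSum, Finset.mul_sum]
  refine Finset.sum_congr rfl fun s hs => ?_
  have hs' := Finset.mem_powerset.1 hs
  have hcard : ((classicalCrossings w \ s).card : ℤ) = (classicalCrossings w).card - s.card := by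
    rw [Finset.card_sdiff_of_subset hs', Nat.cast_sub (Finset.card_le_card hs')]
  have hpos : 0 < (loops w s).card := by
    obtain ⟨x, l, rfl⟩ := List.exists_cons_of_ne_nil hne
    exact Finset.card_pos.2 ⟨_, Finset.mem_image_of_mem _
      (Finset.mem_univ ((⟨0, by simp⟩, true) : Dart (x :: l)))⟩
  have hval : loopsValue (loopWeights (stateArcs (fun n => decide (n ∈ s)) w)) =
      loopFactor ^ (loops w s).card * ∏ l ∈ loops w s, K l.2 := by
    have h1 : ∀ M : Multiset ℕ, loopsValue M = ((M.map (· / 2)).map fun n => loopFactor * K n).prod := by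
      intro M
      rw [loopsValue, Multiset.map_map]
      rfl
    rw [h1, loopWeights_stateArcs hw hne, Multiset.map_map, ← Finset.prod_const,
      ← Finset.prod_mul_distrib]
    rfl
  obtain ⟨k, hk⟩ := Nat.exists_eq_succ_of_ne_zero hpos.ne'
  rw [stateValue, hval, hcard, hk, Nat.succ_sub_one, pow_succ, ← loopFactor]
  rw [show (s.card : ℤ) - ((classicalCrossings w).card - s.card) =
    2 * s.card - (classicalCrossings w).card by ring]
  ring

theorem classicalCrossings_gaussCode (w : List Passage) :
    classicalCrossings (gaussCode w) = classicalCrossings w := by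
  simp [classicalCrossings, gaussCode, List.filter_filter]

theorem classicalCrossings_append (u v : List Passage) :
    classicalCrossings (u ++ v) = classicalCrossings u ∪ classicalCrossings v := by
  simp [classicalCrossings]

theorem classicalCrossings_perm {u v : List Passage} (h : u.Perm v) :
    classicalCrossings u = classicalCrossings v :=
  List.toFinset_eq_of_perm _ _ ((h.filter _).map _)

theorem mem_classicalCrossings {w : List Passage} {n : ℕ} :
    n ∈ classicalCrossings w ↔ ∃ x ∈ w, x.level ≠ .virt ∧ x.crossing = n := by
  simp [classicalCrossings, and_assoc]

theorem stateSum_gaussCode {w : List Passage} (hw : IsProper w) :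
    stateSum (gaussCode w) = stateSum w := by
  simp only [stateSum, stateValue, classicalCrossings_gaussCode, loopWeights_gaussCode hw]

theorem stateSum_rotate {u v : List Passage} (hw : IsProper (u ++ v)) :
    stateSum (u ++ v) = stateSum (v ++ u) := by
  simp only [stateSum, stateValue, loopWeights_rotate hw,
    classicalCrossings_perm (List.perm_append_comm (l₁ := u) (l₂ := v))]

theorem sum_powerset_image {M : Type*} [AddCommMonoid M] {f : ℕ → ℕ} {s : Finset ℕ}
    (hf : Set.InjOn f s) (F : Finset ℕ → M) :
    ∑ x ∈ (s.image f).powerset, F x = ∑ x ∈ s.powerset, F (x.image f) := by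
  rw [Finset.powerset_image, Finset.sum_image]
  intro x hx y hy hxy
  change x.image f = y.image f at hxy
  have hx' : x ⊆ s := by simpa using hx
  have hy' : y ⊆ s := by simpa using hy
  ext a
  have hmem : ∀ z ⊆ s, ∀ a ∈ s, a ∈ z ↔ f a ∈ z.image f := fun z hz a ha =>
    ⟨fun h => Finset.mem_image_of_mem f h, fun h => by
      obtain ⟨b, hb, hba⟩ := Finset.mem_image.1 h
      rwa [← hf (hz hb) ha hba]⟩
  constructor
  · intro ha
    rw [hmem y hy' a (hx' ha), ← hxy]
    exact Finset.mem_image_of_mem f ha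
  · intro ha
    rw [hmem x hx' a (hy' ha)]
    exact hxy ▸ Finset.mem_image_of_mem f ha

theorem sum_powerset_union {M : Type*} [AddCommMonoid M] {s t : Finset ℕ} (h : Disjoint s t)
    (F : Finset ℕ → M) :
    ∑ x ∈ (s ∪ t).powerset, F x = ∑ a ∈ s.powerset, ∑ b ∈ t.powerset, F (a ∪ b) := by
  induction t using Finset.induction_on generalizing F with
  | empty => simp
  | insert n t hn ih =>
    have hns : n ∉ s := fun h' => Finset.disjoint_left.1 h h' (Finset.mem_insert_self n t)
    rw [Finset.union_insert, Finset.sum_powerset_insert (by simp [hn, hns]),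
      ih (Finset.disjoint_insert_right.1 h).2, ih (Finset.disjoint_insert_right.1 h).2,
      ← Finset.sum_add_distrib]
    refine Finset.sum_congr rfl fun a _ => ?_
    rw [Finset.sum_powerset_insert hn]
    simp only [Finset.union_insert]

theorem sum_powerset_toFinset {M : Type*} [AddCommMonoid M] {l : List ℕ} (hl : l.Nodup)
    (F : Finset ℕ → M) :
    ∑ x ∈ l.toFinset.powerset, F x = (l.sublists'.map fun t => F t.toFinset).sum := by
  induction l generalizing F with
  | nil => simp
  | cons n l ih =>
    obtain ⟨hn, hl⟩ := List.nodup_cons.1 hl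
    rw [List.toFinset_cons, Finset.sum_powerset_insert (by simpa using hn), ih hl,
      ih hl fun t => F (insert n t), List.sublists'_cons, List.map_append, List.sum_append,
      List.map_map]
    simp [Function.comp_def]

theorem classicalCrossings_relabel (f : ℕ → ℕ) (w : List Passage) :
    classicalCrossings (w.map (relabel f)) = (classicalCrossings w).image f := by
  ext n
  simp only [mem_classicalCrossings, List.mem_map, Finset.mem_image]
  constructor
  · rintro ⟨_, ⟨x, hx, rfl⟩, hl, rfl⟩
    exact ⟨x.crossing, ⟨x, hx, hl, rfl⟩, rfl⟩
  · rintro ⟨_, ⟨x, hx, hl, rfl⟩, rfl⟩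
    exact ⟨_, ⟨x, hx, rfl⟩, hl, rfl⟩

theorem stateSum_relabel {f : ℕ → ℕ} (hf : f.Injective) (w : List Passage) :
    stateSum (w.map (relabel f)) = stateSum w := by
  rw [stateSum, classicalCrossings_relabel, sum_powerset_image hf.injOn, stateSum]
  refine Finset.sum_congr rfl fun s _ => ?_
  have h : stateArcs (fun n => decide (n ∈ s.image f)) (w.map (relabel f)) =
      mapArcs (relabelPort f) (stateArcs (fun n => decide (n ∈ s)) w) := by
    rw [stateArcs, stateArcs, mapArcs_append, ← seg_relabel,
      ← smoothings_relabel f (χ := fun n => decide (n ∈ s.image f))]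
    · rfl
    · intro x _
      simp [hf.eq_iff]
  rw [stateValue, stateValue, h, loopWeights_mapArcs (relabelPort_injective hf),
    classicalCrossings_relabel, Finset.card_image_of_injective _ hf,
    Finset.card_image_of_injective _ hf]

end VirtualKnot

namespace VirtualKnot

/-! ### Simplification of arc systems -/

section Simplify
variable {α β : Type*} [DecidableEq β]

/-- The closed arc system `L` has the same loops as the closed arc system `M` together with loops
of the weights `ws`. -/
def Simplifies (L : ArcSystem β) (ws : List ℕ) (M : ArcSystem β) : Prop :=
  IsClosed L → IsClosed M ∧ (loopWeights L : Multiset ℕ) = ws + loopWeights M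

theorem Simplifies.refl (L : ArcSystem β) : Simplifies L [] L := fun h => ⟨h, by simp⟩

theorem Simplifies.trans {L M N : ArcSystem β} {v w : List ℕ} (h : Simplifies L v M)
    (h' : Simplifies M w N) : Simplifies L (v ++ w) N := fun hL => by
  obtain ⟨hM, h1⟩ := h hL
  obtain ⟨hN, h2⟩ := h' hM
  exact ⟨hN, by rw [h1, h2, ← Multiset.coe_add, add_assoc]⟩

theorem Simplifies.of_perm {L M : ArcSystem β} (h : L.Perm M) : Simplifies L [] M := fun hL =>
  ⟨hL.perm h, by simp [loopWeights_perm hL h]⟩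

theorem Simplifies.flip (a b : β) (k : ℤ) (L : ArcSystem β) :
    Simplifies ((a, b, k) :: L) [] ((b, a, -k) :: L) := fun hL =>
  ⟨hL.flip, by simp [loopWeights_flip hL]⟩

theorem Simplifies.loop (a : β) (k : ℤ) (L : ArcSystem β) :
    Simplifies ((a, a, k) :: L) [k.natAbs] L := fun hL =>
  ⟨hL.of_loop, by rw [loopWeights_loop, ← Multiset.cons_coe]; rfl⟩

theorem Simplifies.contract (a b c : β) (k l : ℤ) (L : ArcSystem β) :
    Simplifies ((a, b, k) :: (b, c, l) :: L) [] ((a, c, k + l) :: L) := fun hL =>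
  ⟨hL.contract, by simp [loopWeights_contract hL]⟩

theorem Simplifies.extract [DecidableEq α] {b c : α} {l : ℤ} {L M : ArcSystem α} (h : extract b L = some (c, l, M))
    (ρ : α → β) (R : ArcSystem β) :
    Simplifies (mapArcs ρ L ++ R) [] (mapArcs ρ ((b, c, l) :: M) ++ R) := by
  rcases extract_some h with h | h
  · exact .of_perm ((mapArcs_perm ρ h).append_right R)
  · refine (Simplifies.of_perm ((mapArcs_perm ρ h).append_right R)).trans ?_
    have := Simplifies.flip (ρ c) (ρ b) (-l) (mapArcs ρ M ++ R)
    simpa using this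

/-- Remove the point `b`, where two arcs meet, from an arc system; the list holds the weight of
the loop that this closes, if any. -/
def contractAt [DecidableEq α] (b : α) (L : ArcSystem α) : List ℕ × ArcSystem α :=
  match extract b L with
  | none => ([], L)
  | some (c, k, M) =>
    if c = b then ([k.natAbs], M)
    else match extract b M with
      | none => ([], L)
      | some (d, l, N) => ([], (c, d, -k + l) :: N)

/-- Remove several points from an arc system. -/
def contractAll [DecidableEq α] : List α → ArcSystem α → List ℕ × ArcSystem α
  | [], L => ([], L)
  | b :: bs, L =>
    let r := contractAt b L
    let s := contractAll bs r.2
    (r.1 ++ s.1, s.2)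

/-- The contraction is computed on a concrete system `L`; in the applications `ρ` puts in the actual
labels of a diagram and `R` is everything outside the place of the move. -/
theorem Simplifies.contractAt [DecidableEq α] (b : α) (L : ArcSystem α) (ρ : α → β) (R : ArcSystem β) :
    Simplifies (mapArcs ρ L ++ R) (contractAt b L).1 (mapArcs ρ (contractAt b L).2 ++ R) := by
  unfold VirtualKnot.contractAt
  split
  · exact .refl _
  · rename_i c k M h
    split_ifs with hc
    · subst hc
      exact (Simplifies.extract h ρ R).trans (by simpa using Simplifies.loop _ _ _)
    · split
      · exact .refl _
      · rename_i d l N h'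
        refine (Simplifies.extract h ρ R).trans (w := []) ?_
        have h1 : Simplifies (mapArcs ρ M ++ (mapArcs ρ [(b, c, k)] ++ R)) []
            (mapArcs ρ ((b, d, l) :: N) ++ (mapArcs ρ [(b, c, k)] ++ R)) :=
          Simplifies.extract h' ρ _
        have h2 : Simplifies (mapArcs ρ ((b, c, k) :: M) ++ R) []
            (mapArcs ρ M ++ (mapArcs ρ [(b, c, k)] ++ R)) :=
          Simplifies.of_perm (List.perm_middle.symm)
        have h3 : Simplifies (mapArcs ρ ((b, d, l) :: N) ++ (mapArcs ρ [(b, c, k)] ++ R)) []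
            ((ρ b, ρ c, k) :: (ρ b, ρ d, l) :: (mapArcs ρ N ++ R)) :=
          Simplifies.of_perm ((List.perm_middle (l₁ := (ρ b, ρ d, l) :: mapArcs ρ N)))
        exact ((h2.trans h1).trans h3).trans
          ((Simplifies.flip _ _ _ _).trans (Simplifies.contract _ _ _ _ _ _))

theorem Simplifies.contractAll [DecidableEq α] (bs : List α) (L : ArcSystem α) (ρ : α → β) (R : ArcSystem β) :
    Simplifies (mapArcs ρ L ++ R) (contractAll bs L).1 (mapArcs ρ (contractAll bs L).2 ++ R) := by
  induction bs generalizing L with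
  | nil => exact .refl _
  | cons b bs ih => exact (Simplifies.contractAt b L ρ R).trans (ih _)

/-- Orient every arc towards the end with the larger key, and sort the arcs. -/
def sortArcs (key : α → ℕ) (L : ArcSystem α) : ArcSystem α :=
  (L.map fun x => if key x.1 ≤ key x.2.1 then x else (x.2.1, x.1, -x.2.2)).insertionSort
    fun x y => key x.1 ≤ key y.1

/-- Serves as a normal form: once only the end points of the cut pieces remain, states with the same
connections and weights can be compared as lists. -/
theorem Simplifies.sortArcs (key : α → ℕ) (L : ArcSystem α) (ρ : α → β) (R : ArcSystem β) :
    Simplifies (mapArcs ρ L ++ R) [] (mapArcs ρ (sortArcs key L) ++ R) := by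
  refine Simplifies.trans (v := []) ?_
    (.of_perm ((mapArcs_perm ρ (List.perm_insertionSort _ _).symm).append_right R))
  induction L generalizing R with
  | nil => exact .refl _
  | cons x L ih =>
    have h1 : Simplifies (mapArcs ρ (x :: L) ++ R) []
        (mapArcs ρ ((if key x.1 ≤ key x.2.1 then x else (x.2.1, x.1, -x.2.2)) :: L) ++ R) := by
      split_ifs
      · exact .refl _
      · exact .flip _ _ _ _
    refine (h1.trans (w := []) ?_)
    have h2 := ih (mapArcs ρ [if key x.1 ≤ key x.2.1 then x else (x.2.1, x.1, -x.2.2)] ++ R)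
    exact ((Simplifies.of_perm List.perm_middle.symm).trans h2).trans
      (.of_perm List.perm_middle)

end Simplify

/-! ### Lists of terms -/

section Terms
variable {κ : Type*}

/-- The value of a list of terms: `(x, m, c)` stands for `c A ^ m X x`. -/
noncomputable def termsValue (X : κ → ArrowRing) (l : List (κ × ℤ × ℤ)) : ArrowRing :=
  (l.map fun t => t.2.2 • (A t.2.1 * X t.1)).sum

theorem termsValue_append (X : κ → ArrowRing) (l m : List (κ × ℤ × ℤ)) :
    termsValue X (l ++ m) = termsValue X l + termsValue X m := by
  simp [termsValue]

theorem termsValue_cons (X : κ → ArrowRing) (t : κ × ℤ × ℤ) (m : List (κ × ℤ × ℤ)) :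
    termsValue X (t :: m) = t.2.2 • (A t.2.1 * X t.1) + termsValue X m := by
  simp [termsValue]

/-- Multiply a list of terms by `c A ^ e`. -/
def scaleTerms (e c : ℤ) (l : List (κ × ℤ × ℤ)) : List (κ × ℤ × ℤ) :=
  l.map fun t => (t.1, e + t.2.1, c * t.2.2)

theorem termsValue_scaleTerms (X : κ → ArrowRing) (e c : ℤ) (l : List (κ × ℤ × ℤ)) :
    termsValue X (scaleTerms e c l) = c • (A e * termsValue X l) := by
  induction l with
  | nil => simp [termsValue, scaleTerms]
  | cons t l ih =>
    rw [scaleTerms, List.map_cons, termsValue_cons, ← scaleTerms, ih, termsValue_cons, ← A_mul,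
      mul_add, smul_add, mul_smul, mul_smul_comm, mul_assoc]

/-- Add a term to a list of terms. -/
def addTerm [DecidableEq κ] (t : κ × ℤ × ℤ) : List (κ × ℤ × ℤ) → List (κ × ℤ × ℤ)
  | [] => [t]
  | u :: l =>
    if u.1 = t.1 ∧ u.2.1 = t.2.1 then
      if u.2.2 + t.2.2 = 0 then l else (u.1, u.2.1, u.2.2 + t.2.2) :: l
    else u :: addTerm t l

theorem termsValue_addTerm [DecidableEq κ] (X : κ → ArrowRing) (t : κ × ℤ × ℤ) (l : List (κ × ℤ × ℤ)) :
    termsValue X (addTerm t l) = t.2.2 • (A t.2.1 * X t.1) + termsValue X l := by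
  induction l with
  | nil => simp [addTerm, termsValue]
  | cons u l ih =>
    unfold addTerm
    split_ifs with h h0
    · rw [termsValue_cons, h.1, h.2, ← add_assoc, ← add_smul, add_comm t.2.2, h0, zero_smul,
        zero_add]
    · rw [termsValue_cons, termsValue_cons, h.1, h.2, ← add_assoc, ← add_smul, add_comm t.2.2]
    · rw [termsValue_cons, termsValue_cons, ih, add_left_comm]

/-- Collect the terms of a list. -/
def collect [DecidableEq κ] (l : List (κ × ℤ × ℤ)) : List (κ × ℤ × ℤ) := l.foldr addTerm []

theorem termsValue_collect [DecidableEq κ] (X : κ → ArrowRing) (l : List (κ × ℤ × ℤ)) :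
    termsValue X (collect l) = termsValue X l := by
  induction l with
  | nil => rfl
  | cons t l ih => rw [collect, List.foldr_cons, termsValue_addTerm, ← collect, ih, termsValue_cons]

/-- Two lists of terms are equal after collection, up to the factor `c A ^ e`. -/
def termsAgree [DecidableEq κ] (e c : ℤ) (l m : List (κ × ℤ × ℤ)) : Bool :=
  (collect (l ++ scaleTerms e (-c) m)).isEmpty

/-- The formal difference collects to nothing. The keys are treated as independent symbols, so the
identity holds for every valuation `X`; this is what allows one check to serve all outer states. -/
theorem termsValue_eq_of_termsAgree [DecidableEq κ] {e c : ℤ} {l m : List (κ × ℤ × ℤ)} (h : termsAgree e c l m = true)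
    (X : κ → ArrowRing) : termsValue X l = c • (A e * termsValue X m) := by
  have h' := termsValue_collect X (l ++ scaleTerms e (-c) m)
  rw [List.isEmpty_iff.1 h, termsValue_append, termsValue_scaleTerms, neg_smul] at h'
  exact add_neg_eq_zero.1 h'.symm

end Terms

/-- The terms of `d ^ n`. -/
def loopFactorPow : ℕ → List (ℤ × ℤ)
  | 0 => [(0, 1)]
  | n + 1 => (loopFactorPow n).flatMap fun t => [(t.1 + 2, -t.2), (t.1 - 2, -t.2)]

theorem termsValue_loopFactorPow {κ : Type*} (X : κ → ArrowRing) (x : κ) (e : ℤ) (n : ℕ) :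
    termsValue X ((loopFactorPow n).map fun t => (x, e + t.1, t.2)) = A e * (loopFactor ^ n * X x) := by
  induction n generalizing e with
  | zero => simp [loopFactorPow, termsValue]
  | succ n ih =>
    have h : ∀ l : List (ℤ × ℤ), termsValue X ((l.flatMap fun t =>
        [(t.1 + 2, -t.2), (t.1 - 2, -t.2)]).map fun t => (x, e + t.1, t.2)) =
        loopFactor * termsValue X (l.map fun t => (x, e + t.1, t.2)) := by
      intro l
      induction l with
      | nil => simp [termsValue]
      | cons t l ihl =>
        have hr : termsValue X ((t :: l).map fun t => (x, e + t.1, t.2)) = t.2 • (A (e + t.1) * X x) +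
            termsValue X (l.map fun t => (x, e + t.1, t.2)) := termsValue_cons _ _ _
        rw [List.flatMap_cons, List.map_append, termsValue_append, ihl, hr, mul_add]
        congr 1
        have h1 : e + (t.1 + 2) = 2 + (e + t.1) := by ring
        have h2 : e + (t.1 - 2) = -2 + (e + t.1) := by ring
        simp only [List.map_cons, List.map_nil, termsValue_cons, h1, h2, ← A_mul, loopFactor]
        simp only [termsValue, List.map_nil, List.sum_nil, neg_smul, mul_smul_comm]
        simp only [zsmul_eq_mul]
        ring
    rw [loopFactorPow, h, ih, pow_succ]
    ring

end VirtualKnot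

namespace VirtualKnot

/-! ### Local changes of a word -/

theorem smoothings_congr {χ χ' : ℕ → Bool} {u : List Passage}
    (h : ∀ x ∈ u, x.level ≠ .virt → χ x.crossing = χ' x.crossing) :
    smoothings χ u = smoothings χ' u := by
  induction u with
  | nil => rfl
  | cons x u ih =>
    rw [smoothings_cons, smoothings_cons, ih fun y hy => h y (by simp [hy])]
    congr 1
    unfold smoothing
    by_cases hx : x.level = .virt
    · simp [hx]
    · simp only [hx, if_false, h x (by simp) hx]

/-- The arcs of three pieces of a closed curve, with the end points `(0, 0), …, (0, 5)`. -/
def innerArcs (χ : ℕ → Bool) (T₁ T₂ T₃ : List Passage) : ArcSystem (ℕ × ℕ) :=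
  seg (0, 0) T₁ (0, 1) ++ (seg (0, 2) T₂ (0, 3) ++ (seg (0, 4) T₃ (0, 5) ++
    smoothings χ (T₁ ++ (T₂ ++ T₃))))

/-- The arcs of the three pieces that close up the ones of `innerArcs`. -/
def outerArcs (χ : ℕ → Bool) (u v z : List Passage) : ArcSystem (ℕ × ℕ) :=
  seg (0, 1) u (0, 2) ++ (seg (0, 3) v (0, 4) ++ (seg (0, 5) z (0, 0) ++
    smoothings χ (u ++ (v ++ z))))

theorem zero_mem_ends_seg {p q : ℕ × ℕ} {w : List Passage} {i : ℕ} :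
    (0, i) ∈ ends (seg p w q) ↔ p = (0, i) ∨ q = (0, i) := by
  rw [(ends_seg _ _ _).mem_iff]
  simp [zero_not_mem_ports, eq_comm]

/-- The closed curve is cut at the five fresh points `(0, 1), …, (0, 5)`; together with the base
point they bound the six pieces. -/
theorem loopWeights_inner_outer {T₁ u T₂ v T₃ z : List Passage}
    (hw : IsProper (T₁ ++ (u ++ (T₂ ++ (v ++ (T₃ ++ z)))))) (χ : ℕ → Bool) :
    IsClosed (innerArcs χ T₁ T₂ T₃ ++ outerArcs χ u v z) ∧
    (loopWeights (stateArcs χ (T₁ ++ (u ++ (T₂ ++ (v ++ (T₃ ++ z)))))) : Multiset ℕ) =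
      loopWeights (innerArcs χ T₁ T₂ T₃ ++ outerArcs χ u v z) := by
  set W := T₁ ++ (u ++ (T₂ ++ (v ++ (T₃ ++ z)))) with hW
  have hS : ∀ i, (0, i) ∉ ends (smoothings χ W) := fun i => by
    rw [(hw.ends_smoothings_perm χ).mem_iff]
    exact zero_not_mem_ports _ _
  -- The part still to be cut is kept at the front, ready for the next cut.
  have cut : ∀ (p m : ℕ) (a b : List Passage) (L : ArcSystem (ℕ × ℕ)),
      (0, m) ∉ ends (seg (0, p) (a ++ b) (0, 0) ++ L) →
      Simplifies (seg (0, p) (a ++ b) (0, 0) ++ L) []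
        (seg (0, m) b (0, 0) ++ (seg (0, p) a (0, m) ++ L)) := fun p m a b L hm hL => by
    obtain ⟨h1, h2⟩ := hL.cut hm
    have hp : (seg (0, p) a (0, m) ++ (seg (0, m) b (0, 0) ++ L)).Perm
        (seg (0, m) b (0, 0) ++ (seg (0, p) a (0, m) ++ L)) := by
      rw [← List.append_assoc, ← List.append_assoc]
      exact List.perm_append_comm.append_right L
    exact ⟨h1.perm hp, by rw [h2, loopWeights_perm h1 hp]; simp⟩
  have h1 := cut 0 1 T₁ (u ++ (T₂ ++ (v ++ (T₃ ++ z)))) (smoothings χ W) (by simp [zero_mem_ends_seg, hS])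
  have h2 := cut 1 2 u (T₂ ++ (v ++ (T₃ ++ z))) _
    (by simp [zero_mem_ends_seg, hS] : (0, 2) ∉ ends (seg (0, 1) (u ++ (T₂ ++ (v ++ (T₃ ++ z))))
      (0, 0) ++ (seg (0, 0) T₁ (0, 1) ++ smoothings χ W)))
  have h3 := cut 2 3 T₂ (v ++ (T₃ ++ z)) (seg (0, 1) u (0, 2) ++ (seg (0, 0) T₁ (0, 1) ++
    smoothings χ W)) (by simp [zero_mem_ends_seg, hS])
  have h4 := cut 3 4 v (T₃ ++ z) (seg (0, 2) T₂ (0, 3) ++ (seg (0, 1) u (0, 2) ++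
    (seg (0, 0) T₁ (0, 1) ++ smoothings χ W))) (by simp [zero_mem_ends_seg, hS])
  have h5 := cut 4 5 T₃ z (seg (0, 3) v (0, 4) ++ (seg (0, 2) T₂ (0, 3) ++ (seg (0, 1) u (0, 2) ++
    (seg (0, 0) T₁ (0, 1) ++ smoothings χ W)))) (by simp [zero_mem_ends_seg, hS])
  have hp : (seg (0, 5) z (0, 0) ++ (seg (0, 4) T₃ (0, 5) ++ (seg (0, 3) v (0, 4) ++
      (seg (0, 2) T₂ (0, 3) ++ (seg (0, 1) u (0, 2) ++ (seg (0, 0) T₁ (0, 1) ++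
        smoothings χ W)))))).Perm (innerArcs χ T₁ T₂ T₃ ++ outerArcs χ u v z) := by
    rw [← Multiset.coe_eq_coe]
    simp only [innerArcs, outerArcs, hW, smoothings_append, ← Multiset.coe_add]
    abel
  obtain ⟨hc, he⟩ := ((((h1.trans h2).trans h3).trans h4).trans h5).trans (.of_perm hp)
    (hw.isClosed_stateArcs χ)
  exact ⟨hc, by rw [stateArcs, he]; simp⟩

/-- The state `t` of three pieces of a closed curve, simplified: the weights of the closed loops,
and the arcs between the end points. -/
def innerState (T₁ T₂ T₃ : List Passage) (t : List ℕ) : List ℕ × ArcSystem (ℕ × ℕ) :=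
  contractAll (ports (T₁ ++ (T₂ ++ T₃))) (innerArcs (fun n => decide (n ∈ t)) T₁ T₂ T₃)

/-- The terms of a simplified state. -/
def innerStateTerms (e : ℤ) (r : List ℕ × ArcSystem (ℕ × ℕ)) :
    List ((List ℕ × ArcSystem (ℕ × ℕ)) × ℤ × ℤ) :=
  (loopFactorPow r.1.length).map fun t =>
    (((r.1.map (· / 2)).filter (· ≠ 0), sortArcs Prod.snd r.2), e + t.1, t.2)

/-- The terms of all states of three pieces of a closed curve with the classical crossings `X`. -/
def innerTerms (X : List ℕ) (T₁ T₂ T₃ : List Passage) :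
    List ((List ℕ × ArcSystem (ℕ × ℕ)) × ℤ × ℤ) :=
  X.sublists'.flatMap fun t =>
    innerStateTerms (2 * t.length - X.length) (innerState T₁ T₂ T₃ t)

/-- The value of an inner state with given arcs and additional loops. -/
noncomputable def outerValue (f : ℕ → ℕ) (χ : ℕ → Bool) (u v z : List Passage)
    (k : List ℕ × ArcSystem (ℕ × ℕ)) : ArrowRing :=
  (k.1.map K).prod * loopsValue (loopWeights (mapArcs (relabelPort f) k.2 ++ outerArcs χ u v z))

theorem prod_map_K_filter (l : List ℕ) : ((l.filter (· ≠ 0)).map K).prod = (l.map K).prod := by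
  induction l with
  | nil => rfl
  | cons n l ih =>
    by_cases h : n = 0
    · simp [h, K_zero, ← ih]
    · simp [h, ← ih]

theorem loopsValue_coe (l : List ℕ) :
    loopsValue l = loopFactor ^ l.length * ((l.map (· / 2)).map K).prod := by
  induction l with
  | nil => simp [loopsValue]
  | cons n l ih =>
    simp only [loopsValue, Multiset.map_coe, Multiset.prod_coe, List.map_cons, List.prod_cons,
      List.length_cons, pow_succ] at ih ⊢
    rw [ih]
    ring

theorem termsValue_flatMap {κ ι : Type*} (X : κ → ArrowRing) (l : List ι)
    (g : ι → List (κ × ℤ × ℤ)) :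
    termsValue X (l.flatMap g) = (l.map fun i => termsValue X (g i)).sum := by
  induction l with
  | nil => rfl
  | cons i l ih => rw [List.flatMap_cons, termsValue_append, ih, List.map_cons, List.sum_cons]

theorem classicalCrossings_relabel_pieces (T₁ u T₂ v T₃ z : List Passage) (f : ℕ → ℕ) :
    classicalCrossings (T₁.map (relabel f) ++ (u ++ (T₂.map (relabel f) ++ (v ++
      (T₃.map (relabel f) ++ z))))) = classicalCrossings (u ++ (v ++ z)) ∪
        (classicalCrossings (T₁ ++ (T₂ ++ T₃))).image f := by
  rw [← classicalCrossings_relabel]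
  simp only [classicalCrossings_append, List.map_append]
  ext n
  simp only [Finset.mem_union]
  tauto

/-- A state of the whole curve is a pair of an outer state `s` and an inner state `t`. Loops closed
up inside split off as factors `d * K n`; beyond these, the inner state enters only through its arcs
between the six end points. -/
theorem stateValue_union {X : List ℕ} {T₁ u T₂ v T₃ z : List Passage} {f : ℕ → ℕ}
    (hw : IsProper (T₁.map (relabel f) ++ (u ++ (T₂.map (relabel f) ++ (v ++
      (T₃.map (relabel f) ++ z)))))) (hX : X.Nodup)
    (hT : classicalCrossings (T₁ ++ (T₂ ++ T₃)) = X.toFinset)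
    (hv : ∀ x ∈ T₁ ++ (T₂ ++ T₃), x.level ≠ .virt)
    (hf : Set.InjOn f X.toFinset)
    (hd : Disjoint (classicalCrossings (u ++ (v ++ z))) (X.toFinset.image f))
    {s : Finset ℕ} (hs : s ⊆ classicalCrossings (u ++ (v ++ z))) {t : List ℕ} (ht : t.Sublist X) :
    stateValue (T₁.map (relabel f) ++ (u ++ (T₂.map (relabel f) ++ (v ++
        (T₃.map (relabel f) ++ z))))) (s ∪ t.toFinset.image f) =
      A (2 * s.card - (classicalCrossings (u ++ (v ++ z))).card) *
        termsValue (outerValue f (fun n => decide (n ∈ s)) u v z)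
          (innerStateTerms (2 * t.length - X.length) (innerState T₁ T₂ T₃ t)) := by
  have htX : ∀ n ∈ t, n ∈ X := fun n hn => ht.subset hn
  have hdisj : Disjoint s (t.toFinset.image f) :=
    hd.mono hs (Finset.image_subset_image fun n hn => by
      simpa using htX n (by simpa using hn))
  have hcard : (s ∪ t.toFinset.image f).card = s.card + t.length := by
    rw [Finset.card_union_of_disjoint hdisj, Finset.card_image_of_injOn,
      List.toFinset_card_of_nodup (hX.sublist ht)]
    exact hf.mono fun n hn => by simpa using htX n (by simpa using hn)
  have hcardX : (classicalCrossings (u ++ (v ++ z)) ∪ X.toFinset.image f).card =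
      (classicalCrossings (u ++ (v ++ z))).card + X.length := by
    rw [Finset.card_union_of_disjoint hd, Finset.card_image_of_injOn hf,
      List.toFinset_card_of_nodup hX]
  set χ : ℕ → Bool := fun n => decide (n ∈ s ∪ t.toFinset.image f) with hχ
  have hinn : innerArcs χ (T₁.map (relabel f)) (T₂.map (relabel f)) (T₃.map (relabel f)) =
      mapArcs (relabelPort f) (innerArcs (fun n => decide (n ∈ t)) T₁ T₂ T₃) := by
    have h1 : ∀ x ∈ T₁ ++ (T₂ ++ T₃), χ (f x.crossing) = decide (x.crossing ∈ t) := by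
      intro x hx
      have hxX : x.crossing ∈ X.toFinset := by
        rw [← hT, mem_classicalCrossings]
        exact ⟨x, hx, hv x hx, rfl⟩
      have h2 : f x.crossing ∉ s := fun h' =>
        Finset.disjoint_left.1 hd (hs h') (Finset.mem_image_of_mem f hxX)
      simp only [hχ, Finset.mem_union, h2, false_or, decide_eq_decide, Finset.mem_image,
        List.mem_toFinset]
      constructor
      · rintro ⟨n, hn, hnx⟩
        rwa [← hf (by simpa using htX n hn) hxX hnx]
      · exact fun h => ⟨_, h, rfl⟩
    have h3 := smoothings_relabel f (χ := χ) (χ' := fun n => decide (n ∈ t)) h1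
    simp only [List.map_append] at h3
    rw [innerArcs, innerArcs, h3]
    simp only [mapArcs_append, ← seg_relabel]
    rfl
  have hout : outerArcs χ u v z = outerArcs (fun n => decide (n ∈ s)) u v z := by
    rw [outerArcs, outerArcs, smoothings_congr]
    intro x hx hl
    have h2 : x.crossing ∉ t.toFinset.image f := fun h' =>
      Finset.disjoint_left.1 hd (mem_classicalCrossings.2 ⟨x, hx, hl, rfl⟩)
        (Finset.image_subset_image (fun n hn => by
          simpa using htX n (by simpa using hn)) h')
    simp only [hχ, Finset.mem_union, h2, or_false]
  obtain ⟨hc, he⟩ := loopWeights_inner_outer hw χ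
  rw [stateValue, classicalCrossings_relabel_pieces, hT, hcard, hcardX, he]
  rw [hinn, hout] at hc ⊢
  obtain ⟨-, he'⟩ := (Simplifies.contractAll (ports (T₁ ++ (T₂ ++ T₃)))
    (innerArcs (fun n => decide (n ∈ t)) T₁ T₂ T₃) (relabelPort f) _).trans
    (Simplifies.sortArcs Prod.snd _ (relabelPort f) _) hc
  rw [← innerState] at he'
  rw [innerStateTerms, termsValue_loopFactorPow, outerValue, prod_map_K_filter, he', List.append_nil,
    loopsValue_add, loopsValue_coe]
  have hexp : (2 * (s.card + t.length : ℕ) - ((classicalCrossings (u ++ (v ++ z))).card +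
      X.length : ℕ) : ℤ) = (2 * s.card - (classicalCrossings (u ++ (v ++ z))).card) +
        (2 * t.length - X.length) := by push_cast; ring
  rw [hexp, ← A_mul]
  ring

theorem stateSum_eq_innerTerms {X : List ℕ} {T₁ u T₂ v T₃ z : List Passage} {f : ℕ → ℕ}
    (hw : IsProper (T₁.map (relabel f) ++ (u ++ (T₂.map (relabel f) ++ (v ++
      (T₃.map (relabel f) ++ z)))))) (hX : X.Nodup)
    (hT : classicalCrossings (T₁ ++ (T₂ ++ T₃)) = X.toFinset)
    (hv : ∀ x ∈ T₁ ++ (T₂ ++ T₃), x.level ≠ .virt)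
    (hf : Set.InjOn f X.toFinset)
    (hd : Disjoint (classicalCrossings (u ++ (v ++ z))) (X.toFinset.image f)) :
    stateSum (T₁.map (relabel f) ++ (u ++ (T₂.map (relabel f) ++ (v ++
      (T₃.map (relabel f) ++ z))))) =
    ∑ s ∈ (classicalCrossings (u ++ (v ++ z))).powerset,
      A (2 * s.card - (classicalCrossings (u ++ (v ++ z))).card) *
        termsValue (outerValue f (fun n => decide (n ∈ s)) u v z) (innerTerms X T₁ T₂ T₃) := by
  rw [stateSum, classicalCrossings_relabel_pieces, hT, sum_powerset_union hd]
  refine Finset.sum_congr rfl fun s hs => ?_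
  rw [sum_powerset_image hf, sum_powerset_toFinset hX, innerTerms, termsValue_flatMap,
    ← List.sum_map_mul_left]
  exact congrArg List.sum (List.map_congr_left fun t ht => stateValue_union hw hX hT hv hf hd
    (Finset.mem_powerset.1 hs) (List.mem_sublists'.1 ht))

/-- For a fixed outer state the sum over inner states is a valuation of formal inner terms, so their
formal agreement gives the same factor `c A ^ e` for every outer state. -/
theorem stateSum_local_change {X X' : List ℕ} {T₁ T₁' u T₂ T₂' v T₃ T₃' z : List Passage}
    {f : ℕ → ℕ} {e c : ℤ}
    (hw : IsProper (T₁.map (relabel f) ++ (u ++ (T₂.map (relabel f) ++ (v ++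
      (T₃.map (relabel f) ++ z))))))
    (hw' : IsProper (T₁'.map (relabel f) ++ (u ++ (T₂'.map (relabel f) ++ (v ++
      (T₃'.map (relabel f) ++ z))))))
    (hX : X.Nodup) (hX' : X'.Sublist X)
    (hT : classicalCrossings (T₁ ++ (T₂ ++ T₃)) = X.toFinset)
    (hT' : classicalCrossings (T₁' ++ (T₂' ++ T₃')) = X'.toFinset)
    (hv : ∀ x ∈ T₁ ++ (T₂ ++ T₃), x.level ≠ .virt)
    (hv' : ∀ x ∈ T₁' ++ (T₂' ++ T₃'), x.level ≠ .virt)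
    (hf : Set.InjOn f X.toFinset)
    (hd : Disjoint (classicalCrossings (u ++ (v ++ z))) (X.toFinset.image f))
    (h : termsAgree e c (innerTerms X T₁ T₂ T₃) (innerTerms X' T₁' T₂' T₃') = true) :
    stateSum (T₁.map (relabel f) ++ (u ++ (T₂.map (relabel f) ++ (v ++
      (T₃.map (relabel f) ++ z))))) =
    c • (A e * stateSum (T₁'.map (relabel f) ++ (u ++ (T₂'.map (relabel f) ++ (v ++
      (T₃'.map (relabel f) ++ z)))))) := by
  have hs : X'.toFinset ⊆ X.toFinset := fun n hn => by simpa using hX'.subset (by simpa using hn)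
  rw [stateSum_eq_innerTerms hw hX hT hv hf hd, stateSum_eq_innerTerms hw' (hX.sublist hX') hT' hv'
    (hf.mono (Finset.coe_subset.2 hs)) (hd.mono_right (Finset.image_subset_image hs)), Finset.mul_sum,
    Finset.smul_sum]
  refine Finset.sum_congr rfl fun s _ => ?_
  rw [termsValue_eq_of_termsAgree h, mul_smul_comm, mul_left_comm]

end VirtualKnot

namespace VirtualKnot

/-! ### Invariance under the Reidemeister moves -/

/-- Two triples of pieces of words have the classical crossings `X` and `X'`, and no others, and
the same states up to the factor `c A ^ e`. -/
def LocallyAgree (e c : ℤ) (X : List ℕ) (T₁ T₂ T₃ : List Passage) (X' : List ℕ)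
    (T₁' T₂' T₃' : List Passage) : Prop :=
  (classicalCrossings (T₁ ++ (T₂ ++ T₃)) = X.toFinset ∧
    classicalCrossings (T₁' ++ (T₂' ++ T₃')) = X'.toFinset) ∧
  ((∀ x ∈ T₁ ++ (T₂ ++ T₃), x.level ≠ .virt) ∧ ∀ x ∈ T₁' ++ (T₂' ++ T₃'), x.level ≠ .virt) ∧
  termsAgree e c (innerTerms X T₁ T₂ T₃) (innerTerms X' T₁' T₂' T₃') = true

instance (e c : ℤ) (X : List ℕ) (T₁ T₂ T₃ : List Passage) (X' : List ℕ)
    (T₁' T₂' T₃' : List Passage) : Decidable (LocallyAgree e c X T₁ T₂ T₃ X' T₁' T₂' T₃') :=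
  inferInstanceAs (Decidable (_ ∧ _))

/-- The state sums of the two words agree up to a unit. -/
def UnitRelated (w w' : List Passage) : Prop :=
  ∃ (e : ℤ) (c : ℤˣ), stateSum w = (c : ℤ) • (A e * stateSum w')

theorem UnitRelated.of_eq {w w' : List Passage} (h : stateSum w = stateSum w') :
    UnitRelated w w' := ⟨0, 1, by simp [A_zero, h]⟩

theorem UnitRelated.of_gaussCode {w w' : List Passage} (hw : IsGaussWord w) (hw' : IsGaussWord w')
    (h : gaussCode w = gaussCode w') : UnitRelated w w' :=
  .of_eq (by rw [← stateSum_gaussCode hw.isProper, h, stateSum_gaussCode hw'.isProper])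

theorem UnitRelated.of_locallyAgree {e : ℤ} {c : ℤˣ} {X : List ℕ} {T₁ T₂ T₃ : List Passage}
    {X' : List ℕ} {T₁' T₂' T₃' : List Passage} {w w' u v z : List Passage} {f : ℕ → ℕ}
    (h : LocallyAgree e c X T₁ T₂ T₃ X' T₁' T₂' T₃') (hw : IsGaussWord w) (hw' : IsGaussWord w')
    (he : w = T₁.map (relabel f) ++ (u ++ (T₂.map (relabel f) ++ (v ++ (T₃.map (relabel f) ++ z)))))
    (he' : w' =
      T₁'.map (relabel f) ++ (u ++ (T₂'.map (relabel f) ++ (v ++ (T₃'.map (relabel f) ++ z)))))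
    (hX : X.Nodup) (hX' : X'.Sublist X) (hf : ∀ i ∈ X, ∀ j ∈ X, f i = f j → i = j)
    (hd : ∀ i ∈ X, ∀ x ∈ u ++ (v ++ z), x.crossing ≠ f i) : UnitRelated w w' := by
  subst he he'
  refine ⟨e, c, stateSum_local_change hw.isProper hw'.isProper hX hX' h.1.1 h.1.2 h.2.1.1 h.2.1.2
    (fun i hi j hj => hf i (by simpa using hi) j (by simpa using hj)) ?_ h.2.2⟩
  refine Finset.disjoint_left.2 fun n hn hn' => ?_
  obtain ⟨x, hx, -, rfl⟩ := mem_classicalCrossings.1 hn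
  obtain ⟨i, hi, hix⟩ := Finset.mem_image.1 hn'
  exact hd i (by simpa using hi) x hx hix.symm

theorem crossing_ne_of_perm {w : List Passage} (hw : IsGaussWord w) {x : Passage}
    {l : List Passage} (h : w.Perm (x :: x.opp :: l)) {y : Passage} (hy : y ∈ l) :
    y.crossing ≠ x.crossing := by
  intro hyx
  have h1 := (hw x (h.mem_iff.2 (by simp))).2
  rw [h.countP_eq] at h1
  simp only [List.countP_cons, Passage.opp_crossing, beq_self_eq_true, if_true] at h1
  have h2 : 0 < l.countP fun z => z.crossing == x.crossing :=
    List.countP_pos_iff.2 ⟨y, hy, by simpa using hyx⟩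
  omega

/-- One smoothing of the kink splits off a loop and the other does not: the factor is `A ^ (±1) * d
+ A ^ (∓1) = -A ^ (±3)`, with the sign of the crossing in the exponent. -/
theorem locallyAgree_one : ∀ l ∈ [Level.over, Level.under], ∀ t : Bool,
    ∃ e ∈ [(-3 : ℤ), 3], LocallyAgree e ((-1 : ℤˣ) : ℤ) [0] [⟨0, l, t⟩, ⟨0, l.swap, !t⟩] [] []
      [] [] [] [] := by
  decide +kernel

/-- The crossings have opposite signs. One of the four states is the pair of separated strands with
coefficient 1; the other three have the same connections and cancel because `A ^ 2 + A ^ (-2) + d =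
0`. The antiparallel case is similar. -/
theorem locallyAgree_two_parallel : ∀ l ∈ [Level.over, Level.under], ∀ t : Bool,
    LocallyAgree 0 ((1 : ℤˣ) : ℤ) [0, 1] [⟨0, l, t⟩, ⟨1, l, !t⟩] [⟨0, l.swap, !t⟩, ⟨1, l.swap, t⟩] []
      [] [] [] [] := by
  decide +kernel

theorem locallyAgree_two_antiparallel : ∀ l ∈ [Level.over, Level.under], ∀ t : Bool,
    LocallyAgree 0 ((1 : ℤˣ) : ℤ) [0, 1] [⟨0, l, t⟩, ⟨1, l, !t⟩] [⟨1, l.swap, t⟩, ⟨0, l.swap, !t⟩] []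
      [] [] [] [] := by
  decide +kernel

/-- Eight states on each side, compared for all directions, both positions of the triangle and all
admissible levels. Three equal levels would put each strand over the next in a cycle, which is not a
third move. -/
theorem locallyAgree_three : ∀ l₁ ∈ [Level.over, Level.under], ∀ l₂ ∈ [Level.over, Level.under],
    ∀ l₃ ∈ [Level.over, Level.under], ∀ e₁ e₂ e₃ t : Bool, ¬ (l₁ = l₂ ∧ l₂ = l₃) →
    LocallyAgree 0 ((1 : ℤˣ) : ℤ) [0, 1, 2]
      (side e₁ ⟨2, l₃.swap, xor t (e₃ == e₁)⟩ ⟨0, l₁, !(xor t (e₁ == e₂))⟩)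
      (side e₂ ⟨0, l₁.swap, xor t (e₁ == e₂)⟩ ⟨1, l₂, !(xor t (e₂ == e₃))⟩)
      (side e₃ ⟨1, l₂.swap, xor t (e₂ == e₃)⟩ ⟨2, l₃, !(xor t (e₃ == e₁))⟩) [0, 1, 2]
      (side (!e₁) ⟨2, l₃.swap, xor t (e₃ == e₁)⟩ ⟨0, l₁, !(xor t (e₁ == e₂))⟩)
      (side (!e₂) ⟨0, l₁.swap, xor t (e₁ == e₂)⟩ ⟨1, l₂, !(xor t (e₂ == e₃))⟩)
      (side (!e₃) ⟨1, l₂.swap, xor t (e₂ == e₃)⟩ ⟨2, l₃, !(xor t (e₃ == e₁))⟩) := by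
  decide +kernel

end VirtualKnot

namespace VirtualKnot

theorem mem_classical_levels {l : Level} (h : l ≠ .virt) : l ∈ [Level.over, Level.under] := by
  cases l <;> simp_all

theorem unitRelated_one {x : Passage} {w : List Passage} (hw : IsGaussWord (x :: x.opp :: w))
    (hw' : IsGaussWord w) : UnitRelated (x :: x.opp :: w) w := by
  by_cases hl : x.level = .virt
  · exact .of_gaussCode hw hw' (by simp [gaussCode, hl])
  obtain ⟨e, -, h⟩ := locallyAgree_one x.level (mem_classical_levels hl) x.toLeft
  refine .of_locallyAgree (u := w) (v := []) (z := []) (f := fun _ => x.crossing) h hw hw'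
    (by simp [relabel, Passage.opp]) (by simp) (by simp) (by simp) (by simp) ?_
  simpa using fun y hy => crossing_ne_of_perm hw (.refl _) hy

theorem unitRelated_two_parallel {x y : Passage} {u v : List Passage}
    (hl : x.level = y.level) (ht : x.toLeft ≠ y.toLeft)
    (hw : IsGaussWord (x :: y :: u ++ x.opp :: y.opp :: v)) (hw' : IsGaussWord (u ++ v)) :
    UnitRelated (x :: y :: u ++ x.opp :: y.opp :: v) (u ++ v) := by
  by_cases hv : x.level = .virt
  · exact .of_gaussCode hw hw' (by simp [gaussCode, hv, ← hl])
  have h := locallyAgree_two_parallel x.level (mem_classical_levels hv) x.toLeft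
  have ht' : y.toLeft = !x.toLeft := by simpa using (Bool.eq_not_of_ne ht.symm)
  have hx : ∀ z ∈ y :: y.opp :: (u ++ v), z.crossing ≠ x.crossing := fun z hz =>
    crossing_ne_of_perm hw (List.perm_iff_count.2 fun z => by
      simp only [List.count_cons, List.count_append]; ring) hz
  have hy : ∀ z ∈ x :: x.opp :: (u ++ v), z.crossing ≠ y.crossing := fun z hz =>
    crossing_ne_of_perm hw (List.perm_iff_count.2 fun z => by
      simp only [List.count_cons, List.count_append]; ring) hz
  have hxy := hy x (by simp)
  refine .of_locallyAgree (u := u) (v := v) (z := [])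
    (f := fun n => if n = 0 then x.crossing else y.crossing) h hw hw'
    (by simp [relabel, Passage.opp, hl, ht']; exact ⟨by rw [← hl], by rw [← ht']⟩) (by simp) (by simp) (by simp)
    (by simp [hxy, hxy.symm]) ?_
  simp only [List.mem_cons, List.not_mem_nil, or_false, forall_eq_or_imp, forall_eq, if_true,
    List.append_nil]
  exact ⟨fun z hz => hx z (by simp_all), fun z hz => by simpa using hy z (by simp_all)⟩

theorem unitRelated_two_antiparallel {x y : Passage} {u v : List Passage}
    (hl : x.level = y.level) (ht : x.toLeft ≠ y.toLeft)
    (hw : IsGaussWord (x :: y :: u ++ y.opp :: x.opp :: v)) (hw' : IsGaussWord (u ++ v)) :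
    UnitRelated (x :: y :: u ++ y.opp :: x.opp :: v) (u ++ v) := by
  by_cases hv : x.level = .virt
  · exact .of_gaussCode hw hw' (by simp [gaussCode, hv, ← hl])
  have h := locallyAgree_two_antiparallel x.level (mem_classical_levels hv) x.toLeft
  have ht' : y.toLeft = !x.toLeft := by simpa using (Bool.eq_not_of_ne ht.symm)
  have hx : ∀ z ∈ y :: y.opp :: (u ++ v), z.crossing ≠ x.crossing := fun z hz =>
    crossing_ne_of_perm hw (List.perm_iff_count.2 fun z => by
      simp only [List.count_cons, List.count_append]; ring) hz
  have hy : ∀ z ∈ x :: x.opp :: (u ++ v), z.crossing ≠ y.crossing := fun z hz =>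
    crossing_ne_of_perm hw (List.perm_iff_count.2 fun z => by
      simp only [List.count_cons, List.count_append]; ring) hz
  have hxy := hy x (by simp)
  refine .of_locallyAgree (u := u) (v := v) (z := [])
    (f := fun n => if n = 0 then x.crossing else y.crossing) h hw hw'
    (by simp [relabel, Passage.opp, hl, ht']; exact ⟨by rw [← hl], by rw [← ht']⟩) (by simp) (by simp) (by simp)
    (by simp [hxy, hxy.symm]) ?_
  simp only [List.mem_cons, List.not_mem_nil, or_false, forall_eq_or_imp, forall_eq, if_true,
    List.append_nil]
  exact ⟨fun z hz => hx z (by simp_all), fun z hz => by simpa using hy z (by simp_all)⟩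

theorem side_map (e : Bool) (f : Passage → Passage) (x y : Passage) :
    side e (f x) (f y) = (side e x y).map f := by
  cases e <;> rfl

theorem count_side (e : Bool) (x y z : Passage) :
    (side e x y).count z = [x].count z + [y].count z := by
  cases e <;> simp [side, List.count_cons, add_comm]

theorem gaussCode_side (e : Bool) (x y : Passage) (h : x.level = .virt ∨ y.level = .virt) :
    gaussCode (side (!e) x y) = gaussCode (side e x y) := by
  rcases h with h | h <;> cases e <;> simp [gaussCode, side, h, List.filter_cons]

theorem gaussCode_append (u v : List Passage) : gaussCode (u ++ v) = gaussCode u ++ gaussCode v := by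
  simp [gaussCode]

/-- With two virtual crossings every side of the triangle contains a visit to a virtual one, so
exchanging its two letters does not change the Gauss code. Only the purely classical case needs the
local computation. -/
theorem unitRelated_three {a b c : Passage} {e₁ e₂ e₃ t : Bool} {u v w : List Passage}
    (hl : TriangleLevels c.level a.level b.level)
    (hc : c.opp.toLeft = xor t (e₁ == e₂)) (ha : a.opp.toLeft = xor t (e₂ == e₃))
    (hb : b.opp.toLeft = xor t (e₃ == e₁))
    (hw : IsGaussWord (side e₁ b.opp c ++ u ++ side e₂ c.opp a ++ v ++ side e₃ a.opp b ++ w))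
    (hw' : IsGaussWord (side (!e₁) b.opp c ++ u ++ side (!e₂) c.opp a ++ v ++
      side (!e₃) a.opp b ++ w)) :
    UnitRelated (side e₁ b.opp c ++ u ++ side e₂ c.opp a ++ v ++ side e₃ a.opp b ++ w)
      (side (!e₁) b.opp c ++ u ++ side (!e₂) c.opp a ++ v ++ side (!e₃) a.opp b ++ w) := by
  have hvirt : (b.level = .virt ∨ c.level = .virt) ∧ (c.level = .virt ∨ a.level = .virt) ∧
      (a.level = .virt ∨ b.level = .virt) → UnitRelated
      (side e₁ b.opp c ++ u ++ side e₂ c.opp a ++ v ++ side e₃ a.opp b ++ w)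
      (side (!e₁) b.opp c ++ u ++ side (!e₂) c.opp a ++ v ++ side (!e₃) a.opp b ++ w) :=
    fun h => .of_gaussCode hw hw' (by
      simp only [gaussCode_append]
      rw [gaussCode_side e₁ _ _ (by simpa using h.1), gaussCode_side e₂ _ _ (by simpa using h.2.1),
        gaussCode_side e₃ _ _ (by simpa using h.2.2)])
  rcases hl with ⟨h1, h2, h3, h4⟩ | h | h | h
  · have h := locallyAgree_three c.level (mem_classical_levels h1) a.level (mem_classical_levels h2)
      b.level (mem_classical_levels h3) e₁ e₂ e₃ t h4
    have hcp : ∀ z ∈ a :: a.opp :: b :: b.opp :: (u ++ (v ++ w)), z.crossing ≠ c.crossing :=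
      fun z hz => crossing_ne_of_perm hw (List.perm_iff_count.2 fun z => by
        simp only [List.count_cons, List.count_append, count_side, List.count_nil]; ring) hz
    have hap : ∀ z ∈ b :: b.opp :: c :: c.opp :: (u ++ (v ++ w)), z.crossing ≠ a.crossing :=
      fun z hz => crossing_ne_of_perm hw (List.perm_iff_count.2 fun z => by
        simp only [List.count_cons, List.count_append, count_side, List.count_nil]; ring) hz
    have hbp : ∀ z ∈ c :: c.opp :: a :: a.opp :: (u ++ (v ++ w)), z.crossing ≠ b.crossing :=
      fun z hz => crossing_ne_of_perm hw (List.perm_iff_count.2 fun z => by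
        simp only [List.count_cons, List.count_append, count_side, List.count_nil]; ring) hz
    set f : ℕ → ℕ := fun n => if n = 0 then c.crossing else if n = 1 then a.crossing else b.crossing
      with hf
    have hc' : c = relabel f ⟨0, c.level, !(xor t (e₁ == e₂))⟩ := by
      rw [← hc]; simp [relabel, hf]
    have ha' : a = relabel f ⟨1, a.level, !(xor t (e₂ == e₃))⟩ := by
      rw [← ha]; simp [relabel, hf]
    have hb' : b = relabel f ⟨2, b.level, !(xor t (e₃ == e₁))⟩ := by
      rw [← hb]; simp [relabel, hf]
    have hco : c.opp = relabel f ⟨0, c.level.swap, xor t (e₁ == e₂)⟩ := by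
      rw [← hc]; simp [relabel, hf, Passage.opp]
    have hao : a.opp = relabel f ⟨1, a.level.swap, xor t (e₂ == e₃)⟩ := by
      rw [← ha]; simp [relabel, hf, Passage.opp]
    have hbo : b.opp = relabel f ⟨2, b.level.swap, xor t (e₃ == e₁)⟩ := by
      rw [← hb]; simp [relabel, hf, Passage.opp]
    have hmap : ∀ g₁ g₂ g₃ : Bool,
        side g₁ b.opp c ++ u ++ side g₂ c.opp a ++ v ++ side g₃ a.opp b ++ w =
        (side g₁ ⟨2, b.level.swap, xor t (e₃ == e₁)⟩ ⟨0, c.level, !(xor t (e₁ == e₂))⟩).map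
          (relabel f) ++ (u ++
        ((side g₂ ⟨0, c.level.swap, xor t (e₁ == e₂)⟩ ⟨1, a.level, !(xor t (e₂ == e₃))⟩).map
          (relabel f) ++ (v ++
        ((side g₃ ⟨1, a.level.swap, xor t (e₂ == e₃)⟩ ⟨2, b.level, !(xor t (e₃ == e₁))⟩).map
          (relabel f) ++ w)))) := by
      intro g₁ g₂ g₃
      rw [← side_map, ← side_map, ← side_map, ← hc', ← ha', ← hb', ← hco, ← hao, ← hbo]
      simp only [List.append_assoc]
    have hca := hcp a (by simp)
    have hcb := hcp b (by simp)
    have hab := hap b (by simp)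
    refine .of_locallyAgree h hw hw' (hmap _ _ _) (hmap _ _ _) (by simp) (List.Sublist.refl _) ?_ ?_
    · simp [hf, hca, hcb, hab, hca.symm, hcb.symm, hab.symm]
    · simp only [List.mem_cons, List.not_mem_nil, or_false, forall_eq_or_imp, forall_eq, hf, if_true,
        one_ne_zero, if_false, OfNat.ofNat_ne_zero, OfNat.ofNat_ne_one]
      exact ⟨fun z hz => hcp z (by simp only [List.mem_cons, hz, or_true]), fun z hz => hap z (by simp only [List.mem_cons, hz, or_true]),
        fun z hz => hbp z (by simp only [List.mem_cons, hz, or_true])⟩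
  · exact hvirt ⟨.inr h.1, .inl h.1, .inl h.2⟩
  · exact hvirt ⟨.inl h.2, .inr h.1, .inl h.1⟩
  · exact hvirt ⟨.inl h.1, .inl h.2, .inr h.1⟩

/-- The classical first move is the only one that can change the sum. Its factor is a unit, so the
writhe need not be followed along a chain of moves. -/
theorem Move.unitRelated {w w' : List Passage} (h : Move w w') (hw : IsGaussWord w)
    (hw' : IsGaussWord w') : UnitRelated w w' := by
  cases h with
  | rotate u v => exact .of_eq (stateSum_rotate hw.isProper)
  | relabel f hf w => exact .of_eq (stateSum_relabel hf w).symm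
  | one x w => exact unitRelated_one hw hw'
  | two_parallel x y u v hl ht => exact unitRelated_two_parallel hl ht hw hw'
  | two_antiparallel x y u v hl ht => exact unitRelated_two_antiparallel hl ht hw hw'
  | three a b c e₁ e₂ e₃ t u v w hl hc ha hb => exact unitRelated_three hl hc ha hb hw hw'

theorem UnitRelated.symm {w w' : List Passage} (h : UnitRelated w w') : UnitRelated w' w := by
  obtain ⟨e, c, h⟩ := h
  refine ⟨-e, c⁻¹, ?_⟩
  rw [h, mul_smul_comm, smul_smul, ← mul_assoc, A_mul]
  simp [A_zero]

theorem UnitRelated.trans {w w' w'' : List Passage} (h : UnitRelated w w')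
    (h' : UnitRelated w' w'') : UnitRelated w w'' := by
  obtain ⟨e, c, h⟩ := h
  obtain ⟨e', c', h'⟩ := h'
  refine ⟨e + e', c * c', ?_⟩
  rw [h, h', mul_smul_comm, smul_smul, ← mul_assoc, A_mul]
  simp

theorem Diagram.Equivalent.unitRelated {D D' : Diagram} (h : D.Equivalent D') :
    UnitRelated D.word D'.word := by
  induction h with
  | rel D D' h => exact h.unitRelated D.isGaussWord D'.isGaussWord
  | refl D => exact .of_eq rfl
  | symm D D' _ ih => exact ih.symm
  | trans D D' D'' _ _ ih ih' => exact ih.trans ih'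

theorem Diagram.Equivalent.arrowPolynomial {D D' : Diagram} (h : D.Equivalent D') :
    ∃ (e : ℤ) (c : ℤˣ), arrowPolynomial D.word = (c : ℤ) • (A e * arrowPolynomial D'.word) := by
  obtain ⟨e, c, h⟩ := h.unitRelated
  refine ⟨e, c, mul_left_cancel₀ loopFactor_ne_zero ?_⟩
  rw [loopFactor_mul_arrowPolynomial D.isGaussWord, h,
    ← loopFactor_mul_arrowPolynomial D'.isGaussWord, mul_smul_comm, mul_left_comm]

end VirtualKnot

namespace VirtualKnot

/-! ### The Alexander numbering of a planar diagram -/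

theorem leave_injective {w : List Passage} {q q' : Fin w.length} {d d' : Bool}
    (h : leave w q d = leave w q' d') : q = q' ∧ d = d' := by
  cases d <;> cases d' <;> simp_all [leave, -finRotate_apply, -finRotate_symm_apply]

theorem turnLeft_injective {w : List Passage} (hw : IsGaussWord w) :
    (turnLeft w).Injective := by
  rintro ⟨p, d⟩ ⟨p', d'⟩ h
  obtain ⟨h1, h2⟩ := leave_injective h
  have hp : p = p' := by
    have := congrArg (partner w) h1
    rwa [partner_partner hw, partner_partner hw] at this
  subst hp
  simpa using h2

/-- The difference between the values of a function of the faces to the left and to the right of an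
edge. -/
noncomputable def faceDiff (w : List Passage) (f : Dart w → ℚ) (p : Fin w.length) : ℚ :=
  f (finRotate w.length p, true) - f (p, false)

section
variable {w : List Passage} (hw : IsGaussWord w) {f : Dart w → ℚ}
  (hf : ∀ x, f (turnLeft w x) = f x)
include hw hf

/-- A left turn stays in the same face. The four equations say that at each corner of the crossing
the two adjacent edges see the same face. -/
theorem corners {p : Fin w.length} (hp : (w.get p).toLeft = true) :
    f (partner w p, true) = f (finRotate w.length p, true) ∧
    f ((finRotate w.length).symm (partner w p), false) = f (p, true) ∧
    f (finRotate w.length (partner w p), true) = f (p, false) ∧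
    f ((finRotate w.length).symm p, false) = f (partner w p, false) := by
  have hq : (w.get (partner w p)).toLeft = false := by
    rw [get_partner hw, Passage.opp_toLeft, hp]; rfl
  have h1 := hf (p, true)
  have h2 := hf (p, false)
  have h3 := hf (partner w p, true)
  have h4 := hf (partner w p, false)
  simp only [turnLeft, hp, hq, partner_partner hw, leave] at h1 h2 h3 h4
  exact ⟨h3.symm, h1, h2, h4⟩

/-- The four face values around a crossing telescope, so the jumps on the two strands are opposite.
One jump per crossing therefore determines both. -/
theorem faceDiff_partner (p : Fin w.length) :
    faceDiff w f p - faceDiff w f ((finRotate w.length).symm p) +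
      (faceDiff w f (partner w p) - faceDiff w f ((finRotate w.length).symm (partner w p))) = 0 := by
  have key : ∀ p : Fin w.length, (w.get p).toLeft = true →
      faceDiff w f p - faceDiff w f ((finRotate w.length).symm p) +
      (faceDiff w f (partner w p) - faceDiff w f ((finRotate w.length).symm (partner w p))) = 0 := by
    intro p hp
    obtain ⟨h1, h2, h3, h4⟩ := corners hw hf hp
    simp only [faceDiff, Equiv.apply_symm_apply]
    rw [h1, h2, h3, h4]
    ring
  cases hp : (w.get p).toLeft
  · have := key (partner w p) (by rw [get_partner hw, Passage.opp_toLeft, hp]; rfl)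
    rw [partner_partner hw] at this
    linarith
  · exact key p hp

end

theorem eq_of_finRotate_invariant {S : Type*} {n : ℕ} {c : Fin n → S}
    (h : ∀ p, c (finRotate n p) = c p) (p q : Fin n) : c p = c q := by
  cases n with
  | zero => exact p.elim0
  | succ m =>
    have h0 : ∀ p : Fin (m + 1), c p = c 0 := by
      intro p
      induction p using Fin.induction with
      | zero => rfl
      | succ i ih =>
        rw [← ih, ← h i.castSucc, finRotate_apply]
        simp
    rw [h0 p, h0 q]

/-- A function with equal values on both sides of every edge does not change at a crossing either,
hence is constant along the knot, which passes every edge. -/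
theorem constant_of_faceDiff_eq_zero {w : List Passage} (hw : IsGaussWord w) {f : Dart w → ℚ}
    (hf : ∀ x, f (turnLeft w x) = f x) (h : ∀ p, faceDiff w f p = 0) (x y : Dart w) : f x = f y := by
  have hlr : ∀ p, f (finRotate w.length p, true) = f (p, false) := fun p => sub_eq_zero.1 (h p)
  have hlr' : ∀ p, f ((finRotate w.length).symm p, false) = f (p, true) := fun p => by
    rw [← hlr, Equiv.apply_symm_apply]
  have key : ∀ p : Fin w.length, (w.get p).toLeft = true →
      f (p, true) = f (p, false) ∧ f (partner w p, true) = f (partner w p, false) := by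
    intro p hp
    obtain ⟨h1, h2, h3, h4⟩ := corners hw hf hp
    rw [hlr] at h1 h3
    rw [hlr'] at h2 h4
    exact ⟨by rw [← h2, h1], by rw [h3, h1]⟩
  have hd : ∀ p, f (p, true) = f (p, false) := by
    intro p
    cases hp : (w.get p).toLeft
    · have := (key (partner w p) (by rw [get_partner hw, Passage.opp_toLeft, hp]; rfl)).2
      rwa [partner_partner hw] at this
    · exact (key p hp).1
  have hc := eq_of_finRotate_invariant (c := fun p => f (p, false)) fun p => by
    rw [← hd, hlr]
  have : ∀ x : Dart w, f x = f (x.1, false) := by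
    rintro ⟨p, _ | _⟩
    exacts [rfl, hd p]
  rw [this x, this y, hc x.1 y.1]

/-- The values of a function of the faces, at a dart. -/
def faceFun (w : List Passage) (ψ : faces w → ℚ) (x : Dart w) : ℚ :=
  ψ ⟨orbit w (turnLeft w) x, Finset.mem_image_of_mem _ (Finset.mem_univ x)⟩

theorem faceFun_turnLeft {w : List Passage} (hw : IsGaussWord w) (ψ : faces w → ℚ) (x : Dart w) :
    faceFun w ψ (turnLeft w x) = faceFun w ψ x := by
  simp only [faceFun, orbit_apply (turnLeft_injective hw)]

/-- The difference at one edge and the jumps of the differences at the crossings. -/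
noncomputable def faceMap (w : List Passage) (p₀ : Fin w.length) :
    (faces w → ℚ) →ₗ[ℚ] ℚ × ({p : Fin w.length // (w.get p).toLeft = true} → ℚ) where
  toFun ψ := (faceDiff w (faceFun w ψ) p₀, fun p => faceDiff w (faceFun w ψ) p -
    faceDiff w (faceFun w ψ) ((finRotate w.length).symm p))
  map_add' ψ ψ' := by
    refine Prod.ext ?_ (funext fun p => ?_) <;> simp [faceDiff, faceFun] <;> ring
  map_smul' c ψ := by
    refine Prod.ext ?_ (funext fun p => ?_) <;> simp [faceDiff, faceFun] <;> ring

theorem card_toLeft {w : List Passage} (hw : IsGaussWord w) :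
    2 * Fintype.card {p : Fin w.length // (w.get p).toLeft = true} = w.length := by
  have h : Fintype.card {p : Fin w.length // (w.get p).toLeft = true} =
      Fintype.card {p : Fin w.length // ¬ (w.get p).toLeft = true} := by
    refine Fintype.card_congr
      { toFun := fun p => ⟨partner w p, by rw [get_partner hw, Passage.opp_toLeft, p.2]; simp⟩
        invFun := fun p => ⟨partner w p, by
          rw [get_partner hw, Passage.opp_toLeft, Bool.eq_false_of_not_eq_true p.2]; rfl⟩
        left_inv := fun p => Subtype.ext (partner_partner hw _)
        right_inv := fun p => Subtype.ext (partner_partner hw _) }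
  have h2 := Fintype.card_subtype_compl fun p : Fin w.length => (w.get p).toLeft = true
  have h3 := Fintype.card_subtype_le fun p : Fin w.length => (w.get p).toLeft = true
  rw [Fintype.card_fin] at h2 h3
  omega

/-- By `faceDiff_partner` the jumps vanish on both strands of every crossing, so the difference is
constant along the closed curve. -/
theorem faceDiff_eq_of_jumps {w : List Passage} (hw : IsGaussWord w) {f : Dart w → ℚ}
    (hf : ∀ x, f (turnLeft w x) = f x)
    (h : ∀ p, (w.get p).toLeft = true →
      faceDiff w f p - faceDiff w f ((finRotate w.length).symm p) = 0) (p q : Fin w.length) :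
    faceDiff w f p = faceDiff w f q := by
  have hj : ∀ p, faceDiff w f p = faceDiff w f ((finRotate w.length).symm p) := by
    intro p
    cases hp : (w.get p).toLeft
    · have h1 := h (partner w p) (by rw [get_partner hw, Passage.opp_toLeft, hp]; rfl)
      have h2 := faceDiff_partner hw hf p
      linarith
    · linarith [h p hp]
  refine eq_of_finRotate_invariant (fun p => ?_) p q
  rw [hj, Equiv.symm_apply_apply]

/-- In the kernel the difference vanishes at one edge and has no jumps, hence vanishes everywhere,
and the function is constant. -/
theorem finrank_ker_faceMap {w : List Passage} (hw : IsGaussWord w) (p₀ : Fin w.length) :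
    Module.finrank ℚ (LinearMap.ker (faceMap w p₀)) ≤ 1 := by
  refine finrank_le_one ⟨fun _ => 1, ?_⟩ fun ψ => ⟨faceFun w ψ (p₀, true), ?_⟩
  · refine LinearMap.mem_ker.2 (Prod.ext ?_ (funext fun p => ?_)) <;>
      simp [faceMap, faceDiff, faceFun]
  · obtain ⟨ψ, hψ⟩ := ψ
    have h0 := LinearMap.mem_ker.1 hψ
    have h1 : faceDiff w (faceFun w ψ) p₀ = 0 := congrArg Prod.fst h0
    have h2 := faceDiff_eq_of_jumps hw (faceFun_turnLeft hw ψ) fun p hp =>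
      congrFun (congrArg Prod.snd h0) ⟨p, hp⟩
    have h3 := constant_of_faceDiff_eq_zero hw (faceFun_turnLeft hw ψ) fun p => by rw [h2 p p₀, h1]
    refine Subtype.ext (funext fun F => ?_)
    obtain ⟨F, hF⟩ := F
    obtain ⟨x, -, rfl⟩ := Finset.mem_image.1 hF
    exact (mul_one _).trans (h3 (p₀, true) x)

theorem finrank_faceMap_codomain {w : List Passage} (hw : IsGaussWord w) :
    Module.finrank ℚ (ℚ × ({p : Fin w.length // (w.get p).toLeft = true} → ℚ)) =
      w.length / 2 + 1 := by
  rw [Module.finrank_prod, Module.finrank_self, Module.finrank_fintype_fun_eq_card]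
  have := card_toLeft hw
  omega

/-- Rank and nullity: `F ≤ (V + 1) + 1`. This is the inequality `V - E + F ≤ 2` for any surface,
with `E = 2 * V`. -/
theorem card_faces_le {w : List Passage} (hw : IsGaussWord w) (hne : w ≠ []) :
    (faces w).card ≤ w.length / 2 + 2 := by
  have hpos : 0 < w.length := List.length_pos_iff.2 hne
  have h1 := (faceMap w ⟨0, hpos⟩).finrank_range_add_finrank_ker
  have h2 := finrank_ker_faceMap hw ⟨0, hpos⟩
  have h3 := Submodule.finrank_le (LinearMap.range (faceMap w ⟨0, hpos⟩))
  rw [finrank_faceMap_codomain hw] at h3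
  rw [Module.finrank_fintype_fun_eq_card, Fintype.card_coe] at h1
  omega

/-- Planarity is equality in the rank count, so `faceMap` is surjective. -/
theorem exists_faceDiff_eq_one {w : List Passage} (hw : IsGaussWord w) (hne : w ≠ [])
    (hp : (faces w).card = w.length / 2 + 2) :
    ∃ f : Dart w → ℚ, (∀ x, f (turnLeft w x) = f x) ∧ ∀ p, faceDiff w f p = 1 := by
  have hpos : 0 < w.length := List.length_pos_iff.2 hne
  have h1 := (faceMap w ⟨0, hpos⟩).finrank_range_add_finrank_ker
  have h2 := finrank_ker_faceMap hw ⟨0, hpos⟩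
  have h3 := Submodule.finrank_le (LinearMap.range (faceMap w ⟨0, hpos⟩))
  have h4 := finrank_faceMap_codomain hw
  rw [Module.finrank_fintype_fun_eq_card, Fintype.card_coe] at h1
  have htop : LinearMap.range (faceMap w ⟨0, hpos⟩) = ⊤ :=
    Submodule.eq_top_of_finrank_eq (by omega)
  -- The target `(1, 0)` asks for difference 1 at the first edge and no jumps, that is, difference 1
  -- at every edge.
  obtain ⟨ψ, hψ⟩ := LinearMap.range_eq_top.1 htop (1, 0)
  refine ⟨faceFun w ψ, faceFun_turnLeft hw ψ, fun p => ?_⟩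
  rw [faceDiff_eq_of_jumps hw (faceFun_turnLeft hw ψ)
    (fun p hp => congrFun (congrArg Prod.snd hψ) ⟨p, hp⟩) p ⟨0, hpos⟩]
  exact congrArg Prod.fst hψ

/-- The Alexander numbering of the edges of a planar diagram. -/
theorem exists_numbering {w : List Passage} (hw : IsGaussWord w) (hne : w ≠ [])
    (hp : (faces w).card = w.length / 2 + 2) :
    ∃ φ : ℕ × ℕ → ℚ, (∀ a ∈ seg (0, 0) w (0, 0), φ a.2.1 = φ a.1) ∧
      ∀ x ∈ w, x.toLeft = true → φ (out x) = φ (inn x) + 1 ∧ φ (inn x.opp) = φ (inn x) + 1 ∧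
        φ (out x.opp) = φ (inn x) := by
  obtain ⟨x, l, rfl⟩ := List.exists_cons_of_ne_nil hne
  set w := x :: l with hwdef
  obtain ⟨f, hf, hd⟩ := exists_faceDiff_eq_one hw hne hp
  -- An edge is numbered by the face on its right: the dart `(p, false)` runs backwards along edge
  -- `p`, so the face on its left is the one on the right of the edge.
  set φ' : Dart w → ℚ := fun y => f (edgeOf w y, false) with hφ'
  -- The default value matters at the base point, which lies on the edge arriving at visit 0.
  set φ : ℕ × ℕ → ℚ := Function.extend (port w) φ'
    fun _ => φ' (⟨0, by simp [hwdef]⟩, true) with hφ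
  have hport : ∀ y, φ (port w y) = φ' y := (port_injective hw.isProper).extend_apply _ _
  have h0 : φ (0, 0) = φ' (⟨0, by simp [hwdef]⟩, true) :=
    Function.extend_apply' _ _ _ fun ⟨y, h⟩ => zero_not_mem_ports w 0 (mem_ports_iff.2 ⟨y, h⟩)
  refine ⟨φ, (forall_seg_closed φ x l).2 ⟨by rw [h0, hport], fun y => ?_⟩, fun y hy ht => ?_⟩
  · rw [hport, hport]
    exact congrArg (fun e => f (e, false)) (edgeOf_across w y)
  · obtain ⟨p, rfl⟩ := List.get_of_mem hy
    obtain ⟨h1, h2, h3, h4⟩ := corners hw hf ht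
    have hl : ∀ p, f (finRotate w.length p, true) = f (p, false) + 1 := fun p => by
      have := hd p
      rw [faceDiff] at this
      linarith
    have hl' : ∀ p, f (p, true) = f ((finRotate w.length).symm p, false) + 1 := fun p => by
      rw [← hl, Equiv.apply_symm_apply]
    rw [← get_partner hw]
    have e1 : φ (inn (w.get p)) = f ((finRotate w.length).symm p, false) := hport (p, true)
    have e2 : φ (out (w.get p)) = f (p, false) := hport (p, false)
    have e3 : φ (inn (w.get (partner w p))) =
      f ((finRotate w.length).symm (partner w p), false) := hport (partner w p, true)
    have e4 : φ (out (w.get (partner w p))) = f (partner w p, false) := hport (partner w p, false)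
    rw [e1, e2, e3, e4]
    rw [hl, hl'] at h1
    rw [hl'] at h2
    rw [hl] at h3
    refine ⟨?_, ?_, ?_⟩ <;> linarith

end VirtualKnot

namespace VirtualKnot

/-! ### The lower bound for the virtual crossing number -/

section Slack
variable {α : Type*}

/-- How far a function of the end points is from changing by the weights along the arcs. -/
def slack (φ : α → ℚ) (L : ArcSystem α) : ℚ :=
  (L.map fun a => |(a.2.2 : ℚ) - (φ a.2.1 - φ a.1)|).sum

theorem slack_cons (φ : α → ℚ) (a : α × α × ℤ) (L : ArcSystem α) :
    slack φ (a :: L) = |(a.2.2 : ℚ) - (φ a.2.1 - φ a.1)| + slack φ L := by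
  simp [slack]

theorem slack_append (φ : α → ℚ) (L M : ArcSystem α) :
    slack φ (L ++ M) = slack φ L + slack φ M := by
  simp [slack]

theorem slack_perm (φ : α → ℚ) {L M : ArcSystem α} (h : L.Perm M) : slack φ L = slack φ M :=
  (h.map _).sum_eq

theorem slack_nonneg (φ : α → ℚ) (L : ArcSystem α) : 0 ≤ slack φ L :=
  List.sum_nonneg fun _ hx => by
    obtain ⟨a, -, rfl⟩ := List.mem_map.1 hx
    exact abs_nonneg _

/-- On a closed loop the values of `φ` cancel and the slack is the absolute weight. A contraction
does not increase the slack, by the triangle inequality, and the fallback branch only drops a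
nonnegative term. -/
theorem sum_loopWeightsAux_le [DecidableEq α] (φ : α → ℚ) (n : ℕ) (L : ArcSystem α) :
    ((loopWeightsAux n L).sum : ℚ) ≤ slack φ L := by
  induction n generalizing L with
  | zero => simpa [loopWeightsAux] using slack_nonneg φ L
  | succ n ih =>
    rcases L with _ | ⟨⟨a, b, k⟩, L⟩
    · simp [loopWeightsAux, slack]
    · rw [slack_cons]
      unfold loopWeightsAux
      split_ifs with h
      · subst h
        rw [List.sum_cons, Nat.cast_add]
        have := ih L
        have h1 : ((k.natAbs : ℕ) : ℚ) = |(k : ℚ)| := by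
          rw [Nat.cast_natAbs, Int.cast_abs]
        simp only [sub_self, sub_zero]
        rw [h1]
        linarith
      · split
        · rename_i c l M hM
          have h1 := ih ((a, c, k + l) :: M)
          have h2 : slack φ L = |(l : ℚ) - (φ c - φ b)| + slack φ M := by
            rcases extract_some hM with h | h
            · rw [slack_perm φ h, slack_cons]
            · rw [slack_perm φ h, slack_cons, ← abs_neg]
              push_cast
              congr 2
              ring
          rw [slack_cons] at h1
          have h3 := abs_add_le ((k : ℚ) - (φ b - φ a)) ((l : ℚ) - (φ c - φ b))
          have h4 : (k : ℚ) - (φ b - φ a) + ((l : ℚ) - (φ c - φ b)) = (k + l : ℤ) - (φ c - φ a) := by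
            push_cast; ring
          rw [h4] at h3
          simp only at h1 ⊢
          linarith
        · have := ih L
          have := abs_nonneg ((k : ℚ) - (φ b - φ a))
          simp only
          linarith

end Slack

theorem length_virtual {w : List Passage} (hw : IsGaussWord w) :
    (w.filter fun x => x.level = Level.virt).length = 2 * (virtualCrossings w).card := by
  set l := (w.filter fun x => x.level = Level.virt).map Passage.crossing with hl
  have h : ∀ n ∈ l.toFinset, l.count n = 2 := by
    intro n hn
    obtain ⟨x, hx, rfl⟩ := List.mem_map.1 (List.mem_toFinset.1 hn)
    obtain ⟨hxw, hxv⟩ := List.mem_filter.1 hx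
    rw [hl, List.count_eq_countP, List.countP_map, List.countP_filter, ← (hw x hxw).2]
    refine List.countP_congr fun y hy => ?_
    simp only [Function.comp_apply, Bool.and_eq_true, beq_iff_eq, decide_eq_true_eq,
      and_iff_left_iff_imp]
    intro hyx
    by_cases ht : y.toLeft = x.toLeft
    · rw [hw.isProper.eq hy hxw hyx ht]
      simpa using hxv
    · rw [hw.isProper.eq hy (hw x hxw).1 hyx (by simpa using Bool.eq_not_of_ne ht)]
      simpa using hxv
  have h2 := List.sum_toFinset_count_eq_length l
  rw [Finset.sum_congr rfl h, Finset.sum_const, smul_eq_mul] at h2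
  rw [← List.length_map (f := Passage.crossing), ← hl, ← h2, mul_comm]
  rfl

/-- Take the Alexander numbering as `φ`. At a classical crossing an oriented arc joins equal numbers
and a disoriented one joins numbers differing by its nodal sign, so the slack is 0. At a virtual
crossing each strand changes its number by one along an arc of weight 0, which costs 1 per visit, 2
per crossing. -/
theorem sum_loopWeights_le {w : List Passage} (hw : IsGaussWord w) (hne : w ≠ [])
    (hp : (faces w).card = w.length / 2 + 2) (χ : ℕ → Bool) :
    (loopWeights (stateArcs χ w)).sum ≤ 2 * (virtualCrossings w).card := by
  obtain ⟨φ, h1, h2⟩ := exists_numbering hw hne hp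
  have hseg : slack φ (seg (0, 0) w (0, 0)) = 0 := by
    refine List.sum_eq_zero fun y hy => ?_
    obtain ⟨a, ha, rfl⟩ := List.mem_map.1 hy
    simp [seg_weight ha, h1 a ha]
  have hx : ∀ x ∈ w, slack φ (smoothing χ x) ≤ if x.level = Level.virt then 1 else 0 := by
    intro x hx
    have h3 := h2 x hx
    have h4 := h2 x.opp (hw x hx).1
    rw [Passage.opp_opp, Passage.opp_toLeft] at h4
    unfold smoothing
    cases ht : x.toLeft
    · obtain ⟨ha, hb, hc⟩ := h4 (by simp [ht])
      split_ifs <;> simp [slack, nodalSign, ht, ha, hb, hc]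
    · obtain ⟨ha, hb, hc⟩ := h3 ht
      split_ifs <;> simp [slack, nodalSign, ht, ha, hb, hc]
  have hs : ∀ u : List Passage, (∀ x ∈ u, slack φ (smoothing χ x) ≤
      if x.level = Level.virt then 1 else 0) →
      slack φ (smoothings χ u) ≤ (u.filter fun x => x.level = Level.virt).length := by
    intro u hu
    induction u with
    | nil => simp [slack, smoothings]
    | cons x u ih =>
      have := hu x (by simp)
      have := ih fun y hy => hu y (by simp [hy])
      rw [smoothings_cons, slack_append, List.filter_cons]
      by_cases hv : x.level = Level.virt <;> simp [hv] at * <;> linarith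
  have h5 : ((loopWeights (stateArcs χ w)).sum : ℚ) ≤ _ := sum_loopWeightsAux_le φ _ _
  have h6 := hs w hx
  rw [length_virtual hw] at h6
  have h7 : slack φ (stateArcs χ w) = slack φ (smoothings χ w) := by
    rw [stateArcs, slack_append, hseg, zero_add]
  rw [h7] at h5
  exact_mod_cast h5.trans h6

/-! ### The k-degree and the virtual crossing number -/

/-- The k-degree is at most `n`. -/
def KDegreeLE (n : ℕ) (f : ArrowRing) : Prop :=
  ∀ d ∈ f.support, Finsupp.weight (fun i : ℕ+ => (i : ℕ)) d ≤ n

theorem maxKDegree_le_iff {n : ℕ} {f : ArrowRing} : maxKDegree f ≤ n ↔ KDegreeLE n f :=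
  Finset.sup_le_iff

theorem KDegreeLE.mono {m n : ℕ} {f : ArrowRing} (h : KDegreeLE m f) (hmn : m ≤ n) :
    KDegreeLE n f := fun d hd => (h d hd).trans hmn

theorem KDegreeLE.add {n : ℕ} {f g : ArrowRing} (hf : KDegreeLE n f) (hg : KDegreeLE n g) :
    KDegreeLE n (f + g) := fun d hd => by
  classical
  rcases Finset.mem_union.1 (MvPolynomial.support_add hd) with h | h
  exacts [hf d h, hg d h]

theorem KDegreeLE.sum {ι : Type*} {n : ℕ} {s : Finset ι} {f : ι → ArrowRing}
    (h : ∀ i ∈ s, KDegreeLE n (f i)) : KDegreeLE n (∑ i ∈ s, f i) :=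
  Finset.sum_induction f (KDegreeLE n) (fun _ _ => .add) (fun d hd => by simp at hd) h

theorem KDegreeLE.mul {m n : ℕ} {f g : ArrowRing} (hf : KDegreeLE m f) (hg : KDegreeLE n g) :
    KDegreeLE (m + n) (f * g) := fun d hd => by
  classical
  obtain ⟨a, ha, b, hb, rfl⟩ := Finset.mem_add.1 (MvPolynomial.support_mul f g hd)
  rw [map_add]
  exact add_le_add (hf a ha) (hg b hb)

theorem kDegreeLE_C (c : ℤ[T;T⁻¹]) : KDegreeLE 0 (MvPolynomial.C c) := fun d hd => by
  classical
  rw [MvPolynomial.mem_support_iff, MvPolynomial.coeff_C] at hd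
  obtain rfl : 0 = d := by by_contra h; simp [h] at hd
  simp

theorem kDegreeLE_A (m : ℤ) : KDegreeLE 0 (A m) := kDegreeLE_C _

theorem K_coe (n : ℕ+) : K n = MvPolynomial.X n := dif_pos n.pos

theorem kDegreeLE_K (n : ℕ) : KDegreeLE n (K n) := by
  rcases Nat.eq_zero_or_pos n with rfl | h
  · rw [K_zero]
    exact kDegreeLE_C 1
  · lift n to ℕ+ using h
    rw [K_coe]
    intro d hd
    rw [MvPolynomial.support_X, Finset.mem_singleton] at hd
    simp [hd, Finsupp.weight_single]

theorem KDegreeLE.pow {f : ArrowRing} (hf : KDegreeLE 0 f) (k : ℕ) : KDegreeLE 0 (f ^ k) := by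
  induction k with
  | zero => simpa using kDegreeLE_C 1
  | succ k ih => rw [pow_succ]; exact ih.mul hf

theorem KDegreeLE.neg {n : ℕ} {f : ArrowRing} (hf : KDegreeLE n f) : KDegreeLE n (-f) :=
  fun d hd => hf d (by rwa [MvPolynomial.support_neg] at hd)

theorem KDegreeLE.zsmul {n : ℕ} {f : ArrowRing} (hf : KDegreeLE n f) (c : ℤ) :
    KDegreeLE n (c • f) := by
  have : c • f = MvPolynomial.C (c : ℤ[T;T⁻¹]) * f := by
    rw [zsmul_eq_mul, map_intCast]
  rw [this, ← zero_add n]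
  exact (kDegreeLE_C _).mul hf

theorem kDegreeLE_prod_K {ι : Type*} (s : Finset ι) (k : ι → ℕ) :
    KDegreeLE (∑ i ∈ s, k i) (∏ i ∈ s, K (k i)) := by
  classical
  induction s using Finset.induction_on with
  | empty => simpa using kDegreeLE_C 1
  | insert i s hi ih =>
    rw [Finset.sum_insert hi, Finset.prod_insert hi]
    exact (kDegreeLE_K _).mul ih

theorem kDegreeLE_loopFactor : KDegreeLE 0 (- A 2 - A (-2)) := by
  rw [sub_eq_add_neg]
  exact (kDegreeLE_A 2).neg.add (kDegreeLE_A (-2)).neg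

/-- Each state contributes a monomial in the `K n` of degree half the total loop weight, times a
polynomial in `A` alone. -/
theorem maxKDegree_le_virtualCrossings (D : Diagram) :
    maxKDegree (arrowPolynomial D.word) ≤ (virtualCrossings D.word).card := by
  rw [maxKDegree_le_iff]
  rcases D with ⟨w, hw, hp⟩
  simp only
  by_cases hne : w = []
  · simpa [hne, arrowPolynomial] using (kDegreeLE_C 1).mono (Nat.zero_le _)
  rw [arrowPolynomial, if_neg hne]
  refine .sum fun s _ => ?_
  have h1 := sum_loopWeights_le hw hne (hp.resolve_left hne) fun n => decide (n ∈ s)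
  have h2 := congrArg Multiset.sum (loopWeights_stateArcs hw hne s)
  -- Rounding down in `n / 2` only helps, so no parity of the weights is required.
  have h3 : ∀ l : List ℕ, 2 * (((l : Multiset ℕ).map (· / 2)).sum) ≤ l.sum := by
    intro l
    induction l with
    | nil => simp
    | cons n l ih =>
      simp only [Multiset.map_coe, Multiset.sum_coe, List.map_cons, List.sum_cons] at ih ⊢
      omega
  have h4 := h3 (loopWeights (stateArcs (fun n => decide (n ∈ s)) w))
  rw [h2] at h4
  have h5 : ∑ l ∈ loops w s, l.2 ≤ (virtualCrossings w).card := by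
    change Multiset.sum (Multiset.map Prod.snd (loops w s).val) ≤ _
    omega
  have h6 := (((kDegreeLE_A ((s.card : ℤ) - ((classicalCrossings w \ s).card : ℤ))).mul
    (kDegreeLE_loopFactor.pow ((loops w s).card - 1))).mul
    (kDegreeLE_prod_K (loops w s) Prod.snd))
  exact h6.mono (by omega)

/-- The two polynomials differ by a factor `± A ^ e`, which has k-degree 0. -/
theorem maxKDegree_le_of_equivalent {D D' : Diagram} (h : D.Equivalent D') :
    maxKDegree (arrowPolynomial D.word) ≤ maxKDegree (arrowPolynomial D'.word) := by
  obtain ⟨e, c, h⟩ := h.arrowPolynomial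
  rw [maxKDegree_le_iff, h, ← zero_add (maxKDegree _)]
  exact ((kDegreeLE_A e).mul (maxKDegree_le_iff.1 le_rfl)).zsmul c

/-- The maximum k-degree of the arrow polynomial is a lower bound for the virtual crossing number. -/
theorem maxKDegree_le_virtualCrossingNumber (D : Diagram) :
    maxKDegree (arrowPolynomial D.word) ≤ D.virtualCrossingNumber := by
  -- The set contains the count of `D` itself, so the infimum is attained by some equivalent
  -- diagram.
  obtain ⟨D', h, hD'⟩ := Nat.sInf_mem
    (s := {n | ∃ D' : Diagram, D.Equivalent D' ∧ (virtualCrossings D'.word).card = n})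
    ⟨_, D, .refl D, rfl⟩
  rw [Diagram.virtualCrossingNumber, ← hD']
  exact (maxKDegree_le_of_equivalent h).trans (maxKDegree_le_virtualCrossings D')

end VirtualKnot

namespace VirtualKnot

/-! ### The table -/

/-- The monomial `K_i K_j ⋯` of a list. -/
noncomputable def prodK (l : List ℕ) : ArrowRing := (l.map K).prod

/-- The terms of the state sum of a word with the classical crossings `X`. -/
def stateTerms (X : List ℕ) (w : List Passage) : List (List ℕ × ℤ × ℤ) :=
  X.sublists'.flatMap fun t =>
    let r := loopWeights (stateArcs (fun n => decide (n ∈ t)) w)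
    (loopFactorPow r.length).map fun e =>
      (((r.map (· / 2)).filter (· ≠ 0)).insertionSort (· ≤ ·), 2 * t.length - X.length + e.1, e.2)

theorem termsValue_stateTerms {X : List ℕ} {w : List Passage} (hX : X.Nodup)
    (hw : classicalCrossings w = X.toFinset) : termsValue prodK (stateTerms X w) = stateSum w := by
  rw [stateSum, hw, sum_powerset_toFinset hX, stateTerms, termsValue_flatMap]
  refine congrArg List.sum (List.map_congr_left fun t ht => ?_)
  rw [termsValue_loopFactorPow, stateValue, hw, List.toFinset_card_of_nodup hX,
    List.toFinset_card_of_nodup (hX.sublist (List.mem_sublists'.1 ht)), loopsValue_coe, prodK,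
    ((List.perm_insertionSort _ _).map K).prod_eq, prod_map_K_filter]
  simp only [List.mem_toFinset]

/-- The terms of a row of the table. -/
def Row.keyedTerms (r : Row) : List (List ℕ × ℤ × ℤ) := r.terms.map fun t => (t.2.2, t.2.1, t.1)

theorem Row.polynomial_eq (r : Row) : r.polynomial = termsValue prodK r.keyedTerms := by
  simp [Row.polynomial, termsValue, Row.keyedTerms, Function.comp_def, prodK]

theorem termsValue_mul_loopFactor (l : List (List ℕ × ℤ × ℤ)) :
    termsValue prodK (scaleTerms 2 (-1) l ++ scaleTerms (-2) (-1) l) =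
      loopFactor * termsValue prodK l := by
  rw [termsValue_append, termsValue_scaleTerms, termsValue_scaleTerms, loopFactor]
  simp only [neg_smul, one_smul]
  ring

/-- The table polynomial is compared after multiplication by `d`, written as two shifted copies with
sign, so that no division by `d` occurs in the computation. -/
theorem table_stateTerms : ∀ r ∈ table, classicalCrossings r.code = [1, 2, 3, 4].toFinset ∧
    termsAgree 0 1 (stateTerms [1, 2, 3, 4] r.code)
      (scaleTerms 2 (-1) r.keyedTerms ++ scaleTerms (-2) (-1) r.keyedTerms) = true := by
  decide +kernel

theorem arrowPolynomial_of_mem_table {r : Row} (hr : r ∈ table) (D : Diagram)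
    (hD : gaussCode D.word = r.code) : arrowPolynomial D.word = r.polynomial := by
  refine mul_left_cancel₀ loopFactor_ne_zero ?_
  obtain ⟨h1, h2⟩ := table_stateTerms r hr
  rw [loopFactor_mul_arrowPolynomial D.isGaussWord, ← stateSum_gaussCode D.isGaussWord.isProper, hD,
    ← termsValue_stateTerms (by decide) h1, termsValue_eq_of_termsAgree h2, one_smul, A_zero,
    one_mul, termsValue_mul_loopFactor, Row.polynomial_eq]

/-! ### Coefficients of polynomials given by lists of terms -/

/-- The exponents of the monomial `K_n`. -/
noncomputable def exponent (n : ℕ) : ℕ+ →₀ ℕ :=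
  if h : 0 < n then Finsupp.single (⟨n, h⟩ : ℕ+) 1 else 0

theorem exponent_zero : exponent 0 = 0 := rfl

theorem exponent_coe (n : ℕ+) : exponent n = Finsupp.single n 1 := dif_pos n.pos

/-- The exponents of the monomial `K_i K_j ⋯` of a list. -/
noncomputable def exponents (l : List ℕ) : ℕ+ →₀ ℕ := (l.map exponent).sum

theorem exponents_cons (n : ℕ) (l : List ℕ) : exponents (n :: l) = exponent n + exponents l := by
  simp [exponents]

theorem prodK_eq (l : List ℕ) : prodK l = MvPolynomial.monomial (exponents l) 1 := by
  induction l with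
  | nil => rfl
  | cons n l ih =>
    rw [prodK, List.map_cons, List.prod_cons, ← prodK, ih, exponents_cons]
    rcases Nat.eq_zero_or_pos n with rfl | h
    · simp [K_zero, exponent_zero]
    · lift n to ℕ+ using h
      rw [K_coe, MvPolynomial.X, MvPolynomial.monomial_mul, one_mul, exponent_coe]

theorem exponents_apply (l : List ℕ) (n : ℕ+) : exponents l n = l.count (n : ℕ) := by
  induction l with
  | nil => rfl
  | cons m l ih =>
    rw [exponents_cons, Finsupp.add_apply, ih, List.count_cons, add_comm]
    congr 1
    rcases Nat.eq_zero_or_pos m with rfl | h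
    · simp [n.pos.ne, exponent_zero]
    · lift m to ℕ+ using h
      simp [exponent_coe, Finsupp.single_apply, ← PNat.coe_inj]

/-- Zeros have to be excluded because `K 0 = 1` leaves no trace in the exponents. -/
theorem exponents_injective {l l' : List ℕ} (hl : 0 ∉ l) (hl' : 0 ∉ l')
    (h : exponents l = exponents l') : l.Perm l' := by
  refine List.perm_iff_count.2 fun n => ?_
  rcases Nat.eq_zero_or_pos n with rfl | hn
  · rw [List.count_eq_zero.2 hl, List.count_eq_zero.2 hl']
  · lift n to ℕ+ using hn
    rw [← exponents_apply, ← exponents_apply, h]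

theorem weight_exponents (l : List ℕ) :
    Finsupp.weight (fun i : ℕ+ => (i : ℕ)) (exponents l) = l.sum := by
  induction l with
  | nil => exact map_zero _
  | cons m l ih =>
    rw [exponents_cons, map_add, ih, List.sum_cons]
    congr 1
    rcases Nat.eq_zero_or_pos m with rfl | h
    · simp [exponent_zero]
    · lift m to ℕ+ using h
      simp [exponent_coe, Finsupp.weight_single]

theorem exponents_perm {l l' : List ℕ} (h : l.Perm l') : exponents l = exponents l' :=
  (h.map _).sum_eq

/-- The coefficient of `A ^ m K_i K_j ⋯`. -/
noncomputable def coeffAt (m : ℤ) (l : List ℕ) : ArrowRing →+ ℤ where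
  toFun f := (MvPolynomial.coeff (exponents l) f).coeff m
  map_zero' := by simp
  map_add' f g := by simp

theorem coeffAt_A_mul_prodK {m e : ℤ} {l k : List ℕ} (hl : 0 ∉ l) (hk : 0 ∉ k) :
    coeffAt m l (A e * prodK k) = if e = m ∧ k.Perm l then 1 else 0 := by
  classical
  have h : exponents k = exponents l ↔ k.Perm l := ⟨exponents_injective hk hl, exponents_perm⟩
  change (MvPolynomial.coeff (exponents l) (A e * prodK k)).coeff m = _
  rw [A, prodK_eq, MvPolynomial.C_mul_monomial, mul_one, MvPolynomial.coeff_monomial]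
  by_cases h1 : k.Perm l
  · rw [if_pos (h.2 h1)]
    simp [h1, LaurentPolynomial.T_apply]
  · rw [if_neg (fun h' => h1 (h.1 h'))]
    simp [h1]

/-- The coefficient of `A ^ m K_i K_j ⋯`, computed from a list of terms. -/
def coeffSum (m : ℤ) (l : List ℕ) (terms : List (List ℕ × ℤ × ℤ)) : ℤ :=
  (terms.map fun t => if t.2.1 = m ∧ t.1.Perm l then t.2.2 else 0).sum

theorem coeffAt_termsValue {m : ℤ} {l : List ℕ} (hl : 0 ∉ l) {terms : List (List ℕ × ℤ × ℤ)}
    (h : ∀ t ∈ terms, 0 ∉ t.1) : coeffAt m l (termsValue prodK terms) = coeffSum m l terms := by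
  induction terms with
  | nil => simp [termsValue, coeffSum]
  | cons t terms ih =>
    rw [termsValue_cons, map_add, map_zsmul, coeffAt_A_mul_prodK hl (h t (by simp)),
      ih fun t ht => h t (by simp [ht]), coeffSum, coeffSum, List.map_cons, List.sum_cons]
    congr 1
    split_ifs <;> simp

theorem kDegreeLE_prodK (l : List ℕ) : KDegreeLE l.sum (prodK l) := by
  induction l with
  | nil => exact kDegreeLE_C 1
  | cons n l ih =>
    rw [prodK, List.map_cons, List.prod_cons, ← prodK, List.sum_cons]
    exact (kDegreeLE_K n).mul ih

/-- The upper bound holds term by term. For the lower bound a monomial of weight `b` must survive,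
so its total coefficient over the whole list is tested. -/
theorem maxKDegree_termsValue {terms : List (List ℕ × ℤ × ℤ)} {b : ℕ}
    (h0 : ∀ t ∈ terms, 0 ∉ t.1 ∧ t.1.sum ≤ b)
    (h1 : ∃ t ∈ terms, t.1.sum = b ∧ coeffSum t.2.1 t.1 terms ≠ 0) :
    maxKDegree (termsValue prodK terms) = b := by
  refine le_antisymm (maxKDegree_le_iff.2 ?_) ?_
  · clear h1
    induction terms with
    | nil => exact fun d hd => by simp [termsValue] at hd
    | cons t terms ih =>
      rw [termsValue_cons]
      refine .add (.zsmul ?_ _) (ih fun t ht => h0 t (by simp [ht]))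
      have := (kDegreeLE_A t.2.1).mul (kDegreeLE_prodK t.1)
      exact this.mono (by rw [zero_add]; exact (h0 t (by simp)).2)
  · obtain ⟨t, ht, hb, hc⟩ := h1
    rw [← coeffAt_termsValue (h0 t ht).1 fun t ht => (h0 t ht).1] at hc
    rw [← hb, ← weight_exponents]
    refine MvPolynomial.le_weightedTotalDegree _ (MvPolynomial.mem_support_iff.2 fun h => hc ?_)
    exact congrArg (fun c : ℤ[T;T⁻¹] => c.coeff t.2.1) h

theorem termsValue_ne_one {terms : List (List ℕ × ℤ × ℤ)} (h0 : ∀ t ∈ terms, 0 ∉ t.1)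
    (h1 : ∃ t ∈ terms, (t.2.1 ≠ 0 ∨ t.1 ≠ []) ∧ coeffSum t.2.1 t.1 terms ≠ 0) :
    termsValue prodK terms ≠ 1 := by
  intro h
  obtain ⟨t, ht, hne, hc⟩ := h1
  rw [← coeffAt_termsValue (h0 t ht) h0, h] at hc
  have h2 := coeffAt_A_mul_prodK (m := t.2.1) (e := 0) (h0 t ht) (List.not_mem_nil (a := 0))
  rw [A_zero, one_mul, show prodK [] = 1 from rfl] at h2
  rw [h2] at hc
  simp only [List.nil_perm, ne_eq, ite_eq_right_iff, one_ne_zero, imp_false, not_not] at hc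
  rcases hne with h | h
  exacts [h hc.1.symm, h hc.2]

theorem writhe_gaussCode (w : List Passage) : writhe (gaussCode w) = writhe w := by
  unfold writhe gaussCode
  rw [List.filter_filter]
  congr 3
  funext x
  cases x.level <;> simp

theorem normalizedArrowPolynomial_eq {r : Row} (hr : r ∈ table) (D : Diagram)
    (hD : gaussCode D.word = r.code) : normalizedArrowPolynomial D.word =
      termsValue prodK (scaleTerms (-3 * writhe r.code) ((writhe r.code).negOnePow : ℤ)
        r.keyedTerms) := by
  rw [normalizedArrowPolynomial, arrowPolynomial_of_mem_table hr D hD, ← writhe_gaussCode, hD,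
    termsValue_scaleTerms, Row.polynomial_eq]

theorem table_bounds : ∀ r ∈ table, r.bound ≤ 3 ∧
    (∀ t ∈ r.keyedTerms, 0 ∉ t.1 ∧ t.1.sum ≤ r.bound) ∧
    ∃ t ∈ r.keyedTerms, t.1.sum = r.bound ∧ coeffSum t.2.1 t.1 r.keyedTerms ≠ 0 := by
  decide +kernel

theorem table_trivial : ∀ r ∈ table, r.number ∈ ({46, 72, 98, 107} : Finset ℕ) →
    r.keyedTerms = [([], 0, 1)] ∧ writhe r.code = 0 := by
  decide +kernel

/-- The terms contain a monomial other than `A ^ m`, with a nonzero coefficient. -/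
def HasTermOtherThan (m : ℤ) (terms : List (List ℕ × ℤ × ℤ)) : Prop :=
  ∃ t ∈ terms, (t.2.1 ≠ m ∨ t.1 ≠ []) ∧ coeffSum t.2.1 t.1 terms ≠ 0

instance (m : ℤ) (terms : List (List ℕ × ℤ × ℤ)) : Decidable (HasTermOtherThan m terms) :=
  inferInstanceAs (Decidable (∃ _ ∈ _, _))

/-- Normalization multiplies by `± A ^ (-3 * writhe)`, so a value 1 would require the polynomial to
be `± A ^ (3 * writhe)`; hence the second condition excludes this exponent instead of 0. -/
theorem table_nontrivial : ∀ r ∈ table, r.number ∉ ({46, 72, 98, 107} : Finset ℕ) →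
    HasTermOtherThan 0 r.keyedTerms ∧ HasTermOtherThan (3 * writhe r.code) r.keyedTerms := by
  decide +kernel

theorem coeffSum_scaleTerms (e c m : ℤ) (l : List ℕ) (terms : List (List ℕ × ℤ × ℤ)) :
    coeffSum (e + m) l (scaleTerms e c terms) = c * coeffSum m l terms := by
  induction terms with
  | nil => simp [coeffSum, scaleTerms]
  | cons t terms ih =>
    simp only [coeffSum, scaleTerms, List.map_cons, List.sum_cons, add_right_inj] at ih ⊢
    rw [ih, mul_add]
    congr 1
    split_ifs <;> simp

theorem arrowPolynomial_eq_one_iff {r : Row} (hr : r ∈ table) (D : Diagram)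
    (hD : gaussCode D.word = r.code) :
    arrowPolynomial D.word = 1 ↔ r.number ∈ ({46, 72, 98, 107} : Finset ℕ) := by
  rw [arrowPolynomial_of_mem_table hr D hD, Row.polynomial_eq]
  constructor
  · intro h
    by_contra hn
    exact termsValue_ne_one (fun t ht => ((table_bounds r hr).2.1 t ht).1)
      (table_nontrivial r hr hn).1 h
  · intro h
    rw [(table_trivial r hr h).1]
    simp [termsValue, A_zero, prodK]

theorem normalizedArrowPolynomial_eq_one_iff {r : Row} (hr : r ∈ table) (D : Diagram)
    (hD : gaussCode D.word = r.code) :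
    normalizedArrowPolynomial D.word = 1 ↔ r.number ∈ ({46, 72, 98, 107} : Finset ℕ) := by
  rw [normalizedArrowPolynomial_eq hr D hD]
  constructor
  · intro h
    by_contra hn
    refine termsValue_ne_one (fun t ht => ?_) ?_ h
    · obtain ⟨t', ht', rfl⟩ := List.mem_map.1 ht
      exact ((table_bounds r hr).2.1 t' ht').1
    · obtain ⟨t, ht, h1, h2⟩ := (table_nontrivial r hr hn).2
      refine ⟨_, List.mem_map_of_mem ht, h1.imp_left fun h3 h4 => h3 (by simp only at h4; linarith),
        ?_⟩
      simp only
      rw [coeffSum_scaleTerms]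
      exact mul_ne_zero (Units.ne_zero _) h2
  · intro h
    obtain ⟨h1, h2⟩ := table_trivial r hr h
    rw [h1, h2]
    simp [termsValue, A_zero, prodK, scaleTerms]

end VirtualKnot

namespace VirtualKnot

/-! ### Planar diagrams of the knots of the table -/

/-- Insert visits to virtual crossings into a code: `0` stands for the next letter of the code, and
`2 * k + 1` and `2 * k` for the visits to the virtual crossing `k + 4` from the right and from the
left. -/
def insertVirtual : List Passage → List ℕ → List Passage
  | w, [] => w
  | w, k :: l =>
    if k = 0 then w.take 1 ++ insertVirtual (w.drop 1) l
    else ⟨k / 2 + 4, .virt, decide (k % 2 = 1)⟩ :: insertVirtual w l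

set_option maxHeartbeats 1000000 in
/-- The virtual crossings of planar diagrams of the knots of the table. -/
def virtualVisits : List (List ℕ) := [
  [0,2,0,0,3,0,0,4,0,0,5], [0,2,0,0,3,0,0,5,0,0,4], [0,2,0,0,3,0,4,0,0,5], [0,2,0,0,3,0,0,4,0,0,5],
  [0,2,0,0,3,0,0,5,0,0,4], [0,2,0,0,3,0,0,0,4,0,0,5], [0,2,0,0,3,0,0,5,0,0,4],
  [0,2,0,0,3,0,0,4,0,0,5], [0,0,2,0,5,0,6,3,0,0,0,7,0,4], [0,2,0,0,4,0,3,0,0,5],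
  [0,2,0,0,5,0,3,0,6,0,0,4,0,7], [0,2,0,0,0,5,3,0,0,0,4], [0,0,3,0,4,0,0,2,0,5],
  [0,3,0,0,5,7,0,0,2,0,6,0,0,4], [0,2,0,0,4,0,3,0,0,5], [0,0,2,0,5,0,6,3,0,0,0,7,0,4],
  [0,2,0,0,5,0,3,0,6,0,0,4,0,7], [0,0,3,0,4,0,0,2,0,5], [0,3,0,0,5,0,6,0,2,0,0,7,0,4],
  [0,0,3,0,0,5,0,2,0,0,4], [0,3,0,0,5,7,0,0,2,0,6,0,0,4], [0,2,0,0,5,0,7,0,3,0,0,6,0,4],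
  [0,3,0,0,0,4,0,0,2,0,5], [2,0,0,5,0,3,0,7,0,0,4,0,6], [0,0,2,0,0,4,0,3,0,0,5],
  [0,2,0,0,5,0,7,0,3,0,0,6,0,4], [0,3,0,0,0,4,0,0,2,0,5], [0,0,3,0,5,0,7,0,0,2,0,6,0,4],
  [2,0,0,4,0,3,0,6,0,0,5,0,7], [0,2,0,0,4,0,7,0,0,5,3,0,0,6], [0,2,0,0,0,0,4,0,3,0,0,5],
  [0,2,0,0,0,5,0,0,3,0,4], [0,3,0,0,5,0,6,0,0,0,2,7,0,4], [0,0,3,0,4,0,7,0,0,5,0,2,0,6],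
  [0,0,3,0,0,0,4,0,0,2,0,5], [0,0,3,0,0,5,0,0,0,2,4], [0,2,0,0,4,0,0,5,3], [0,0,2,0,0,4,0,3,0,0,5],
  [0,2,0,0,5,0,7,0,3,0,0,6,0,4], [0,0,2,0,5,0,0,3,0,4], [0,0,3,0,4,0,0,5,0,2],
  [2,0,0,5,0,3,0,7,0,0,4,0,6], [0,2,0,0,0,0,3], [0,0,2,0,0,4,0,3,0,0,5],
  [0,2,0,0,5,0,7,0,3,0,0,6,0,4], [2,0,0,4,0,3,0,0,5], [0,0,3,0,5,0,7,0,0,2,0,6,0,4],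
  [0,2,0,0,4,0,7,0,0,5,3,0,0,6], [2,0,0,4,0,3,0,6,0,0,5,0,7], [0,2,0,0,0,5,0,0,3,0,4],
  [0,2,0,0,0,0,4,0,3,0,0,5], [0,3,0,0,5,0,6,0,0,0,2,7,0,4], [0,2,0,0,3,4,0,0,5],
  [0,2,0,0,0,4,0,0,5,0,3], [0,0,3,0,0,4,0,0,5,0,0,2], [0,0,3,0,0,5,0,0,4,0,0,2],
  [0,2,0,0,5,0,3,0,6,0,0,4,0,7], [0,0,2,0,5,0,6,3,0,0,0,7,0,4], [0,3,0,0,5,7,0,0,2,0,6,0,0,4],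
  [0,0,3,0,4,0,0,2,0,5], [0,0,2,0,5,0,0,3,0,4], [0,2,0,0,5,0,7,0,3,0,0,6,0,4],
  [0,0,2,0,0,4,0,3,0,0,5], [0,2,0,0,4,0,0,5,3], [0,3,0,0,5,0,0,0,2,4], [2,0,0,5,0,3,0,7,0,0,4,0,6],
  [0,3,0,0,0,4,0,0,2,0,5], [0,0,3,0,4,0,0,5,0,2], [0,2,0,0,0,0,4,0,3,0,0,5],
  [2,0,0,4,0,3,0,6,0,0,5,0,7], [0,2,0,0,4,0,7,0,0,5,3,0,0,6], [0,3,0,0,5,0,6,0,0,0,2,7,0,4],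
  [0,2,0,0,3,0,0,4,0,0,5], [0,2,0,0,3,0,5,0,0,4], [0,2,0,0,3,4,0,0,5], [0,0,3,0,0,5,0,0,4,0,0,2],
  [0,0,3,0,0,4,0,0,5,0,0,2], [0,2,0,0,5,0,7,0,3,0,0,6,0,4], [2,0,0,5,0,3,0,7,0,0,4,0,6],
  [0,2,0,0,5,0,7,0,3,0,0,6,0,4], [0,0,3,0,5,0,7,0,0,2,0,6,0,4], [0,0,2,0,4,0,0,5,0,3],
  [0,2,0,4,0,0,7,0,3,0,5,0,0,6], [0,3,0,5,0,0,0,0,4,0,2], [0,2,0,4,0,0,7,0,3,0,5,0,0,6],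
  [0,3,0,5,0,0,0,0,2,0,4], [0,2,0,4,0,0,7,0,3,0,5,0,0,6], [0,0,3,0,5,0,7,0,0,4,0,2,0,6],
  [0,2,0,4,0,0,7,0,3,0,5,0,0,6], [2,0,0,5,0,7,0,3,0,0,4,0,6], [0,2,0,4,0,6,0,0,3,0,5,0,7],
  [0,2,0,4,0,6,0,0,5,0,7,0,3], [0,2,0,4,0,0,7,0,3,0,5,0,0,6], [0,2,0,0,3],
  [0,2,0,0,3,0,5,0,7,0,0,4,0,6], [0,0,2,0,4,0,0,5,0,3], [0,2,0,4,0,0,7,0,3,0,5,0,0,6],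
  [0,2,0,4,0,0,7,0,3,0,5,0,0,6], [0,2,0,0,3,0,0,4,0,0,5], [0,2,0,0,0,0,3],
  [0,2,0,0,5,0,7,0,3,0,0,4,0,6], [0,2,0,4,0,0,7,0,3,0,5,0,0,6], [0,2,0,0,5,0,7,0,3,0,0,4,0,6],
  [0,2,0,4,0,0,7,0,3,0,5,0,0,6], [0,2,0,0,3,0,0,4,0,0,5], [2,0,4,0,0,5,0,3],
  [2,0,0,5,0,7,0,3,0,0,4,0,6], []]

/-- The number of a dart. -/
def dartNumber {w : List Passage} (x : Dart w) : ℕ := 2 * x.1 + x.2.toNat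

/-- Counting the faces by labels of the darts that do not change when turning left. -/
theorem isPlanar_of_labels {w : List Passage} (hw : IsGaussWord w) (hne : w ≠ []) (labels : List ℕ)
    (hlen : labels.length = 2 * w.length)
    (hc : ∀ p d, labels[dartNumber (turnLeft w (p, d))]? = labels[dartNumber (w := w) (p, d)]?)
    (hcard : w.length / 2 + 2 ≤ labels.dedup.length) : IsPlanar w := by
  set c : Dart w → Option ℕ := fun x => labels[dartNumber x]? with hcdef
  have hc' : ∀ x, c (turnLeft w x) = c x := fun x => hc x.1 x.2
  -- The upper bound on the number of faces holds for every Gauss word, so only enough distinct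
  -- labels have to be exhibited.
  refine .inr (le_antisymm (card_faces_le hw hne) (hcard.trans ?_))
  rw [← List.card_toFinset, ← Finset.card_image_of_injective _ (Option.some_injective ℕ)]
  refine (Finset.card_le_card (t := Finset.univ.image c) fun n hn => ?_).trans ?_
  · obtain ⟨m, hm, rfl⟩ := Finset.mem_image.1 hn
    obtain ⟨i, hi, rfl⟩ := List.getElem_of_mem (List.mem_toFinset.1 hm)
    refine Finset.mem_image.2 ⟨(⟨i / 2, by omega⟩, decide (i % 2 = 1)), Finset.mem_univ _, ?_⟩
    have : dartNumber (w := w) (⟨i / 2, by omega⟩, decide (i % 2 = 1)) = i := by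
      rcases Nat.mod_two_eq_zero_or_one i with h | h <;> simp [dartNumber, h] <;> omega
    simp only [hcdef, this, List.getElem?_eq_getElem hi]
  have hinj := turnLeft_injective hw
  -- Labels unchanged by left turns are constant on faces, so there are at least as many faces as
  -- labels.
  have hfac : c.FactorsThrough (orbit w (turnLeft w)) := by
    intro x y h
    have hxy : x ∈ orbit w (turnLeft w) y := h ▸ self_mem_orbit hinj x
    obtain ⟨k, rfl⟩ := (mem_orbit hinj).1 hxy
    clear h hxy
    induction k with
    | zero => rfl
    | succ k ih => rw [Function.iterate_succ_apply', hc', ih]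
  have himage : Finset.univ.image c =
      (faces w).image (Function.extend (orbit w (turnLeft w)) c fun _ => none) := by
    rw [faces, Finset.image_image]
    exact Finset.image_congr fun x _ => (hfac.extend_apply _ x).symm
  rw [himage]
  exact Finset.card_image_le

/-- The numbers of the darts that follow the darts number `0, 1, …` around the faces. -/
def nextOnFace (w : List Passage) : List ℕ :=
  w.flatMap fun x => [false, true].map fun d =>
    if xor d x.toLeft then 2 * ((w.idxOf x.opp + 1) % w.length) + 1
    else 2 * ((w.idxOf x.opp + w.length - 1) % w.length)

/-- The least number met on the way from `j` to `i`. -/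
def leastUntil (next : List ℕ) (i : ℕ) : ℕ → ℕ → ℕ
  | 0, j => j
  | k + 1, j => if j = i then j else min j (leastUntil next i k (next.getD j i))

/-- For every dart the least number on its face. -/
def faceLabels (w : List Passage) : List ℕ :=
  (nextOnFace w).zipIdx.map fun x => leastUntil (nextOnFace w) x.2 (2 * w.length) x.1

/-- A criterion for planarity that can be computed. -/
def HasFaceLabels (w : List Passage) (labels : List ℕ) : Prop :=
  w ≠ [] ∧ labels.length = 2 * w.length ∧
  (∀ p d, labels[dartNumber (turnLeft w (p, d))]? = labels[dartNumber (w := w) (p, d)]?) ∧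
  w.length / 2 + 2 ≤ labels.dedup.length

instance (w : List Passage) (labels : List ℕ) : Decidable (HasFaceLabels w labels) :=
  inferInstanceAs (Decidable (_ ∧ _))

/-- The output of `faceLabels` is used only as a certificate: `HasFaceLabels` checks the invariance
under left turns and the number of labels directly. -/
theorem table_planar : ∀ x ∈ table.zip virtualVisits, IsGaussWord (insertVirtual x.1.code x.2) ∧
    gaussCode (insertVirtual x.1.code x.2) = x.1.code ∧
    HasFaceLabels (insertVirtual x.1.code x.2) (faceLabels (insertVirtual x.1.code x.2)) := by
  decide +kernel

theorem exists_diagram {r : Row} (hr : r ∈ table) :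
    ∃ D : Diagram, gaussCode D.word = r.code := by
  have h : table = (table.zip virtualVisits).map Prod.fst :=
    (List.map_fst_zip (by decide +kernel)).symm
  rw [h] at hr
  obtain ⟨x, hx, rfl⟩ := List.mem_map.1 hr
  obtain ⟨h1, h2, h3, h4, h5, h6⟩ := table_planar x hx
  exact ⟨⟨insertVirtual x.1.code x.2, h1, isPlanar_of_labels h1 h3 _ h4 h5 h6⟩, h2⟩

end VirtualKnot

theorem mainTheorem1 :
    -- every knot of the table has virtual knot diagrams
    (∀ r ∈ VirtualKnot.table, ∃ D : VirtualKnot.Diagram, VirtualKnot.gaussCode D.word = r.code) ∧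
    -- the computation and the bounds, for each knot `4.n` and each of its diagrams from the table
    (∀ r ∈ VirtualKnot.table, ∀ D : VirtualKnot.Diagram, VirtualKnot.gaussCode D.word = r.code →
      VirtualKnot.arrowPolynomial D.word = r.polynomial ∧
      VirtualKnot.maxKDegree (VirtualKnot.arrowPolynomial D.word) = r.bound ∧
      r.bound ≤ D.virtualCrossingNumber ∧
      r.bound ≤ 3 ∧
      (VirtualKnot.arrowPolynomial D.word = 1 ↔ r.number ∈ ({46, 72, 98, 107} : Finset ℕ)) ∧
      (VirtualKnot.normalizedArrowPolynomial D.word = 1 ↔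
        r.number ∈ ({46, 72, 98, 107} : Finset ℕ))) := by
  refine ⟨fun r hr => VirtualKnot.exists_diagram hr, fun r hr D hD => ?_⟩
  have hbound : VirtualKnot.maxKDegree (VirtualKnot.arrowPolynomial D.word) = r.bound := by
    rw [VirtualKnot.arrowPolynomial_of_mem_table hr D hD, VirtualKnot.Row.polynomial_eq]
    exact VirtualKnot.maxKDegree_termsValue (VirtualKnot.table_bounds r hr).2.1
      (VirtualKnot.table_bounds r hr).2.2
  exact ⟨VirtualKnot.arrowPolynomial_of_mem_table hr D hD, hbound,
    hbound ▸ VirtualKnot.maxKDegree_le_virtualCrossingNumber D, (VirtualKnot.table_bounds r hr).1,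
    VirtualKnot.arrowPolynomial_eq_one_iff hr D hD,
    VirtualKnot.normalizedArrowPolynomial_eq_one_iff hr D hD⟩
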